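/- Let $m\ge 2$ be an integer. Let $N_1=\chi_{[0,1)}$ and $N_n(x)=\int_0^1 N_{n-1}(x-y)\,dy$ for $n\ge 2$ be the cardinal B-splines, and write $\widehat f(\lambda)=\frac{1}{\sqrt{2\pi}}\int_{\mathbb R} f(t)e^{-i\lambda t}\,dt$. Put $$P_m\!\left(\cos\tfrac{\theta}{2}\right)=2\pi\sum_{j\in\mathbb Z}\left|\widehat{N_m}(\theta+2\pi j)\right|^2,\qquad c_j=\frac1{2\pi}\int_{-\pi}^{\pi}\frac{\cos j\theta}{\sqrt{P_m(\cos\frac{\theta}{2})}}\,d\theta,\qquad \varphi_m(x)=\sum_{j\in\mathbb Z}c_jN_m(x-j).$$ The integer translates of $\varphi_m$ are orthonormal in $L_2(\mathbb R)$. Let $a_j=2\int_{\mathbb R}\varphi_m(x)\varphi_m(2x-j)\,dx$ be the scaling constants of $\varphi_m$, and let $$\psi_m(x)=\sum_{j\in\mathbb Z}(-1)^ja_{1-j}\,\varphi_m(2x-j),\qquad \gamma_j=(-1)^j\sum_{k\in\mathbb Z}(-1)^ka_{k-j+1}c_k\quad(j\in\mathbb Z).$$ Let $\lambda_1>\lambda_2>\cdots$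 be the negative roots of the Euler–Frobenius polynomial $(2m-1)!\,z^{m-1}\sum_{k=-m+1}^{m-1}N_{2m}(m+k)z^k$ in decreasing order (so by increasing absolute value), and put $$\mu_{m-1}=\frac{(\lambda_{m-1}+1)^2}{4|\lambda_{m-1}|},\qquad \alpha_0=\ln\left[\frac{\sqrt{\mu_{m-1}+1}+\sqrt{\mu_{m-1}}}{\sqrt{\mu_{m-1}+1}-\sqrt{\mu_{m-1}}}\right].$$ Then the series defining $\psi_m(x)$ (for every $x\in\mathbb R$) and $\gamma_j$ (for every $j\in\mathbb Z$) converge absolutely, and for every $x\in\mathbb R$ $$\varphi_m(x)=\sum_{j\in\mathbb Z}a_j\varphi_m(2x-j),\qquad \psi_m(x)=\sum_{j\in\mathbb Z}\gamma_jN_m(2x-j).$$ Moreover, with $r=\left[\frac{|j|+1}{2}\right]$ (integer part), there are nonzero real constants $E_j$, depending (for the given $m$) only on the sign and the parity of $j$, such that $$\gamma_j\sim(-1)^rE_j\,\frac{e^{-\alpha_0 r}}{\sqrt r}\qquad\text{as }|j|\to\infty .$$ -/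

import Mathlib

open MeasureTheory Filter Asymptotics

noncomputable section

namespace BSplineWavelet

/-- The cardinal B-spline `N_m`, with `N_1 = χ_[0,1)` and `N_m(x) = ∫_0^1 N_{m-1}(x - y) dy` for
`m ≥ 2`. (The value at the unused index `0` is irrelevant.) -/
def bspline : ℕ → ℝ → ℝ
  | 0 => fun _ => 0
  | 1 => Set.indicator (Set.Ico (0 : ℝ) 1) (fun _ => 1)
  | (n + 2) => fun x => ∫ y in (0 : ℝ)..1, bspline (n + 1) (x - y)

/-- The Fourier transform `(2π)^(-1/2) ∫ f(t) e^{-iλt} dt`. -/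
def fourierTr (f : ℝ → ℝ) (l : ℝ) : ℂ :=
  ((1 / Real.sqrt (2 * Real.pi) : ℝ) : ℂ) *
    ∫ t : ℝ, (f t : ℂ) * Complex.exp (-(Complex.I * (l : ℂ) * (t : ℂ)))

/-- The function `θ ↦ P_m(cos(θ/2)) = 2π ∑_{j ∈ ℤ} |N̂_m(θ + 2πj)|²`. -/
def Pcos (m : ℕ) (θ : ℝ) : ℝ :=
  2 * Real.pi * ∑' j : ℤ, ‖fourierTr (bspline m) (θ + 2 * Real.pi * (j : ℝ))‖ ^ 2

/-- `c_j = (1/2π) ∫_{-π}^{π} cos(jθ) / √(P_m(cos(θ/2))) dθ`. -/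
def coeffC (m : ℕ) (j : ℤ) : ℝ :=
  1 / (2 * Real.pi) *
    ∫ θ in (-Real.pi)..Real.pi, Real.cos ((j : ℝ) * θ) / Real.sqrt (Pcos m θ)

/-- The orthonormal scaling function `φ_m(x) = ∑_j c_j N_m(x - j)`
(for each `x` only finitely many terms are nonzero). -/
def scalingFun (m : ℕ) (x : ℝ) : ℝ :=
  ∑' j : ℤ, coeffC m j * bspline m (x - (j : ℝ))

/-- The scaling constants `a_j` of `φ_m`: the coefficients of `φ_m` in the orthogonal system
`φ_m(2x - j)`, `j ∈ ℤ`, each of whose members has squared `L²` norm `1/2`. -/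
def scalingConst (m : ℕ) (j : ℤ) : ℝ :=
  2 * ∫ x : ℝ, scalingFun m x * scalingFun m (2 * x - (j : ℝ))

/-- The wavelet `ψ_m(x) = ∑_j (-1)^j a_{1-j} φ_m(2x - j)`. -/
def wavelet (m : ℕ) (x : ℝ) : ℝ :=
  ∑' j : ℤ, (-1 : ℝ) ^ j * scalingConst m (1 - j) * scalingFun m (2 * x - (j : ℝ))

/-- `γ_j = (-1)^j ∑_k (-1)^k a_{k-j+1} c_k`. -/
def coeffGamma (m : ℕ) (j : ℤ) : ℝ :=
  (-1 : ℝ) ^ j * ∑' k : ℤ, (-1 : ℝ) ^ k * scalingConst m (k - j + 1) * coeffC m k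

/-- The Euler–Frobenius polynomial
`(2m-1)! z^{m-1} ∑_{k=-m+1}^{m-1} N_{2m}(m+k) z^k = (2m-1)! ∑_{i=0}^{2m-2} N_{2m}(i+1) z^i`,
of degree `2m - 2`. -/
def eulerFrobenius (m : ℕ) : Polynomial ℝ :=
  ∑ i ∈ Finset.range (2 * m - 1),
    Polynomial.C (((2 * m - 1).factorial : ℝ) * bspline (2 * m) ((i : ℝ) + 1)) *
      Polynomial.X ^ i

/-- `λ_k`, `k = 1, 2, …`: the negative roots of the Euler–Frobenius polynomial, listed in
decreasing order `0 > λ_1 > λ_2 > ⋯` (that is, by increasing absolute value). -/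
def efRoot (m k : ℕ) : ℝ :=
  (((eulerFrobenius m).roots.toFinset.filter (fun x => x < 0)).sort (fun x y => y ≤ x)).getD
    (k - 1) 0

/-- `μ_k = (λ_k + 1)² / (4 |λ_k|)`. -/
def mu (m k : ℕ) : ℝ := (efRoot m k + 1) ^ 2 / (4 * |efRoot m k|)

/-- `α₀ = ln [(√(μ_{m-1} + 1) + √μ_{m-1}) / (√(μ_{m-1} + 1) - √μ_{m-1})]`. -/
def alpha0 (m : ℕ) : ℝ :=
  Real.log ((Real.sqrt (mu m (m - 1) + 1) + Real.sqrt (mu m (m - 1))) /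
    (Real.sqrt (mu m (m - 1) + 1) - Real.sqrt (mu m (m - 1))))

end BSplineWavelet

end

open BSplineWavelet

/-! Write `w = e^{iθ}` and P(θ) for `Pcos m θ`. Each sequence in play has an explicit Laurent series
(symbol) on the unit circle: `coeffC` has P(θ)^(-1/2), and `scalingConst` has 2^(1-m) (1+w)^m √P(θ)
/ √P(2θ). Convolution becomes multiplication and Fourier coefficients are unique, so the refinement
equation and the B-spline expansion of ψ reduce to identities between symbols, carried back to
functions by absolutely convergent rearrangement (`dconv_apply_bounded`).

The symbol of γ factors as D(w²) G(w). Here G (`gammaFactor`) is a Laurent polynomial and D(w²) =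
1/√(P(2θ) P(θ) P(θ+π)); the product P(θ)P(θ+π) depends on 2θ only. By Poisson summation P is the
symbol of the knot values of N_{2m}, hence a positive constant times ∏ |1 - r w|² over the
Euler–Frobenius roots r in (-1, 0) (`Pcos_eq_norm_prod`). So D(v) is a constant times ∏ |1 - r v|⁻¹
∏ |1 - r² v|⁻¹. Its dominant singularity outside the circle is of inverse square root type, at v =
1/l with l = λ_{m-1} = -e^{-α₀}, whence D_n ~ X lⁿ/√n with X ≠ 0 (`exists_asym_prod`). Convolving
with the finite sequence g of coefficients of G gives γ_{2p+s} ~ X S_s l^p/√p with S_s = ∑ g_{2i+s}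
l^{-i} (`singularSum`). Negative indices follow from the symmetry `coeffGamma_neg`.

The delicate point is S_s ≠ 0. At the imaginary point z₀ with z₀² = 1/l one has G(z₀) = S_0 + z₀
S_1, so G(z₀) must be neither real nor imaginary. The two-scale relation for P, continued to
imaginary 2cos θ, says that a certain phase equals π/2 at the first zero (`phase_at_first_zero`);
this places arg G(z₀), up to a multiple of π/2, strictly between consecutive multiples of π/4
(`singular_coeff_ne_zero`). -/

namespace BSplineWavelet

/-! ### Sequences on ℤ and their symbols. -/

/-- The `d`-step convolution of two real sequences on `ℤ`. -/
noncomputable def dconv (d : ℤ) (f g : ℤ → ℝ) (j : ℤ) : ℝ := ∑' k : ℤ, f k * g (j - d * k)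

/-- The Laurent series with coefficients `f` has sum `F` at the point `w`. -/
def SymAt (f : ℤ → ℝ) (w F : ℂ) : Prop := HasSum (fun n : ℤ => (f n : ℂ) * w ^ n) F

/-- One rearrangement of a double sum, for an arbitrary test sequence `B`: powers of `w` give
products of symbols, and values of shifted B-splines give identities between functions. -/
theorem dconv_hasSum {f g : ℤ → ℝ} {d : ℤ} {B : ℤ → ℂ}
    (h : Summable fun p : ℤ × ℤ => (f p.1 : ℂ) * g p.2 * B (d * p.1 + p.2)) :
    HasSum (fun n => (dconv d f g n : ℂ) * B n)
      (∑' p : ℤ × ℤ, (f p.1 : ℂ) * g p.2 * B (d * p.1 + p.2)) ∧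
    HasSum (fun j => (f j : ℂ) * ∑' k, (g k : ℂ) * B (d * j + k))
      (∑' p : ℤ × ℤ, (f p.1 : ℂ) * g p.2 * B (d * p.1 + p.2)) := by
  constructor
  · let e : ℤ × ℤ ≃ ℤ × ℤ :=
      { toFun := fun p => (p.2, p.1 - d * p.2)
        invFun := fun p => (d * p.1 + p.2, p.1)
        left_inv := fun p => by ext <;> simp
        right_inv := fun p => by ext <;> simp }
    have h1 := (e.hasSum_iff (f := fun p : ℤ × ℤ => (f p.1 : ℂ) * g p.2 * B (d * p.1 + p.2))).2
      h.hasSum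
    have h2 : ∀ n : ℤ, HasSum (fun k : ℤ => (f k : ℂ) * g (n - d * k) * B n)
        ((dconv d f g n : ℂ) * B n) := by
      intro n
      have h3 := h1.summable.prod_factor n
      simp only [Function.comp_apply, e, Equiv.coe_fn_mk, add_sub_cancel] at h3
      convert! h3.hasSum using 1
      rw [tsum_mul_right, dconv, Complex.ofReal_tsum]
      simp
    refine h1.prod_fiberwise fun n => ?_
    simpa only [Function.comp_apply, e, Equiv.coe_fn_mk, add_sub_cancel] using h2 n
  · refine h.hasSum.prod_fiberwise fun j => ?_
    convert! (h.prod_factor j).hasSum using 1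
    simp only [mul_assoc, tsum_mul_left]

/-- The step `d` appears as the argument `w ^ d` of the first symbol: `d = 2` is upsampling, `d =
-1` correlation. -/
theorem SymAt.dconv {f g : ℤ → ℝ} {d : ℤ} {w F G : ℂ} (hw : w ≠ 0) (hf : SymAt f (w ^ d) F)
    (hg : SymAt g w G) : SymAt (dconv d f g) w (F * G) := by
  have hs := summable_mul_of_summable_norm hf.summable.norm hg.summable.norm
  have hE : (fun p : ℤ × ℤ => (f p.1 : ℂ) * (w ^ d) ^ p.1 * (g p.2 * w ^ p.2)) =
      fun p : ℤ × ℤ => (f p.1 : ℂ) * g p.2 * w ^ (d * p.1 + p.2) := by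
    funext p
    rw [zpow_add₀ hw, zpow_mul]; ring
  have := (dconv_hasSum (d := d) (B := fun n => w ^ n) (hE ▸ hs)).1
  rw [← hE] at this
  rw [← tsum_mul_tsum_of_summable_norm hf.summable.norm hg.summable.norm, hf.tsum_eq,
    hg.tsum_eq] at this
  exact this

theorem SymAt.summable {f : ℤ → ℝ} {θ : ℝ} {F : ℂ} (h : SymAt f (Complex.exp (θ * Complex.I)) F) :
    Summable fun n => |f n| := by
  have := (HasSum.summable h).norm
  simpa [norm_zpow, Complex.norm_exp_ofReal_mul_I] using this

theorem dconv_apply_bounded {f g : ℤ → ℝ} (hf : Summable fun n => |f n|)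
    (hg : Summable fun n => |g n|) (d : ℤ) {B : ℤ → ℝ} {M : ℝ} (hB : ∀ n, |B n| ≤ M) :
    HasSum (fun j => f j * ∑' k, g k * B (d * j + k)) (∑' n, dconv d f g n * B n) := by
  have hs : Summable fun p : ℤ × ℤ => (f p.1 : ℂ) * g p.2 * ((B (d * p.1 + p.2) : ℝ) : ℂ) := by
    refine Summable.of_norm_bounded (g := fun p : ℤ × ℤ => |f p.1| * |g p.2| * M)
      (Summable.mul_right _ ?_) fun p => ?_
    · exact summable_mul_of_summable_norm hf.norm hg.norm
    · simp only [norm_mul, Complex.norm_real, Real.norm_eq_abs]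
      gcongr
      exact hB _
  obtain ⟨h1, h2⟩ := dconv_hasSum (d := d) (B := fun n => ((B n : ℝ) : ℂ)) hs
  rw [← h1.tsum_eq] at h2
  rw [← Complex.hasSum_ofReal]
  convert! h2 using 1
  · push_cast; rfl
  · push_cast; rfl

theorem SymAt.reverse {f : ℤ → ℝ} {w F : ℂ} (h : SymAt f w⁻¹ F) :
    SymAt (fun n => f (-n)) w F := by
  have := (Equiv.neg ℤ).hasSum_iff.2 h
  unfold SymAt
  convert! this using 2 with n
  simp

/-- Substitute `k = 1 - j` and use (-w)^(1-k) = -w (-w⁻¹)^k. -/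
theorem SymAt.modulate {f : ℤ → ℝ} {w F : ℂ} (hw : w ≠ 0) (h : SymAt f (-w⁻¹) F) :
    SymAt (fun j => (-1 : ℝ) ^ j * f (1 - j)) w (-w * F) := by
  have := (Equiv.subLeft (1 : ℤ)).hasSum_iff.2 (HasSum.mul_left (-w) h)
  unfold SymAt
  convert! this using 2 with n
  have h1 : (-w⁻¹ : ℂ) = (-w)⁻¹ := by rw [inv_neg]
  simp only [Function.comp_apply, Equiv.subLeft_apply]
  rw [h1, inv_zpow', neg_sub, zpow_sub_one₀ (neg_ne_zero.2 hw),
    show (-w) = (-1) * w by ring, mul_zpow]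
  push_cast
  field_simp

theorem SymAt.integral {f : ℤ → ℝ} {F : ℝ → ℂ}
    (h : ∀ θ : ℝ, SymAt f (Complex.exp (θ * Complex.I)) (F θ)) (j : ℤ) :
    ∫ θ in (-Real.pi)..Real.pi, F θ * Complex.exp (-(j * θ * Complex.I)) = 2 * Real.pi * f j := by
  have hs := (h 0).summable
  have key : HasSum (fun n : ℤ => ∫ θ in (-Real.pi)..Real.pi,
      (f n : ℂ) * Complex.exp (((n - j : ℤ) : ℂ) * θ * Complex.I))
      (∫ θ in (-Real.pi)..Real.pi, F θ * Complex.exp (-(j * θ * Complex.I))) := by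
    refine intervalIntegral.hasSum_integral_of_dominated_convergence (fun n _ => |f n|) ?_ ?_ ?_ ?_ ?_
    · intro n
      exact (by fun_prop : Continuous _).aestronglyMeasurable
    · intro n
      refine Eventually.of_forall fun θ _ => ?_
      rw [norm_mul, show (((n - j : ℤ) : ℂ) * θ * Complex.I) =
        (((n - j : ℤ) * θ : ℝ) : ℂ) * Complex.I by push_cast; ring,
        Complex.norm_exp_ofReal_mul_I]
      simp
    · exact Eventually.of_forall fun θ _ => hs
    · exact intervalIntegrable_const
    · refine Eventually.of_forall fun θ _ => ?_
      convert! HasSum.mul_right (Complex.exp (-(j * θ * Complex.I))) (h θ) using 2 with n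
      rw [← Complex.exp_int_mul, mul_assoc (f n : ℂ), ← Complex.exp_add]
      congr 2
      push_cast; ring
  have h2 := hasSum_single (f := fun n : ℤ => ∫ θ in (-Real.pi)..Real.pi,
      (f n : ℂ) * Complex.exp (((n - j : ℤ) : ℂ) * θ * Complex.I)) j ?_
  · rw [key.unique h2]
    simp
    left; ring
  · intro n hn
    have hne : ((n - j : ℤ) : ℂ) ≠ 0 := by exact_mod_cast sub_ne_zero.2 hn
    rw [intervalIntegral.integral_const_mul]
    have : ∀ θ : ℝ, Complex.exp (((n - j : ℤ) : ℂ) * θ * Complex.I) =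
        Complex.exp (((n - j : ℤ) : ℂ) * Complex.I * θ) := fun θ => by congr 1; ring
    simp_rw [this]
    rw [integral_exp_mul_complex (mul_ne_zero hne Complex.I_ne_zero)]
    have h3 : Complex.exp (((n - j : ℤ) : ℂ) * Complex.I * ((-Real.pi : ℝ) : ℂ)) =
        Complex.exp (((n - j : ℤ) : ℂ) * Complex.I * (Real.pi : ℂ)) := by
      rw [Complex.exp_eq_exp_iff_exists_int]
      exact ⟨-(n - j), by push_cast; ring⟩
    rw [h3]; simp

/-- Every later identity between coefficient sequences is proved by comparing symbols through this
lemma. -/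
theorem SymAt.unique {f g : ℤ → ℝ} {F : ℝ → ℂ}
    (hf : ∀ θ : ℝ, SymAt f (Complex.exp (θ * Complex.I)) (F θ))
    (hg : ∀ θ : ℝ, SymAt g (Complex.exp (θ * Complex.I)) (F θ)) : f = g := by
  funext j
  have h1 := SymAt.integral hf j
  rw [SymAt.integral hg j] at h1
  have : (2 * Real.pi : ℂ) ≠ 0 := by
    simp [Real.pi_ne_zero]
  exact_mod_cast (mul_left_cancel₀ this h1).symm

theorem SymAt.continuous {f : ℤ → ℝ} {F : ℝ → ℂ}
    (h : ∀ θ : ℝ, SymAt f (Complex.exp (θ * Complex.I)) (F θ)) : Continuous F := by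
  have : F = fun θ : ℝ => ∑' n : ℤ, (f n : ℂ) * Complex.exp (θ * Complex.I) ^ n :=
    funext fun θ => (HasSum.tsum_eq (h θ)).symm
  rw [this]
  refine continuous_tsum (u := fun n => |f n|) (fun n => ?_) (h 0).summable fun n θ => ?_
  · simp_rw [← Complex.exp_int_mul]
    fun_prop
  · simp [norm_zpow, Complex.norm_exp_ofReal_mul_I]

theorem SymAt.cos_integral {f : ℤ → ℝ} {F : ℝ → ℝ}
    (h : ∀ θ : ℝ, SymAt f (Complex.exp (θ * Complex.I)) (F θ : ℂ)) (j : ℤ) :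
    1 / (2 * Real.pi) * ∫ θ in (-Real.pi)..Real.pi, Real.cos (j * θ) * F θ = f j := by
  have h1 := SymAt.integral h j
  have hc : Continuous fun θ => (F θ : ℂ) := SymAt.continuous h
  have h2 : (∫ θ in (-Real.pi)..Real.pi, (F θ : ℂ) * Complex.exp (-(j * θ * Complex.I))).re =
      ∫ θ in (-Real.pi)..Real.pi, Real.cos (j * θ) * F θ := by
    have hi : IntervalIntegrable (fun θ : ℝ => (F θ : ℂ) * Complex.exp (-(j * θ * Complex.I)))
        volume (-Real.pi) Real.pi :=
      (hc.mul (by fun_prop)).intervalIntegrable _ _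
    have := Complex.reCLM.intervalIntegral_comp_comm hi
    simp only [Complex.reCLM_apply] at this
    rw [← this]
    refine intervalIntegral.integral_congr fun θ _ => ?_
    have : (-(j * θ * Complex.I) : ℂ) = ((-(j * θ) : ℝ) : ℂ) * Complex.I := by push_cast; ring
    simp only [this]
    rw [Complex.re_ofReal_mul, Complex.exp_ofReal_mul_I_re, Real.cos_neg]
    ring
  rw [← h2, h1]
  have : (2 * Real.pi * (f j : ℂ)).re = 2 * Real.pi * f j := by
    rw [show (2 * Real.pi * (f j : ℂ)) = ((2 * Real.pi * f j : ℝ) : ℂ) by push_cast; ring]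
    exact Complex.ofReal_re _
  rw [this]
  field_simp

end BSplineWavelet

/-! ### Asymptotics lⁿ/√n of coefficients at an inverse square root singularity. -/

namespace BSplineWavelet

open scoped Topology

/-- The weight `√(|n| + 1)` on `ℤ`. -/
noncomputable def wt (n : ℤ) : ℝ := Real.sqrt (|(n : ℝ)| + 1)

theorem wt_pos (n : ℤ) : 0 < wt n := Real.sqrt_pos.2 (by positivity)

/-- Submultiplicativity of the weight supplies the dominating series in `Asym.dconv`. -/
theorem wt_le_mul (n k : ℤ) : wt n ≤ wt (n - k) * wt k := by
  unfold wt
  rw [← Real.sqrt_mul (by positivity)]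
  apply Real.sqrt_le_sqrt
  have : |(n : ℝ)| ≤ |((n - k : ℤ) : ℝ)| + |(k : ℝ)| := by
    have := abs_add_le ((n : ℝ) - k) k
    push_cast
    simpa using this
  nlinarith [abs_nonneg ((n - k : ℤ) : ℝ), abs_nonneg (k : ℝ)]

theorem wt_nat (n : ℕ) : wt n = Real.sqrt (n + 1) := by
  simp [wt]

theorem tendsto_wt_div (k : ℤ) : Tendsto (fun n : ℤ => wt n / wt (n - k)) atTop (𝓝 1) := by
  have h1 : Tendsto (fun n : ℤ => 1 + (k : ℝ) / ((n : ℝ) - k + 1)) atTop (𝓝 (1 + 0)) := by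
    refine tendsto_const_nhds.add (Tendsto.const_div_atTop ?_ _)
    have : Tendsto (fun n : ℤ => (n : ℝ)) atTop atTop := tendsto_intCast_atTop_atTop
    simpa [sub_eq_add_neg, add_assoc] using tendsto_atTop_add_const_right _ (-(k : ℝ) + 1) this
  have h2 := h1.sqrt
  simp only [add_zero, Real.sqrt_one] at h2
  refine h2.congr' ?_
  filter_upwards [eventually_ge_atTop 0, eventually_ge_atTop k] with n h0 hk
  unfold wt
  have h3 : (0 : ℝ) ≤ n := by exact_mod_cast h0
  have h4 : (0 : ℝ) ≤ (n : ℝ) - k := by simpa using (Int.cast_le (R := ℝ)).2 hk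
  rw [← Real.sqrt_div (by positivity)]
  congr 1
  push_cast
  rw [abs_of_nonneg h3, abs_of_nonneg h4]
  field_simp
  ring

/-- `x n` behaves like `X lⁿ / √n` at `+∞`, and is bounded by a multiple of
`|l|ⁿ / √(|n| + 1)` on all of `ℤ`. -/
def Asym (l : ℝ) (x : ℤ → ℝ) (X : ℝ) : Prop :=
  (∃ M, ∀ n, |x n| * wt n ≤ M * |l| ^ n) ∧
    Tendsto (fun n : ℤ => x n * wt n / l ^ n) atTop (𝓝 X)

/-- Dominated convergence: after normalisation the `k`-th term tends to `X * y k / l ^ k`. The limit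
constant is thus multiplied by the symbol of `y` at `1 / l`. -/
theorem Asym.dconv {l : ℝ} (hl : l ≠ 0) {x y : ℤ → ℝ} {X : ℝ} (hx : Asym l x X)
    (hy : Summable fun k => |y k| * wt k / |l| ^ k) :
    Asym l (dconv 1 y x) (X * ∑' k, y k / l ^ k) := by
  obtain ⟨⟨M, hM⟩, hX⟩ := hx
  have hl' : 0 < |l| := abs_pos.2 hl
  have ha : ∀ n, |x n * wt n / l ^ n| ≤ M := fun n => by
    rw [abs_div, abs_mul, abs_of_pos (wt_pos n), abs_zpow, div_le_iff₀ (by positivity)]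
    exact hM n
  have hM0 : 0 ≤ M := (abs_nonneg _).trans (ha 0)
  let T : ℤ → ℤ → ℝ := fun n k =>
    y k / l ^ k * (x (n - k) * wt (n - k) / l ^ (n - k) * (wt n / wt (n - k)))
  have hT : ∀ n k, T n k = y k * x (n - 1 * k) * (wt n / l ^ n) := fun n k => by
    have := (wt_pos (n - k)).ne'
    simp only [T, one_mul]
    rw [zpow_sub₀ hl]
    field_simp
  have hb : ∀ n k, ‖T n k‖ ≤ |y k| * wt k / |l| ^ k * M := fun n k => by
    simp only [T, Real.norm_eq_abs]
    rw [abs_mul, abs_mul, abs_div, abs_zpow]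
    have h1 : |wt n / wt (n - k)| ≤ wt k := by
      rw [abs_of_pos (div_pos (wt_pos _) (wt_pos _)), div_le_iff₀ (wt_pos _), mul_comm]
      exact wt_le_mul n k
    calc |y k| / |l| ^ k * (|x (n - k) * wt (n - k) / l ^ (n - k)| * |wt n / wt (n - k)|)
        ≤ |y k| / |l| ^ k * (M * wt k) := by
          gcongr
          exact ha _
      _ = _ := by ring
  have hsum : ∀ n, ∑' k, T n k = BSplineWavelet.dconv 1 y x n * wt n / l ^ n := fun n => by
    simp_rw [hT]
    rw [tsum_mul_right, BSplineWavelet.dconv, mul_div_assoc]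
  have hbs := hy.mul_right M
  refine ⟨⟨∑' k, |y k| * wt k / |l| ^ k * M, fun n => ?_⟩, ?_⟩
  · have h1 := tsum_of_norm_bounded hbs.hasSum (hb n)
    rw [hsum, Real.norm_eq_abs, abs_div, abs_mul, abs_of_pos (wt_pos n), abs_zpow,
      div_le_iff₀ (by positivity)] at h1
    exact h1
  · have h2 : Tendsto (fun n => ∑' k, T n k) atTop (𝓝 (∑' k, y k / l ^ k * (X * 1))) := by
      refine tendsto_tsum_of_dominated_convergence hbs (fun k => ?_)
        (Eventually.of_forall fun n k => hb n k)
      refine Tendsto.const_mul _ (Tendsto.mul ?_ (tendsto_wt_div k))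
      have : Tendsto (fun n : ℤ => n - k) atTop atTop :=
        tendsto_atTop_add_const_right _ (-k) tendsto_id
      exact hX.comp this
    simp_rw [hsum, mul_one, tsum_mul_right] at h2
    rwa [mul_comm] at h2

/-- The Taylor coefficients of `(1 - x)^(-1/2)`. -/
noncomputable def invSqrtCoeff (n : ℕ) : ℝ := Ring.choose ((1 / 2 : ℝ) + n - 1) n

theorem invSqrtCoeff_eq (n : ℕ) :
    (n.factorial : ℝ) * invSqrtCoeff n = (ascPochhammer ℝ n).eval (1 / 2) := by
  have h := Ring.factorial_nsmul_multichoose_eq_ascPochhammer (1 / 2 : ℝ) n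
  have h2 : Ring.multichoose (1 / 2 : ℝ) n = invSqrtCoeff n := by
    rw [invSqrtCoeff, Ring.choose]
    congr 1
    ring
  rw [← h2, ← nsmul_eq_mul, h, Polynomial.ascPochhammer_smeval_eq_eval]

theorem invSqrtCoeff_zero : invSqrtCoeff 0 = 1 := by
  simpa using invSqrtCoeff_eq 0

theorem invSqrtCoeff_succ (n : ℕ) :
    invSqrtCoeff (n + 1) = invSqrtCoeff n * ((2 * n + 1) / (2 * n + 2)) := by
  have h1 := invSqrtCoeff_eq n
  have h2 := invSqrtCoeff_eq (n + 1)
  rw [ascPochhammer_succ_eval, ← h1, Nat.factorial_succ] at h2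
  push_cast at h2
  have h3 : (n.factorial : ℝ) ≠ 0 := by positivity
  have h4 : ((n : ℝ) + 1) * invSqrtCoeff (n + 1) = invSqrtCoeff n * (1 / 2 + n) := by
    apply mul_left_cancel₀ h3
    linarith
  have h5 : ((n : ℝ) + 1) ≠ 0 := by positivity
  field_simp
  linarith

theorem invSqrtCoeff_pos (n : ℕ) : 0 < invSqrtCoeff n := by
  induction n with
  | zero => simp [invSqrtCoeff_zero]
  | succ n ih => rw [invSqrtCoeff_succ]; positivity

theorem antitone_invSqrtCoeff_sq : Antitone fun n : ℕ => invSqrtCoeff n ^ 2 * ((n : ℝ) + 1) := by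
  refine antitone_nat_of_succ_le fun n => ?_
  rw [invSqrtCoeff_succ, mul_pow, mul_assoc]
  gcongr
  push_cast
  rw [div_pow, div_mul_eq_mul_div, div_le_iff₀ (by positivity)]
  nlinarith [(Nat.cast_nonneg n : (0 : ℝ) ≤ n)]

/-- The squares times `n + 1` decrease, while the shifted version used here increases from 1/4; so
the limit of `invSqrtCoeff n * √(n + 1)` exists and is positive. -/
theorem invSqrtCoeff_lower (n : ℕ) : 1 / 4 ≤ invSqrtCoeff (n + 1) ^ 2 * ((n : ℝ) + 1) := by
  induction n with
  | zero => rw [invSqrtCoeff_succ, invSqrtCoeff_zero]; norm_num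
  | succ n ih =>
    refine ih.trans ?_
    rw [invSqrtCoeff_succ (n + 1), mul_pow, mul_assoc]
    gcongr
    push_cast
    rw [div_pow, div_mul_eq_mul_div, le_div_iff₀ (by positivity)]
    nlinarith [(Nat.cast_nonneg n : (0 : ℝ) ≤ n)]

theorem exists_tendsto_invSqrtCoeff :
    ∃ X : ℝ, X ≠ 0 ∧ Tendsto (fun n : ℕ => invSqrtCoeff n * Real.sqrt (n + 1)) atTop (𝓝 X) := by
  have hb : BddBelow (Set.range fun n : ℕ => invSqrtCoeff n ^ 2 * ((n : ℝ) + 1)) :=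
    ⟨0, by rintro _ ⟨n, rfl⟩; positivity⟩
  have h1 := tendsto_atTop_ciInf antitone_invSqrtCoeff_sq hb
  refine ⟨_, ?_, h1.sqrt.congr fun n => ?_⟩
  · have : (1 / 4 : ℝ) ≤ ⨅ n : ℕ, invSqrtCoeff n ^ 2 * ((n : ℝ) + 1) := by
      refine le_ciInf fun n => ?_
      have h2 := invSqrtCoeff_lower n
      have h3 := antitone_invSqrtCoeff_sq (Nat.le_succ n)
      simp only [Nat.succ_eq_add_one] at h3
      push_cast at h3
      nlinarith [sq_nonneg (invSqrtCoeff (n + 1))]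
    exact (Real.sqrt_pos.2 (by linarith)).ne'
  · rw [Real.sqrt_mul (sq_nonneg _), Real.sqrt_sq (invSqrtCoeff_pos n).le]

theorem invSqrtCoeff_mul_le (n : ℕ) : invSqrtCoeff n * Real.sqrt (n + 1) ≤ 1 := by
  have h := antitone_invSqrtCoeff_sq (Nat.zero_le n)
  simp only [invSqrtCoeff_zero] at h
  rw [← Real.sqrt_sq (invSqrtCoeff_pos n).le, ← Real.sqrt_mul (sq_nonneg _)]
  rw [Real.sqrt_le_one]
  simpa using h

theorem hasSum_invSqrtCoeff {z : ℂ} (hz : ‖z‖ < 1) :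
    HasSum (fun n : ℕ => (invSqrtCoeff n : ℂ) * z ^ n) (1 / (1 - z) ^ (1 / 2 : ℂ)) := by
  have h := (Complex.one_div_one_sub_cpow_hasFPowerSeriesOnBall_zero (1 / 2)).hasSum (y := z)
    (by rw [mem_eball_zero_iff, enorm_eq_nnnorm]; exact_mod_cast hz)
  simp only [zero_add] at h
  convert! h using 2 with n
  rw [FormalMultilinearSeries.ofScalars_apply_eq, smul_eq_mul, invSqrtCoeff, Complex.ofReal_choose]
  push_cast
  rfl

/-- The sequence of Taylor coefficients of `(1 - l w)^(-1/2)`, extended by zero to `ℤ`. -/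
noncomputable def geomSqrt (l : ℝ) (n : ℤ) : ℝ :=
  if 0 ≤ n then invSqrtCoeff n.toNat * l ^ n.toNat else 0

theorem geomSqrt_nat (l : ℝ) (n : ℕ) : geomSqrt l n = invSqrtCoeff n * l ^ n := by
  simp [geomSqrt]

theorem geomSqrt_of_not_mem_range (l : ℝ) (n : ℤ) (hn : n ∉ Set.range ((↑) : ℕ → ℤ)) :
    geomSqrt l n = 0 := by
  rw [geomSqrt, if_neg]
  intro h
  exact hn ⟨n.toNat, Int.toNat_of_nonneg h⟩

theorem symAt_geomSqrt {l : ℝ} {w : ℂ} (h : ‖l * w‖ < 1) :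
    SymAt (geomSqrt l) w (1 / (1 - l * w) ^ (1 / 2 : ℂ)) := by
  unfold SymAt
  rw [← (Nat.cast_injective (R := ℤ)).hasSum_iff]
  · convert! hasSum_invSqrtCoeff h using 2 with n
    simp only [Function.comp_apply, geomSqrt_nat, zpow_natCast]
    push_cast
    ring
  · intro n hn
    rw [geomSqrt_of_not_mem_range l n hn]
    simp

theorem one_sub_cpow_ne_zero {z : ℂ} (hz : ‖z‖ < 1) : 1 / (1 - z) ^ (1 / 2 : ℂ) ≠ 0 := by
  have h : 1 - z ≠ 0 := fun h => by
    rw [sub_eq_zero] at h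
    rw [← h] at hz
    simp at hz
  simp [Complex.cpow_eq_zero_iff, h]

theorem summable_geomSqrt {l l0 : ℝ} (h0 : l0 ≠ 0) (h : |l| < |l0|) :
    Summable fun k => |geomSqrt l k| * wt k / |l0| ^ k := by
  have hl0 : 0 < |l0| := abs_pos.2 h0
  rw [← (Nat.cast_injective (R := ℤ)).summable_iff]
  · refine Summable.of_nonneg_of_le (fun n => ?_) (fun n => ?_)
      (summable_geometric_of_lt_one (by positivity) ((div_lt_one hl0).2 h))
    · have := wt_pos n
      simp only [Function.comp_apply]
      positivity
    · simp only [Function.comp_apply, geomSqrt_nat, abs_mul, abs_pow, zpow_natCast, wt_nat,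
        abs_of_pos (invSqrtCoeff_pos n), div_pow]
      gcongr
      have := invSqrtCoeff_mul_le n
      nlinarith [pow_nonneg (abs_nonneg l) n]
  · intro n hn
    rw [geomSqrt_of_not_mem_range l n hn]
    simp

theorem summable_geomSqrt_neg {l l0 : ℝ} (h0 : l0 ≠ 0) (h : |l| * |l0| < 1) :
    Summable fun k => |geomSqrt l (-k)| * wt k / |l0| ^ k := by
  have hl0 : 0 < |l0| := abs_pos.2 h0
  rw [← (Equiv.neg ℤ).summable_iff, ← (Nat.cast_injective (R := ℤ)).summable_iff]
  · refine Summable.of_nonneg_of_le (fun n => ?_) (fun n => ?_)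
      (summable_geometric_of_lt_one (by positivity) h)
    · have := wt_pos (-n)
      simp only [Function.comp_apply, Equiv.neg_apply]
      positivity
    · have hw : wt (-(n : ℤ)) = Real.sqrt (n + 1) := by rw [← wt_nat]; simp [wt]
      simp only [Function.comp_apply, Equiv.neg_apply, neg_neg, geomSqrt_nat, abs_mul, abs_pow,
        hw, abs_of_pos (invSqrtCoeff_pos n), mul_pow, zpow_neg, zpow_natCast, div_inv_eq_mul]
      gcongr
      have := invSqrtCoeff_mul_le n
      nlinarith [pow_nonneg (abs_nonneg l) n]
  · intro n hn
    simp only [Function.comp_apply, Equiv.neg_apply, neg_neg]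
    rw [geomSqrt_of_not_mem_range l n hn]
    simp

theorem asym_geomSqrt {l : ℝ} (h0 : l ≠ 0) : ∃ X : ℝ, X ≠ 0 ∧ Asym l (geomSqrt l) X := by
  obtain ⟨X, hX, hT⟩ := exists_tendsto_invSqrtCoeff
  refine ⟨X, hX, ⟨1, fun n => ?_⟩, ?_⟩
  · by_cases hn : n ∈ Set.range ((↑) : ℕ → ℤ)
    · obtain ⟨n, rfl⟩ := hn
      rw [geomSqrt_nat, abs_mul, abs_pow, zpow_natCast, wt_nat, abs_of_pos (invSqrtCoeff_pos n)]
      have := invSqrtCoeff_mul_le n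
      nlinarith [pow_nonneg (abs_nonneg l) n]
    · rw [geomSqrt_of_not_mem_range l n hn]
      simp only [abs_zero, zero_mul, one_mul]
      positivity
  · rw [← Nat.map_cast_int_atTop, tendsto_map'_iff]
    refine hT.congr fun n => ?_
    simp only [Function.comp_apply, geomSqrt_nat, wt_nat, zpow_natCast]
    field_simp

/-- Shows that the factor produced by `Asym.dconv` does not kill the leading constant. -/
theorem tsum_ne_zero_of_symAt {y : ℤ → ℝ} {l : ℝ} {Y : ℂ} (h : SymAt y (l : ℂ)⁻¹ Y) (hY : Y ≠ 0) :
    ∑' k, y k / l ^ k ≠ 0 := by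
  intro h0
  apply hY
  rw [← HasSum.tsum_eq h]
  have h1 := congrArg (fun t : ℝ => (t : ℂ)) h0
  simp only [Complex.ofReal_tsum, Complex.ofReal_zero] at h1
  rw [← h1]
  refine tsum_congr fun k => ?_
  push_cast
  rw [inv_zpow, div_eq_mul_inv]

theorem SymAt.conj {f : ℤ → ℝ} {w F : ℂ} (h : SymAt f w F) :
    SymAt f (starRingEnd ℂ w) (starRingEnd ℂ F) := by
  have := (Complex.hasSum_conj'.2 h : _)
  unfold SymAt
  convert! this using 2 with n
  simp

/-- The symbols of `(1 - l w)^(-1/2)` and of its reversal multiply to `|1 - l w|⁻¹` on the unit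
circle. -/
theorem geomSqrt_symbol_mul {l : ℝ} {w : ℂ} (hl : |l| < 1) (hw : ‖w‖ = 1) :
    ∃ U V : ℂ, SymAt (geomSqrt l) w U ∧ SymAt (fun n => geomSqrt l (-n)) w V ∧
      V * U = ((‖1 - l * w‖⁻¹ : ℝ) : ℂ) := by
  have hlw : ‖(l : ℂ) * w‖ < 1 := by simpa [hw] using hl
  have hU := symAt_geomSqrt hlw
  have hV : SymAt (fun n => geomSqrt l (-n)) w (starRingEnd ℂ (1 / (1 - l * w) ^ (1 / 2 : ℂ))) := by
    apply SymAt.reverse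
    rw [Complex.inv_eq_conj hw]
    exact hU.conj
  refine ⟨_, _, hU, hV, ?_⟩
  rw [mul_comm, Complex.mul_conj]
  congr 1
  rw [Complex.normSq_eq_norm_sq, norm_div, norm_one, one_div, inv_pow]
  have h : (1 / 2 : ℂ) = ((1 / 2 : ℝ) : ℂ) := by push_cast; rfl
  rw [h, Complex.norm_cpow_real, ← Real.sqrt_eq_rpow, Real.sq_sqrt (norm_nonneg _)]

/-- On the circle |1 - a w|⁻¹ = (1 - a w)^(-1/2) (1 - a w⁻¹)^(-1/2). The factor (1 - l0 w)^(-1/2)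
carries the asymptotics; all others have absolutely convergent, nonvanishing symbols at w = 1/l0, so
multiplying by them one at a time only changes the constant by a nonzero factor. -/
theorem exists_asym_prod {ι : Type*} (s : Finset ι) (l : ι → ℝ) {l0 : ℝ} (h0 : l0 ≠ 0)
    (h1 : |l0| < 1) (hl : ∀ i ∈ s, |l i| < |l0|) :
    ∃ (f : ℤ → ℝ) (X : ℝ), X ≠ 0 ∧ Asym l0 f X ∧ ∀ w : ℂ, ‖w‖ = 1 →
      SymAt f w ((‖1 - l0 * w‖⁻¹ * ∏ i ∈ s, ‖1 - l i * w‖⁻¹ : ℝ) : ℂ) := by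
  classical
  -- The reversed factor takes the value (1 - a l0)^(-1/2) at w = 1/l0, so only |a l0| < 1 is
  -- needed; the case a = l0 is included.
  have step_neg : ∀ (a : ℝ) (f : ℤ → ℝ) (X : ℝ), |a| < 1 → X ≠ 0 → Asym l0 f X →
      ∃ X', X' ≠ 0 ∧ Asym l0 (dconv 1 (fun n => geomSqrt a (-n)) f) X' := by
    intro a f X ha hX hf
    have hm : |a| * |l0| < 1 := by nlinarith [abs_nonneg a, abs_nonneg l0]
    refine ⟨_, mul_ne_zero hX (tsum_ne_zero_of_symAt (Y := 1 / (1 - a * l0) ^ (1 / 2 : ℂ)) ?_ ?_),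
      hf.dconv h0 (summable_geomSqrt_neg h0 hm)⟩
    · apply SymAt.reverse
      rw [inv_inv]
      exact symAt_geomSqrt (by simpa using hm)
    · exact one_sub_cpow_ne_zero (by simpa using hm)
  induction s using Finset.induction_on with
  | empty =>
    obtain ⟨X, hX, hA⟩ := asym_geomSqrt h0
    obtain ⟨X', hX', hA'⟩ := step_neg l0 _ X h1 hX hA
    refine ⟨_, X', hX', hA', fun w hw => ?_⟩
    obtain ⟨U, V, hU, hV, hUV⟩ := geomSqrt_symbol_mul h1 hw
    have hw0 : w ≠ 0 := fun h => by simp [h] at hw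
    rw [Finset.prod_empty, mul_one, ← hUV]
    exact SymAt.dconv hw0 (by simpa using hV) hU
  | insert i s hi ih =>
    obtain ⟨f, X, hX, hA, hS⟩ := ih fun j hj => hl j (Finset.mem_insert_of_mem hj)
    have hli := hl i (Finset.mem_insert_self _ _)
    obtain ⟨X', hX', hA'⟩ := step_neg (l i) f X (hli.trans h1) hX hA
    have hr : ‖(l i : ℂ) * (l0 : ℂ)⁻¹‖ < 1 := by
      rw [norm_mul, norm_inv, Complex.norm_real, Complex.norm_real, ← div_eq_mul_inv,
        Real.norm_eq_abs, Real.norm_eq_abs]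
      exact (div_lt_one (abs_pos.2 h0)).2 hli
    refine ⟨_, _, mul_ne_zero hX' (tsum_ne_zero_of_symAt (symAt_geomSqrt hr)
      (one_sub_cpow_ne_zero hr)), hA'.dconv h0 (summable_geomSqrt h0 hli), fun w hw => ?_⟩
    obtain ⟨U, V, hU, hV, hUV⟩ := geomSqrt_symbol_mul (hli.trans h1) hw
    have hw0 : w ≠ 0 := fun h => by simp [h] at hw
    have := SymAt.dconv (d := 1) hw0 (by simpa using hU)
      (SymAt.dconv (d := 1) hw0 (by simpa using hV) (hS w hw))
    convert! this using 1
    rw [Finset.prod_insert hi]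
    push_cast at hUV ⊢
    linear_combination (-(‖1 - (l0 : ℂ) * w‖ : ℂ)⁻¹ * ∏ j ∈ s, (‖1 - (l j : ℂ) * w‖ : ℂ)⁻¹) * hUV

end BSplineWavelet

/-! ### B-splines: truncated powers, recurrence, two-scale relation, autocorrelation. -/

namespace BSplineWavelet

open scoped Topology

theorem bspline_succ (n : ℕ) (x : ℝ) :
    bspline (n + 2) x = ∫ y in (0 : ℝ)..1, bspline (n + 1) (x - y) := rfl

/-- The truncated power `x₊ⁿ`. -/
noncomputable def truncPow (n : ℕ) (x : ℝ) : ℝ := if 0 ≤ x then x ^ n else 0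

theorem truncPow_succ (n : ℕ) (x : ℝ) : truncPow (n + 1) x = x * truncPow n x := by
  unfold truncPow
  split_ifs <;> ring

theorem measurable_truncPow (n : ℕ) : Measurable (truncPow n) :=
  Measurable.ite measurableSet_Ici (by fun_prop) measurable_const

theorem continuous_truncPow_succ (n : ℕ) : Continuous (truncPow (n + 1)) := by
  have : truncPow (n + 1) = fun x => max x 0 ^ (n + 1) := by
    funext x
    unfold truncPow
    split_ifs with h
    · rw [max_eq_left h]
    · rw [max_eq_right (not_le.1 h).le]; simp
  rw [this]
  fun_prop

theorem intervalIntegrable_truncPow (n : ℕ) (a b : ℝ) :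
    IntervalIntegrable (truncPow n) volume a b := by
  have : truncPow n = Set.indicator (Set.Ici 0) (fun x => x ^ n) := by
    funext x
    simp [truncPow, Set.indicator_apply]
  rw [this, intervalIntegrable_iff]
  exact (intervalIntegrable_iff.1 ((continuous_pow n).intervalIntegrable a b)).indicator
    measurableSet_Ici

theorem integral_truncPow (n : ℕ) (a b : ℝ) :
    ∫ t in a..b, truncPow n t = (truncPow (n + 1) b - truncPow (n + 1) a) / (n + 1) := by
  have h0 : (n : ℝ) + 1 ≠ 0 := by positivity
  rw [intervalIntegral.integral_eq_sub_of_hasDeriv_right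
    (f := fun x => truncPow (n + 1) x / (n + 1)) _ _ (intervalIntegrable_truncPow n a b)]
  · ring
  · exact ((continuous_truncPow_succ n).div_const _).continuousOn
  · intro x _
    rcases le_or_gt 0 x with hx | hx
    · have h1 : HasDerivAt (fun y : ℝ => y ^ (n + 1) / ((n : ℝ) + 1)) (x ^ n) x := by
        convert! (hasDerivAt_pow (n + 1) x).div_const ((n : ℝ) + 1) using 1
        push_cast
        field_simp
      have h2 : truncPow n x = x ^ n := if_pos hx
      rw [h2]
      refine h1.hasDerivWithinAt.congr (fun y hy => ?_) ?_
      · rw [truncPow, if_pos (hx.trans (le_of_lt hy))]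
      · rw [truncPow, if_pos hx]
    · have h2 : truncPow n x = 0 := if_neg (not_le.2 hx)
      rw [h2]
      refine ((hasDerivAt_const x (0 : ℝ)).congr_of_eventuallyEq ?_).hasDerivWithinAt
      filter_upwards [Iio_mem_nhds hx] with y hy
      rw [truncPow, if_neg (not_le.2 hy), zero_div]

theorem integral_truncPow_sub (n : ℕ) (a : ℝ) :
    ∫ y in (0 : ℝ)..1, truncPow n (a - y) =
      (truncPow (n + 1) a - truncPow (n + 1) (a - 1)) / (n + 1) := by
  rw [intervalIntegral.integral_comp_sub_left (truncPow n), sub_zero, integral_truncPow]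

/-- Pascal's rule as (1 + cS)ⁿ (1 + cS) = (1 + cS)ⁿ⁺¹ for the shift S. It is used with c = -1 for
differences and with c = 1 for the two-scale relation. -/
theorem sum_choose_succ (n : ℕ) (c : ℝ) (S : ℕ → ℝ) :
    ∑ k ∈ Finset.range (n + 1), c ^ k * (n.choose k : ℝ) * (S k + c * S (k + 1)) =
      ∑ k ∈ Finset.range (n + 2), c ^ k * ((n + 1).choose k : ℝ) * S k := by
  have h1 : ∑ k ∈ Finset.range (n + 1), c ^ k * (n.choose k : ℝ) * S k =
      S 0 + ∑ k ∈ Finset.range (n + 1), c ^ (k + 1) * (n.choose (k + 1) : ℝ) * S (k + 1) := by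
    rw [Finset.sum_range_succ', Finset.sum_range_succ _ n]
    simp [add_comm]
  rw [Finset.sum_range_succ' _ (n + 1)]
  simp only [mul_add, Finset.sum_add_distrib, h1, Nat.choose_succ_succ, Nat.cast_add, add_mul]
  simp only [pow_zero, Nat.choose_zero_right, Nat.cast_one, one_mul]
  have h2 : ∀ k : ℕ, c ^ k * (n.choose k : ℝ) * (c * S (k + 1)) =
      c ^ (k + 1) * (n.choose k : ℝ) * S (k + 1) := fun k => by ring
  simp only [h2]
  ring

theorem bspline_eq_sum (n : ℕ) (x : ℝ) : bspline (n + 1) x =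
    (1 / (n.factorial : ℝ)) * ∑ k ∈ Finset.range (n + 2),
      (-1) ^ k * ((n + 1).choose k : ℝ) * truncPow n (x - k) := by
  induction n generalizing x with
  | zero =>
    simp only [bspline, truncPow, Set.indicator_apply, Set.mem_Ico, Finset.sum_range_succ]
    by_cases h0 : 0 ≤ x <;> by_cases h1 : x < 1 <;> simp [h0, h1] <;> grind
  | succ n ih =>
    rw [bspline_succ]
    simp_rw [ih]
    rw [intervalIntegral.integral_const_mul, intervalIntegral.integral_finsetSum]
    · have h1 : ∀ k : ℕ, ∀ y : ℝ, truncPow n (x - y - k) = truncPow n ((x - k) - y) :=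
        fun k y => by congr 1; ring
      simp_rw [h1, intervalIntegral.integral_const_mul, integral_truncPow_sub]
      have h2 := sum_choose_succ (n + 1) (-1) fun k => truncPow (n + 1) (x - k)
      rw [← h2, Finset.mul_sum, Finset.mul_sum]
      refine Finset.sum_congr rfl fun k _ => ?_
      rw [Nat.factorial_succ]
      push_cast
      rw [show x - ((k : ℝ) + 1) = x - k - 1 by ring]
      have h3 : (n.factorial : ℝ) ≠ 0 := by positivity
      have h4 : (n : ℝ) + 1 ≠ 0 := by positivity
      field_simp
      ring
    · intro k _
      refine IntervalIntegrable.const_mul ?_ _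
      have h1 : ∀ y : ℝ, truncPow n (x - y - k) = truncPow n ((x - k) - y) :=
        fun y => by congr 1; ring
      simp_rw [h1]
      have := (intervalIntegrable_truncPow n (x - k) (x - k - 1)).comp_sub_left (x - k)
      simpa using this

/-- Write `truncPow (n + 1)` as `x` times `truncPow n` and compare coefficients. At integer `x` this
becomes the recurrence of the Eulerian numbers. -/
theorem bspline_recurrence (n : ℕ) (x : ℝ) : ((n : ℝ) + 1) * bspline (n + 2) x =
    x * bspline (n + 1) x + ((n : ℝ) + 2 - x) * bspline (n + 1) (x - 1) := by
  have h3 : (n.factorial : ℝ) ≠ 0 := by positivity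
  have h4 : (n : ℝ) + 1 ≠ 0 := by positivity
  rw [bspline_eq_sum (n + 1), bspline_eq_sum n x, bspline_eq_sum n (x - 1), Nat.factorial_succ]
  have e1 : ∑ k ∈ Finset.range (n + 2), (-1 : ℝ) ^ k * ((n + 1).choose k : ℝ) * truncPow n (x - k) =
      truncPow n x + ∑ k ∈ Finset.range (n + 2), (-1 : ℝ) ^ (k + 1) *
        ((n + 1).choose (k + 1) : ℝ) * truncPow n (x - 1 - k) := by
    rw [Finset.sum_range_succ', Finset.sum_range_succ _ (n + 1)]
    simp only [Nat.cast_add, Nat.cast_one, sub_sub, add_comm (1 : ℝ),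
      Nat.choose_succ_self (n + 1)]
    simp [add_comm]
  have e2 : ∑ k ∈ Finset.range (n + 1 + 2), (-1 : ℝ) ^ k * ((n + 1 + 1).choose k : ℝ) *
      truncPow (n + 1) (x - k) = x * truncPow n x +
      ∑ k ∈ Finset.range (n + 2), ((-1 : ℝ) ^ (k + 1) * ((n + 1).choose (k + 1) : ℝ) * x
        - (-1 : ℝ) ^ k * ((n + 1).choose k : ℝ) * x
        + (-1 : ℝ) ^ k * ((n + 1).choose k : ℝ) * (n + 2)) * truncPow n (x - 1 - k) := by
    rw [Finset.sum_range_succ', add_comm]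
    congr 1
    · simp [truncPow_succ]
    · refine Finset.sum_congr rfl fun k _ => ?_
      rw [truncPow_succ]
      -- Absorption identity, which removes the factor `k + 1` coming from `x - (k + 1)`.
      have h5 : (((k : ℝ) + 1)) * ((n + 1 + 1).choose (k + 1) : ℝ) =
          (n + 2) * ((n + 1).choose k : ℝ) := by
        have := Nat.add_one_mul_choose_eq (n + 1) k
        have h6 : (((n + 1 + 1) * (n + 1).choose k : ℕ) : ℝ) =
          (((n + 1 + 1).choose (k + 1) * (k + 1) : ℕ) : ℝ) := by rw [this]
        push_cast at h6
        linarith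
      have h7 : ((n + 1 + 1).choose (k + 1) : ℝ) =
          ((n + 1).choose k : ℝ) + ((n + 1).choose (k + 1) : ℝ) := by
        rw [Nat.choose_succ_succ (n + 1) k]; push_cast; rfl
      have h8 : x - ((k + 1 : ℕ) : ℝ) = x - 1 - k := by push_cast; ring
      rw [h8]
      linear_combination ((-1 : ℝ) ^ (k + 1) * x * truncPow n (x - 1 - k)) * h7 -
        ((-1 : ℝ) ^ (k + 1) * truncPow n (x - 1 - k)) * h5
  rw [e1, e2]
  push_cast
  have e3 : ∑ k ∈ Finset.range (n + 2), ((-1 : ℝ) ^ (k + 1) * ((n + 1).choose (k + 1) : ℝ) * x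
        - (-1 : ℝ) ^ k * ((n + 1).choose k : ℝ) * x
        + (-1 : ℝ) ^ k * ((n + 1).choose k : ℝ) * (n + 2)) * truncPow n (x - 1 - k) =
      x * ∑ k ∈ Finset.range (n + 2), (-1 : ℝ) ^ (k + 1) *
        ((n + 1).choose (k + 1) : ℝ) * truncPow n (x - 1 - k) +
      ((n : ℝ) + 2 - x) * ∑ k ∈ Finset.range (n + 2), (-1 : ℝ) ^ k *
        ((n + 1).choose k : ℝ) * truncPow n (x - 1 - k) := by
    rw [Finset.mul_sum, Finset.mul_sum, ← Finset.sum_add_distrib]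
    exact Finset.sum_congr rfl fun k _ => by ring
  rw [e3]
  field_simp
  ring

theorem bspline_of_neg (n : ℕ) {x : ℝ} (hx : x < 0) : bspline n x = 0 := by
  cases n with
  | zero => rfl
  | succ n =>
    rw [bspline_eq_sum, Finset.sum_eq_zero, mul_zero]
    intro k _
    have : x - k < 0 := by
      have : (0 : ℝ) ≤ k := Nat.cast_nonneg k
      linarith
    rw [truncPow, if_neg (not_le.2 this), mul_zero]

theorem bspline_of_ge (n : ℕ) {x : ℝ} (hx : (n : ℝ) ≤ x) : bspline n x = 0 := by
  induction n generalizing x with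
  | zero => rfl
  | succ n ih =>
    cases n with
    | zero =>
      have : ¬ x < 1 := by simpa using hx
      simp [bspline, this]
    | succ n =>
      rw [bspline_succ]
      have : ∀ y ∈ Set.uIcc (0 : ℝ) 1, bspline (n + 1) (x - y) = 0 := fun y hy => by
        rw [Set.uIcc_of_le zero_le_one] at hy
        apply ih
        push_cast at hx ⊢
        linarith [hy.2]
      rw [intervalIntegral.integral_congr this]
      simp

theorem bspline_nonneg (n : ℕ) (x : ℝ) : 0 ≤ bspline n x := by
  induction n generalizing x with
  | zero => exact le_rfl
  | succ n ih =>
    cases n with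
    | zero => exact Set.indicator_nonneg (fun _ _ => zero_le_one) x
    | succ n => exact intervalIntegral.integral_nonneg zero_le_one fun y _ => ih _

theorem abs_bspline_le (n : ℕ) (x : ℝ) : |bspline n x| ≤ 1 := by
  induction n generalizing x with
  | zero => simp [bspline]
  | succ n ih =>
    cases n with
    | zero =>
      simp only [bspline, Set.indicator_apply]
      split_ifs <;> simp
    | succ n =>
      have := intervalIntegral.norm_integral_le_of_norm_le_const (a := 0) (b := 1)
        (f := fun y => bspline (n + 1) (x - y)) (C := 1) fun y _ => ih _
      simpa [bspline_succ] using this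

theorem measurable_bspline (n : ℕ) : Measurable (bspline n) := by
  cases n with
  | zero => exact measurable_const
  | succ n =>
    have : bspline (n + 1) = fun x => (1 / (n.factorial : ℝ)) * ∑ k ∈ Finset.range (n + 2),
      (-1) ^ k * ((n + 1).choose k : ℝ) * truncPow n (x - k) := funext (bspline_eq_sum n)
    rw [this]
    have := measurable_truncPow n
    fun_prop

theorem continuous_bspline (n : ℕ) : Continuous (bspline (n + 2)) := by
  have : bspline (n + 2) = fun x => (1 / ((n + 1).factorial : ℝ)) * ∑ k ∈ Finset.range (n + 1 + 2),
    (-1) ^ k * ((n + 1 + 1).choose k : ℝ) * truncPow (n + 1) (x - k) :=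
      funext (bspline_eq_sum (n + 1))
  rw [this]
  have := continuous_truncPow_succ n
  fun_prop

theorem integrable_bspline (n : ℕ) : Integrable (bspline n) := by
  have h : IntegrableOn (bspline n) (Set.Icc 0 n) := by
    refine Measure.integrableOn_of_bounded (M := 1) (by simp)
      (measurable_bspline n).aestronglyMeasurable (Eventually.of_forall fun x => ?_)
    exact abs_bspline_le n x
  refine (integrableOn_iff_integrable_of_support_subset fun x hx => ?_).1 h
  constructor
  · by_contra h0
    exact hx (bspline_of_neg n (not_le.1 h0))
  · by_contra h0
    exact hx (bspline_of_ge n (not_le.1 h0).le)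

theorem intervalIntegrable_bspline_sub (n : ℕ) (x a b : ℝ) :
    IntervalIntegrable (fun y => bspline n (x - y)) volume a b :=
  ((integrable_bspline n).comp_sub_left x).intervalIntegrable

/-- Averaging over [0, 1] in `x` is half the integral over [0, 2] in `2x`; splitting at 1 gives two
neighbouring splines of the next order. -/
theorem bspline_two_scale (n : ℕ) (x : ℝ) : bspline (n + 1) x =
    ∑ i ∈ Finset.range (n + 2), (1 / 2) ^ n * ((n + 1).choose i : ℝ) *
      bspline (n + 1) (2 * x - i) := by
  induction n generalizing x with
  | zero =>
    simp only [bspline, Set.indicator_apply, Set.mem_Ico, Finset.sum_range_succ]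
    by_cases h0 : 0 ≤ x <;> by_cases h1 : x < 1 <;> by_cases h2 : 2 * x < 1 <;>
      simp [h0, h1, h2] <;> grind
  | succ n ih =>
    rw [bspline_succ, intervalIntegral.integral_congr fun y _ => ih (x - y)]
    have hsub : ∀ (i : ℕ) (y : ℝ), 2 * (x - y) - i = (2 * x - i) - 2 * y := fun i y => by ring
    rw [intervalIntegral.integral_finsetSum]
    · have h1 : ∀ i : ℕ, ∫ y in (0 : ℝ)..1, bspline (n + 1) (2 * (x - y) - i) =
          1 / 2 * (bspline (n + 2) (2 * x - i) + 1 * bspline (n + 2) (2 * x - (i + 1 : ℕ))) := by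
        intro i
        simp_rw [hsub]
        rw [intervalIntegral.integral_comp_mul_left (fun y => bspline (n + 1) (2 * x - i - y))
          two_ne_zero, ← intervalIntegral.integral_add_adjacent_intervals (b := 1)
          (intervalIntegrable_bspline_sub _ _ _ _) (intervalIntegrable_bspline_sub _ _ _ _)]
        have h2 : ∫ y in (1 : ℝ)..2 * 1, bspline (n + 1) (2 * x - i - y) =
            bspline (n + 2) (2 * x - (i + 1 : ℕ)) := by
          rw [bspline_succ]
          have := intervalIntegral.integral_comp_add_right (a := 0) (b := 1)
            (fun y => bspline (n + 1) (2 * x - i - y)) 1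
          rw [zero_add, one_add_one_eq_two] at this
          rw [mul_one, ← this]
          refine intervalIntegral.integral_congr fun y _ => ?_
          congr 1
          push_cast
          ring
        rw [h2, mul_zero, ← bspline_succ, smul_eq_mul]
        norm_num
      simp_rw [intervalIntegral.integral_const_mul, h1]
      have h3 := sum_choose_succ (n + 1) 1 fun i => bspline (n + 2) (2 * x - i)
      simp only [one_pow, one_mul] at h3
      simp only [mul_assoc]
      rw [← Finset.mul_sum, ← Finset.mul_sum, ← h3, Finset.mul_sum, Finset.mul_sum]
      refine Finset.sum_congr rfl fun i _ => ?_
      ring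
    · intro i _
      refine IntervalIntegrable.const_mul ?_ _
      simp_rw [hsub]
      exact ((((integrable_bspline (n + 1)).comp_sub_left (2 * x - i))).comp_mul_left'
        two_ne_zero).intervalIntegrable

/-- Only almost everywhere, since the half-open indicator breaks the symmetry at 0 and 1 when `n =
0`. -/
theorem bspline_reflect (n : ℕ) :
    ∀ᵐ x : ℝ, bspline (n + 1) ((n + 1 : ℕ) - x) = bspline (n + 1) x := by
  induction n with
  | zero =>
    have h0 : ∀ᵐ x : ℝ, x ≠ 0 := by simp [ae_iff]
    have h1 : ∀ᵐ x : ℝ, x ≠ 1 := by simp [ae_iff]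
    filter_upwards [h0, h1] with x h0 h1
    simp only [bspline, Set.indicator_apply, Set.mem_Ico]
    congr 1
    apply propext
    constructor
    · rintro ⟨h2, h3⟩
      push_cast at h2 h3
      exact ⟨by linarith, lt_of_le_of_ne (by linarith) h1⟩
    · rintro ⟨h2, h3⟩
      push_cast
      have := lt_of_le_of_ne h2 (Ne.symm h0)
      exact ⟨by linarith, by linarith⟩
  | succ n ih =>
    refine Eventually.of_forall fun x => ?_
    rw [bspline_succ, bspline_succ]
    have h1 : ∫ y in (0 : ℝ)..1, bspline (n + 1) (x - y) =
        ∫ y in (0 : ℝ)..1, bspline (n + 1) (y + (x - 1)) := by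
      have := intervalIntegral.integral_comp_sub_left (a := 0) (b := 1)
        (fun y => bspline (n + 1) (x - y)) 1
      rw [sub_zero, sub_self] at this
      rw [← this]
      refine intervalIntegral.integral_congr fun y _ => ?_
      congr 1; ring
    rw [h1]
    refine intervalIntegral.integral_congr_ae ?_
    have := (measurePreserving_add_right (volume : Measure ℝ) (x - 1)).quasiMeasurePreserving.ae ih
    filter_upwards [this] with y hy _
    rw [← hy]
    congr 1
    push_cast; ring

/-- Fubini for averaging against a bounded function. Values in `E` let it serve both the real
convolution of splines and their complex Fourier integral. -/
theorem integral_average_smul {E : Type*} [NormedAddCommGroup E] [NormedSpace ℝ E]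
    [CompleteSpace E] {f : ℝ → ℝ} (hf : Integrable f) {g : ℝ → E} (hg : AEStronglyMeasurable g)
    {C : ℝ} (hC : ∀ x, ‖g x‖ ≤ C) :
    ∫ t, (∫ y in (0 : ℝ)..1, f (t - y)) • g t = ∫ y in (0 : ℝ)..1, ∫ t, f t • g (t + y) := by
  have h1 : Integrable (fun p : ℝ × ℝ => f (p.1 - p.2))
      (volume.prod (volume.restrict (Set.Ioc (0 : ℝ) 1))) := by
    have h := Integrable.convolution_integrand (ContinuousLinearMap.mul ℝ ℝ)
      (f := fun _ : ℝ => (1 : ℝ)) (ν := volume.restrict (Set.Ioc (0 : ℝ) 1)) (μ := volume)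
      (integrable_const _) hf
    simpa using h
  have h2 : Integrable (fun p : ℝ × ℝ => f (p.1 - p.2) • g p.1)
      (volume.prod (volume.restrict (Set.Ioc (0 : ℝ) 1))) := by
    refine Integrable.smul_bdd (C := C) ?_ ?_ ?_
    · exact h1
    · exact hg.comp_fst
    · exact Eventually.of_forall fun p => hC p.1
  simp_rw [intervalIntegral.integral_of_le zero_le_one, ← integral_smul_const]
  rw [integral_integral_swap h2]
  refine integral_congr_ae (Eventually.of_forall fun y => ?_)
  simp only
  rw [← integral_add_right_eq_self _ y]
  simp

theorem integral_bspline_mul_bspline (m n : ℕ) (z : ℝ) :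
    ∫ x, bspline (m + 1) x * bspline (n + 1) (z - x) = bspline (m + n + 2) z := by
  induction m generalizing z with
  | zero =>
    rw [zero_add, bspline_succ, intervalIntegral.integral_of_le zero_le_one,
      integral_Ioc_eq_integral_Ioo, ← integral_Ico_eq_integral_Ioo,
      ← integral_indicator measurableSet_Ico]
    refine integral_congr_ae (Eventually.of_forall fun x => ?_)
    simp only [zero_add, bspline, Set.indicator_apply]
    split_ifs <;> simp
  | succ m ih =>
    have := integral_average_smul (integrable_bspline (m + 1))
      (g := fun t => bspline (n + 1) (z - t)) (C := 1)
      ((measurable_bspline (n + 1)).comp (measurable_const.sub measurable_id)).aestronglyMeasurable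
      fun x => abs_bspline_le _ _
    simp only [smul_eq_mul] at this
    rw [show m + 1 + n + 2 = (m + n + 1) + 2 by ring, bspline_succ]
    simp_rw [bspline_succ m]
    rw [this]
    refine intervalIntegral.integral_congr fun y _ => ?_
    rw [show m + n + 1 + 1 = m + n + 2 by ring, ← ih]
    refine integral_congr_ae (Eventually.of_forall fun x => ?_)
    beta_reduce
    rw [show z - (x + y) = z - y - x by ring]

/-- The autocorrelation of `N_m`. -/
theorem integral_bspline_shift (m : ℕ) (hm : 1 ≤ m) (k : ℝ) :
    ∫ x, bspline m x * bspline m (x - k) = bspline (2 * m) (m + k) := by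
  obtain ⟨m, rfl⟩ := Nat.exists_eq_add_of_le' hm
  rw [show 2 * (m + 1) = m + m + 2 by ring, ← integral_bspline_mul_bspline]
  have := (measurePreserving_sub_right (volume : Measure ℝ) k).quasiMeasurePreserving.ae
    (bspline_reflect m)
  refine integral_congr_ae ?_
  filter_upwards [this] with x hx
  rw [← hx]
  congr 2
  ring

end BSplineWavelet

/-! ### The Fourier side: Poisson summation and the two-scale relation for `Pcos`. -/

namespace BSplineWavelet

open scoped Topology

/-- The Fourier integral `∫_0^1 e^{-iξt} dt` of the box function. -/
noncomputable def boxFourier (ξ : ℝ) : ℂ :=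
  ∫ t in (0 : ℝ)..1, Complex.exp (-(Complex.I * (ξ : ℂ) * (t : ℂ)))

theorem norm_exp_phase (ξ t : ℝ) : ‖Complex.exp (-(Complex.I * (ξ : ℂ) * (t : ℂ)))‖ = 1 := by
  rw [show -(Complex.I * (ξ : ℂ) * (t : ℂ)) = ((-(ξ * t) : ℝ) : ℂ) * Complex.I by push_cast; ring,
    Complex.norm_exp_ofReal_mul_I]

theorem integral_bspline_exp (n : ℕ) (ξ : ℝ) :
    ∫ t : ℝ, (bspline (n + 1) t : ℂ) * Complex.exp (-(Complex.I * (ξ : ℂ) * (t : ℂ))) =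
      boxFourier ξ ^ (n + 1) := by
  induction n with
  | zero =>
    rw [zero_add, pow_one, boxFourier, intervalIntegral.integral_of_le zero_le_one,
      integral_Ioc_eq_integral_Ioo, ← integral_Ico_eq_integral_Ioo,
      ← integral_indicator measurableSet_Ico]
    refine integral_congr_ae (Eventually.of_forall fun x => ?_)
    simp only [bspline, Set.indicator_apply]
    split_ifs <;> simp
  | succ n ih =>
    have := integral_average_smul (integrable_bspline (n + 1))
      (g := fun t : ℝ => Complex.exp (-(Complex.I * (ξ : ℂ) * (t : ℂ)))) (C := 1)
      (by fun_prop : Continuous _).aestronglyMeasurable fun x => (norm_exp_phase ξ x).le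
    simp only [Complex.real_smul] at this
    simp_rw [bspline_succ n]
    rw [this, pow_succ, ← ih, boxFourier, ← intervalIntegral.integral_const_mul]
    refine intervalIntegral.integral_congr fun y _ => ?_
    rw [← integral_mul_const]
    refine integral_congr_ae (Eventually.of_forall fun x => ?_)
    simp only
    rw [mul_assoc (bspline (n + 1) x : ℂ), ← Complex.exp_add]
    congr 2
    push_cast
    ring

theorem boxFourier_neg (ξ : ℝ) : boxFourier (-ξ) = Complex.exp (Complex.I * ξ) * boxFourier ξ := by
  have h := intervalIntegral.integral_comp_sub_left (a := 0) (b := 1)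
    (fun t : ℝ => Complex.exp (-(Complex.I * ((-ξ : ℝ) : ℂ) * (t : ℂ)))) 1
  rw [sub_zero, sub_self] at h
  rw [boxFourier, ← h, boxFourier, ← intervalIntegral.integral_const_mul]
  refine intervalIntegral.integral_congr fun y _ => ?_
  rw [← Complex.exp_add]
  congr 1
  push_cast
  ring

theorem boxFourier_conj (ξ : ℝ) : starRingEnd ℂ (boxFourier ξ) = boxFourier (-ξ) := by
  rw [boxFourier, boxFourier, ← intervalIntegral.intervalIntegral_conj]
  refine intervalIntegral.integral_congr fun y _ => ?_
  simp only [← Complex.exp_conj]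
  congr 1
  simp

theorem norm_boxFourier_neg (ξ : ℝ) : ‖boxFourier (-ξ)‖ = ‖boxFourier ξ‖ := by
  rw [← boxFourier_conj, RCLike.norm_conj]

/-- The box is symmetric about 1/2, so centring it makes its transform real up to sign; this is what
turns the 2m-th power into |·|^{2m} for the centred spline. -/
theorem norm_boxFourier_sq (ξ : ℝ) :
    ((‖boxFourier ξ‖ ^ 2 : ℝ) : ℂ) = boxFourier ξ ^ 2 * Complex.exp (Complex.I * ξ) := by
  rw [← Complex.normSq_eq_norm_sq, ← Complex.mul_conj, boxFourier_conj, boxFourier_neg]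
  ring

theorem norm_boxFourier_le_one (ξ : ℝ) : ‖boxFourier ξ‖ ≤ 1 := by
  have := intervalIntegral.norm_integral_le_of_norm_le_const (a := 0) (b := 1) (C := 1)
    (f := fun t : ℝ => Complex.exp (-(Complex.I * (ξ : ℂ) * (t : ℂ))))
    fun t _ => (norm_exp_phase ξ t).le
  simpa [boxFourier] using this

theorem norm_boxFourier_le {ξ : ℝ} (hξ : ξ ≠ 0) : ‖boxFourier ξ‖ ≤ 2 / |ξ| := by
  have hne : -(Complex.I * (ξ : ℂ)) ≠ 0 := by simp [hξ]
  have h : boxFourier ξ = (Complex.exp (-(Complex.I * (ξ : ℂ)) * 1) -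
      Complex.exp (-(Complex.I * (ξ : ℂ)) * 0)) / (-(Complex.I * (ξ : ℂ))) := by
    have := integral_exp_mul_complex (a := 0) (b := 1) hne
    push_cast at this
    rw [← this, boxFourier]
    refine intervalIntegral.integral_congr fun y _ => ?_
    congr 1; ring
  rw [h, norm_div]
  have h2 : ‖-(Complex.I * (ξ : ℂ))‖ = |ξ| := by simp
  rw [h2]
  gcongr
  refine (norm_sub_le _ _).trans ?_
  have h3 := norm_exp_phase ξ 1
  push_cast at h3
  rw [neg_mul, h3]
  norm_num

theorem boxFourier_two_mul (ξ : ℝ) :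
    boxFourier (2 * ξ) = boxFourier ξ * ((1 + Complex.exp (-(Complex.I * ξ))) / 2) := by
  have h := intervalIntegral.integral_comp_mul_left (a := 0) (b := 1)
    (fun t : ℝ => Complex.exp (-(Complex.I * (ξ : ℂ) * (t : ℂ)))) (c := 2) two_ne_zero
  have h1 : boxFourier (2 * ξ) =
      ∫ t in (0 : ℝ)..1, Complex.exp (-(Complex.I * (ξ : ℂ) * ((2 * t : ℝ) : ℂ))) := by
    refine intervalIntegral.integral_congr fun y _ => ?_
    congr 1
    push_cast
    ring
  have hi : ∀ a b : ℝ, IntervalIntegrable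
      (fun t : ℝ => Complex.exp (-(Complex.I * (ξ : ℂ) * (t : ℂ)))) volume a b := fun a b =>
    (by fun_prop : Continuous _).intervalIntegrable _ _
  have h2 : ∫ t in (1 : ℝ)..2, Complex.exp (-(Complex.I * (ξ : ℂ) * (t : ℂ))) =
      boxFourier ξ * Complex.exp (-(Complex.I * ξ)) := by
    have := intervalIntegral.integral_comp_add_right (a := 0) (b := 1)
      (fun t : ℝ => Complex.exp (-(Complex.I * (ξ : ℂ) * (t : ℂ)))) 1
    rw [zero_add, one_add_one_eq_two] at this
    rw [← this, boxFourier, ← intervalIntegral.integral_mul_const]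
    refine intervalIntegral.integral_congr fun y _ => ?_
    rw [← Complex.exp_add]
    congr 1
    push_cast
    ring
  rw [h1, h, mul_zero, mul_one, ← intervalIntegral.integral_add_adjacent_intervals (hi 0 1) (hi 1 2),
    h2, ← boxFourier, Complex.real_smul]
  push_cast
  ring

theorem norm_one_add_exp_sq (ξ : ℝ) :
    ‖(1 + Complex.exp (-(Complex.I * ξ))) / 2‖ ^ 2 = (1 + Real.cos ξ) / 2 := by
  rw [show -(Complex.I * (ξ : ℂ)) = ((-ξ : ℝ) : ℂ) * Complex.I by push_cast; ring,
    Complex.exp_mul_I, ← Complex.ofReal_cos, ← Complex.ofReal_sin, ← Complex.normSq_eq_norm_sq,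
    map_div₀]
  have h1 : (1 + ((Real.cos (-ξ) : ℝ) + (Real.sin (-ξ) : ℝ) * Complex.I) : ℂ) =
      ⟨1 + Real.cos ξ, -Real.sin ξ⟩ := by
    apply Complex.ext <;> simp [Complex.cos_ofReal_re, Complex.sin_ofReal_re]
  rw [h1]
  rw [Complex.normSq_mk, Complex.normSq_ofNat]
  nlinarith [Real.sin_sq_add_cos_sq ξ]

theorem summable_boxFourier (m : ℕ) (hm : 1 ≤ m) (θ : ℝ) :
    Summable fun j : ℤ => ‖boxFourier (θ + 2 * Real.pi * j)‖ ^ (2 * m) := by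
  refine summable_of_isBigO (g := fun j : ℤ => |(j : ℝ)| ^ (-2 : ℝ))
    (Real.summable_abs_int_rpow (by norm_num)) ?_
  -- 4 is the square of the 2 in `norm_boxFourier_le`; for large `j` one has |θ + 2πj| ≥ |j|, and
  -- exponents above 2 only help as the norm is at most 1.
  refine IsBigO.of_bound 4 ?_
  have h1 : ∀ᶠ j : ℤ in cofinite, |θ| + 1 ≤ |(j : ℝ)| := by
    have : Tendsto (fun j : ℤ => ‖(j : ℝ)‖) cofinite atTop :=
      tendsto_norm_cocompact_atTop.comp Int.tendsto_coe_cofinite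
    exact this.eventually_ge_atTop _
  filter_upwards [h1] with j hj
  have hj0 : 0 < |(j : ℝ)| := by linarith [abs_nonneg θ]
  have h2 : |(j : ℝ)| ≤ |θ + 2 * Real.pi * j| := by
    have h3 : |2 * Real.pi * (j : ℝ)| = 2 * Real.pi * |(j : ℝ)| := by
      rw [abs_mul, abs_of_pos Real.two_pi_pos]
    have h4 := abs_sub_abs_le_abs_sub (2 * Real.pi * (j : ℝ)) (-θ)
    rw [abs_neg, h3, sub_neg_eq_add, add_comm (2 * Real.pi * (j : ℝ))] at h4
    nlinarith [Real.pi_gt_three, abs_nonneg θ]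
  have hne : θ + 2 * Real.pi * j ≠ 0 := fun h => by
    rw [h, abs_zero] at h2
    linarith
  have h5 : ‖boxFourier (θ + 2 * Real.pi * j)‖ ≤ 2 / |(j : ℝ)| :=
    (norm_boxFourier_le hne).trans (by gcongr)
  rw [norm_pow, norm_norm, Real.norm_of_nonneg (by positivity), Real.rpow_neg hj0.le]
  calc ‖boxFourier (θ + 2 * Real.pi * j)‖ ^ (2 * m)
      ≤ ‖boxFourier (θ + 2 * Real.pi * j)‖ ^ 2 :=
        pow_le_pow_of_le_one (norm_nonneg _) (norm_boxFourier_le_one _) (by omega)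
    _ ≤ (2 / |(j : ℝ)|) ^ 2 := by gcongr
    _ = _ := by
      rw [Real.rpow_two]
      field_simp
      norm_num

theorem norm_fourierTr_sq (m : ℕ) (hm : 1 ≤ m) (ξ : ℝ) :
    2 * Real.pi * ‖fourierTr (bspline m) ξ‖ ^ 2 = ‖boxFourier ξ‖ ^ (2 * m) := by
  obtain ⟨m, rfl⟩ := Nat.exists_eq_add_of_le' hm
  rw [fourierTr, integral_bspline_exp, norm_mul, Complex.norm_real, Real.norm_of_nonneg
    (by positivity), mul_pow, div_pow, Real.sq_sqrt Real.two_pi_pos.le, norm_pow, ← pow_mul,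
    mul_comm (m + 1) 2]
  have := Real.two_pi_pos.ne'
  field_simp

theorem hasSum_Pcos (m : ℕ) (hm : 1 ≤ m) (θ : ℝ) :
    HasSum (fun j : ℤ => ‖boxFourier (θ + 2 * Real.pi * j)‖ ^ (2 * m)) (Pcos m θ) := by
  have : Pcos m θ = ∑' j : ℤ, ‖boxFourier (θ + 2 * Real.pi * j)‖ ^ (2 * m) := by
    rw [Pcos, ← tsum_mul_left]
    exact tsum_congr fun j => norm_fourierTr_sq m hm _
  rw [this]
  exact (summable_boxFourier m hm θ).hasSum

theorem integral_centered_bspline_exp (m : ℕ) (hm : 1 ≤ m) (ξ : ℝ) :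
    ∫ t : ℝ, (bspline (2 * m) (t + m) : ℂ) * Complex.exp (-(Complex.I * (ξ : ℂ) * (t : ℂ))) =
      ((‖boxFourier ξ‖ ^ (2 * m) : ℝ) : ℂ) := by
  have h := integral_bspline_exp (2 * m - 1) ξ
  rw [Nat.sub_add_cancel (by omega)] at h
  rw [← integral_add_right_eq_self _ (m : ℝ)] at h
  rw [pow_mul, Complex.ofReal_pow, norm_boxFourier_sq, mul_pow, ← pow_mul, ← h,
    ← integral_mul_const]
  refine integral_congr_ae (Eventually.of_forall fun x => ?_)
  simp only
  rw [mul_assoc (bspline (2 * m) (x + m) : ℂ), ← Complex.exp_nat_mul, ← Complex.exp_add]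
  congr 2
  push_cast
  ring

theorem hasCompactSupport_of_bspline (n : ℕ) (a : ℝ) (E : ℝ → ℂ) :
    HasCompactSupport fun t : ℝ => (bspline n (t + a) : ℂ) * E t := by
  refine HasCompactSupport.intro (isCompact_Icc (a := -a) (b := n - a)) fun t ht => ?_
  rw [Set.mem_Icc, not_and_or, not_le, not_le] at ht
  rcases ht with ht | ht
  · rw [bspline_of_neg n (by linarith)]; simp
  · rw [bspline_of_ge n (by linarith)]; simp

theorem bspline_shift_eq_zero (m : ℕ) (n : ℤ) (hn : n ∉ Finset.Ioo (-(m : ℤ)) m) :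
    bspline (2 * m) (m + n) = 0 := by
  rw [Finset.mem_Ioo, not_and_or, not_lt, not_lt] at hn
  rcases hn with hn | hn
  · rcases hn.lt_or_eq with h | h
    · apply bspline_of_neg
      have : (n : ℝ) < -m := by exact_mod_cast h
      linarith
    -- The argument is the left end of the support; the value there is 0 by continuity from the
    -- left.
    · have h0 : (m : ℝ) + n = 0 := by
        have : (n : ℝ) = -m := by exact_mod_cast h
        rw [this]; ring
      rw [h0]
      cases m with
      | zero => rfl
      | succ m =>
        have hc := continuous_bspline (2 * m)
        have h1 : Tendsto (bspline (2 * m + 2)) (𝓝[<] 0) (𝓝 (bspline (2 * m + 2) 0)) :=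
          (hc.tendsto 0).mono_left nhdsWithin_le_nhds
        have h2 : Tendsto (bspline (2 * m + 2)) (𝓝[<] 0) (𝓝 0) := by
          refine tendsto_const_nhds.congr' ?_
          filter_upwards [self_mem_nhdsWithin] with x hx
          exact (bspline_of_neg _ hx).symm
        exact tendsto_nhds_unique h1 h2
  · apply bspline_of_ge
    have : (m : ℝ) ≤ n := by exact_mod_cast hn
    push_cast
    linarith

/-- The sequence `k ↦ N_{2m}(m + k)` of autocorrelations of `N_m`. -/
noncomputable def autocorr (m : ℕ) (k : ℤ) : ℝ := bspline (2 * m) (m + k)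

theorem symAt_autocorr_finite (m : ℕ) (w : ℂ) :
    SymAt (autocorr m) w (∑ n ∈ Finset.Ioo (-(m : ℤ)) m, (autocorr m n : ℂ) * w ^ n) := by
  refine hasSum_sum_of_ne_finset_zero fun n hn => ?_
  rw [autocorr, bspline_shift_eq_zero m n hn]
  simp

/-- Poisson summation for the modulated centred spline N_{2m}(t + m) e^{iθt}, which is continuous
with compact support and has transform |box|^{2m} at the shifted frequencies. -/
theorem symAt_autocorr (m : ℕ) (hm : 1 ≤ m) (θ : ℝ) :
    SymAt (autocorr m) (Complex.exp (θ * Complex.I)) (Pcos m θ : ℂ) := by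
  let f : ℝ → ℂ := fun t => (bspline (2 * m) (t + m) : ℂ) * Complex.exp (Complex.I * θ * t)
  have hfc : Continuous f := by
    have := continuous_bspline (2 * m - 2)
    rw [Nat.sub_add_cancel (by omega)] at this
    fun_prop
  have hF : ∀ n : ℤ, FourierTransform.fourier f (n : ℝ) =
      ((‖boxFourier (θ + 2 * Real.pi * ((-n : ℤ) : ℝ))‖ ^ (2 * m) : ℝ) : ℂ) := by
    intro n
    have h0 : θ + 2 * Real.pi * ((-n : ℤ) : ℝ) = -(2 * Real.pi * n - θ) := by push_cast; ring
    rw [h0, norm_boxFourier_neg, ← integral_centered_bspline_exp m hm, Real.fourier_eq']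
    refine integral_congr_ae (Eventually.of_forall fun x => ?_)
    simp only [f, smul_eq_mul]
    rw [mul_left_comm, ← Complex.exp_add]
    congr 2
    simp
    ring
  have hsum := (Equiv.neg ℤ).hasSum_iff.2 (hasSum_Pcos m hm θ)
  have hsumC : HasSum (fun n : ℤ => FourierTransform.fourier f (n : ℝ)) (Pcos m θ : ℂ) := by
    simp_rw [hF]
    exact Complex.hasSum_ofReal.2 hsum
  have hO : f =O[cocompact ℝ] fun x : ℝ => |x| ^ (-2 : ℝ) := by
    have h1 : f =ᶠ[cocompact ℝ] 0 := by
      have := hasCompactSupport_of_bspline (2 * m) m fun t => Complex.exp (Complex.I * θ * t)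
      exact hasCompactSupport_iff_eventuallyEq.1 this |>.filter_mono cocompact_le_coclosedCompact
    exact h1.trans_isBigO (isBigO_zero _ _)
  have hP := Real.tsum_eq_tsum_fourier_of_rpow_decay_of_summable hfc one_lt_two hO
    hsumC.summable 0
  have h2 := symAt_autocorr_finite m (Complex.exp (θ * Complex.I))
  have h3 : (Pcos m θ : ℂ) = ∑' n : ℤ, (autocorr m n : ℂ) * Complex.exp (θ * Complex.I) ^ n := by
    rw [← hsumC.tsum_eq]
    simp only [QuotientAddGroup.mk_zero, fourier_eval_zero, mul_one] at hP
    rw [← hP]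
    refine tsum_congr fun n => ?_
    simp only [f, autocorr, zero_add]
    rw [← Complex.exp_int_mul, add_comm (n : ℝ)]
    congr 2
    push_cast
    ring
  rw [h3]
  exact (HasSum.summable h2).hasSum

theorem hasSum_int_even_odd {E : Type*} [AddCommMonoid E] [TopologicalSpace E] [ContinuousAdd E]
    {f : ℤ → E} {a b : E} (ha : HasSum (fun k : ℤ => f (2 * k)) a)
    (hb : HasSum (fun k : ℤ => f (2 * k + 1)) b) : HasSum f (a + b) := by
  have h2 : Function.Injective fun k : ℤ => 2 * k := fun x y h => by simpa using h
  have h3 : Function.Injective fun k : ℤ => 2 * k + 1 := fun x y h => by simpa using h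
  replace ha := h2.hasSum_range_iff.2 ha
  replace hb := h3.hasSum_range_iff.2 hb
  refine ha.add_isCompl ?_ hb
  simpa [Function.comp_def] using Int.isCompl_even_odd

/-- Halve the frequency in every term and separate even from odd translates: even ones see cos θ,
odd ones see cos(θ + π). -/
theorem Pcos_two_mul (m : ℕ) (hm : 1 ≤ m) (θ : ℝ) :
    Pcos m (2 * θ) = ((1 + Real.cos θ) / 2) ^ m * Pcos m θ +
      ((1 - Real.cos θ) / 2) ^ m * Pcos m (θ + Real.pi) := by
  have key : ∀ j : ℤ, ‖boxFourier (2 * θ + 2 * Real.pi * j)‖ ^ (2 * m) =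
      ((1 + Real.cos (θ + Real.pi * j)) / 2) ^ m * ‖boxFourier (θ + Real.pi * j)‖ ^ (2 * m) := by
    intro j
    rw [show 2 * θ + 2 * Real.pi * j = 2 * (θ + Real.pi * j) by ring, boxFourier_two_mul, norm_mul,
      mul_pow, pow_mul ‖(1 + _) / 2‖, norm_one_add_exp_sq]
    ring
  have he := (hasSum_Pcos m hm θ).mul_left (((1 + Real.cos θ) / 2) ^ m)
  have ho := (hasSum_Pcos m hm (θ + Real.pi)).mul_left (((1 - Real.cos θ) / 2) ^ m)
  have h := hasSum_Pcos m hm (2 * θ)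
  refine h.unique (hasSum_int_even_odd (he.congr_fun fun j => ?_) (ho.congr_fun fun j => ?_))
  · rw [key, show θ + Real.pi * ((2 * j : ℤ) : ℝ) = θ + j * (2 * Real.pi) by push_cast; ring,
      Real.cos_add_int_mul_two_pi, show θ + j * (2 * Real.pi) = θ + 2 * Real.pi * j by ring]
  · rw [key, show θ + Real.pi * ((2 * j + 1 : ℤ) : ℝ) = θ + Real.pi + j * (2 * Real.pi) by
      push_cast; ring, Real.cos_add_int_mul_two_pi, Real.cos_add_pi,
      show θ + Real.pi + j * (2 * Real.pi) = θ + Real.pi + 2 * Real.pi * j by ring, ← sub_eq_add_neg]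

theorem Pcos_nonneg (m : ℕ) (hm : 1 ≤ m) (θ : ℝ) : 0 ≤ Pcos m θ :=
  (hasSum_Pcos m hm θ).nonneg fun _ => by positivity

end BSplineWavelet

/-! ### Eulerian polynomials: real, simple, negative, reciprocal roots. -/

namespace BSplineWavelet

open scoped Topology
open Polynomial

/-- The scaled values `n! N_{n+1}(k)` of the B-spline at the knots: Eulerian numbers. -/
noncomputable def eulerNum (n k : ℕ) : ℝ := n.factorial * bspline (n + 1) k

theorem eulerNum_succ (n k : ℕ) : eulerNum (n + 1) (k + 1) =
    (k + 1) * eulerNum n (k + 1) + (n + 1 - k) * eulerNum n k := by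
  have h := bspline_recurrence n ((k : ℝ) + 1)
  unfold eulerNum
  rw [Nat.factorial_succ]
  push_cast
  rw [add_sub_cancel_right] at h
  linear_combination (n.factorial : ℝ) * h

theorem eulerNum_zero (n : ℕ) : eulerNum (n + 1) 0 = 0 := by
  unfold eulerNum
  have h : bspline (n + 2) 0 = 0 := by
    have h1 := bspline_recurrence n 0
    rw [bspline_of_neg (n + 1) (by norm_num : (0 : ℝ) - 1 < 0)] at h1
    have h2 : (n : ℝ) + 1 ≠ 0 := by positivity
    simpa [h2] using h1
  simp [h]

theorem eulerNum_of_lt {n k : ℕ} (h : n < k) : eulerNum n k = 0 := by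
  rw [eulerNum, bspline_of_ge, mul_zero]
  exact_mod_cast h

theorem eulerNum_nonneg (n k : ℕ) : 0 ≤ eulerNum n k :=
  mul_nonneg (by positivity) (bspline_nonneg _ _)

theorem eulerNum_one_one : eulerNum 1 1 = 1 := by
  have : bspline 1 0 = 1 := by simp [bspline]
  have h := bspline_recurrence 0 1
  rw [bspline_of_ge 1 (by norm_num : ((1 : ℕ) : ℝ) ≤ 1), sub_self, this] at h
  norm_num at h
  simp [eulerNum, h]

theorem eulerNum_one (n : ℕ) : eulerNum (n + 1) 1 = 1 := by
  induction n with
  | zero => exact eulerNum_one_one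
  | succ n ih =>
    have := eulerNum_succ (n + 1) 0
    rw [zero_add, ih, eulerNum_zero] at this
    simpa using this

theorem eulerNum_symm (n : ℕ) {i j : ℕ} (h : i + j = n + 2) :
    eulerNum (n + 1) i = eulerNum (n + 1) j := by
  induction n generalizing i j with
  | zero =>
    have : i ≤ 2 := by omega
    have h2 : eulerNum 1 2 = 0 := eulerNum_of_lt (by norm_num)
    interval_cases i
    · obtain rfl : j = 2 := by omega
      rw [eulerNum_zero, h2]
    · obtain rfl : j = 1 := by omega
      rfl
    · obtain rfl : j = 0 := by omega
      rw [eulerNum_zero, h2]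
  | succ n ih =>
    rcases Nat.eq_zero_or_pos i with rfl | hi
    · rw [eulerNum_zero, eulerNum_of_lt (by omega)]
    rcases Nat.eq_zero_or_pos j with rfl | hj
    · rw [eulerNum_zero, eulerNum_of_lt (by omega)]
    obtain ⟨i, rfl⟩ := Nat.exists_eq_succ_of_ne_zero hi.ne'
    obtain ⟨j, rfl⟩ := Nat.exists_eq_succ_of_ne_zero hj.ne'
    rw [Nat.succ_eq_add_one, Nat.succ_eq_add_one, eulerNum_succ (n + 1) i, eulerNum_succ (n + 1) j, ih (i := i + 1) (j := j) (by omega),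
      ih (i := i) (j := j + 1) (by omega)]
    have : (i : ℝ) + j = n + 1 := by
      have : i + j = n + 1 := by omega
      exact_mod_cast this
    push_cast
    linear_combination (eulerNum (n + 1) j - eulerNum (n + 1) (j + 1)) * this

/-- The Eulerian polynomial `∑_{i < n} n! N_{n+1}(i + 1) zⁱ`. -/
noncomputable def eulerPoly (n : ℕ) : ℝ[X] :=
  ∑ i ∈ Finset.range n, C (eulerNum n (i + 1)) * X ^ i

theorem eulerFrobenius_eq (m : ℕ) (hm : 1 ≤ m) : eulerFrobenius m = eulerPoly (2 * m - 1) := by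
  unfold eulerFrobenius eulerPoly eulerNum
  rw [Nat.sub_add_cancel (by omega)]
  push_cast
  rfl

theorem coeff_eulerPoly (n k : ℕ) : (eulerPoly n).coeff k = eulerNum n (k + 1) := by
  unfold eulerPoly
  simp only [finsetSum_coeff, coeff_C_mul, coeff_X_pow, mul_ite, mul_one, mul_zero,
    Finset.sum_ite_eq, Finset.mem_range]
  split_ifs with h
  · rfl
  · rw [eulerNum_of_lt (by omega)]

theorem coeff_X_mul_derivative (p : ℝ[X]) (k : ℕ) :
    (X * derivative p).coeff k = k * p.coeff k := by
  cases k with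
  | zero => simp
  | succ k => rw [coeff_X_mul, coeff_derivative]; push_cast; ring

theorem eulerPoly_succ (n : ℕ) : eulerPoly (n + 2) =
    (1 + C ((n : ℝ) + 1) * X) * eulerPoly (n + 1) +
      (1 - X) * (X * derivative (eulerPoly (n + 1))) := by
  ext k
  rw [add_mul, sub_mul, one_mul, one_mul, mul_assoc, coeff_add, coeff_add, coeff_sub, coeff_C_mul,
    coeff_X_mul_derivative, coeff_eulerPoly, coeff_eulerPoly, eulerNum_succ]
  cases k with
  | zero => simp [eulerNum_zero]
  | succ k =>
    rw [coeff_X_mul, coeff_X_mul, coeff_X_mul_derivative, coeff_eulerPoly]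
    push_cast
    ring

theorem eulerPoly_ne_zero (n : ℕ) : eulerPoly (n + 1) ≠ 0 := fun h => by
  have := coeff_eulerPoly (n + 1) 0
  rw [h, zero_add, eulerNum_one] at this
  simp at this

theorem eulerPoly_natDegree (n : ℕ) : (eulerPoly (n + 1)).natDegree = n := by
  apply le_antisymm
  · rw [natDegree_le_iff_coeff_eq_zero]
    intro k hk
    rw [coeff_eulerPoly, eulerNum_of_lt (by omega)]
  · apply le_natDegree_of_ne_zero
    rw [coeff_eulerPoly, eulerNum_symm n (j := 1) (by omega), eulerNum_one]
    exact one_ne_zero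

theorem eulerPoly_monic (n : ℕ) : (eulerPoly (n + 1)).Monic := by
  rw [Monic, leadingCoeff, eulerPoly_natDegree, coeff_eulerPoly, eulerNum_symm n (j := 1) (by omega),
    eulerNum_one]

theorem eval_eulerPoly (n : ℕ) (x : ℝ) :
    (eulerPoly n).eval x = ∑ i ∈ Finset.range n, eulerNum n (i + 1) * x ^ i := by
  simp [eulerPoly, eval_finsetSum]

theorem neg_of_isRoot_eulerPoly {n : ℕ} {x : ℝ} (h : (eulerPoly (n + 1)).IsRoot x) : x < 0 := by
  by_contra hx
  rw [not_lt] at hx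
  rw [IsRoot.def, eval_eulerPoly, Finset.sum_range_succ', zero_add, eulerNum_one] at h
  have : 0 ≤ ∑ i ∈ Finset.range n, eulerNum (n + 1) (i + 1 + 1) * x ^ (i + 1) :=
    Finset.sum_nonneg fun i _ => mul_nonneg (eulerNum_nonneg _ _) (by positivity)
  simp only [pow_zero] at h
  linarith

theorem eval_inv_eulerPoly (n : ℕ) {x : ℝ} (hx : x ≠ 0) :
    (eulerPoly (n + 1)).eval x = x ^ n * (eulerPoly (n + 1)).eval x⁻¹ := by
  rw [eval_eulerPoly, eval_eulerPoly, Finset.mul_sum, ← Finset.sum_range_reflect]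
  refine Finset.sum_congr rfl fun i hi => ?_
  rw [Finset.mem_range] at hi
  have h1 : n + 1 - 1 - i + i = n := by omega
  rw [eulerNum_symm n (i := n + 1 - 1 - i + 1) (j := i + 1) (by omega)]
  have h2 : x ^ n = x ^ (n + 1 - 1 - i) * x ^ i := by rw [← pow_add, h1]
  rw [h2, inv_pow]
  field_simp

/-- The polynomials `t^{n+1} z E_n(z)`, where `z = 1 - 1/t` and `E_n` is the Eulerian polynomial
(`n` is shifted by one). -/
noncomputable def rollePoly : ℕ → ℝ[X]
  | 0 => X ^ 2 - X
  | n + 1 => (X ^ 2 - X) * derivative (rollePoly n)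

/-- The substitution z = 1 - 1/t turns the recurrence `eulerPoly_succ` into the operator (t² - t)
d/dt, to which Rolle's theorem applies directly. -/
theorem eval_rollePoly (n : ℕ) {t : ℝ} (ht : t ≠ 0) :
    (rollePoly n).eval t = t ^ (n + 2) * (1 - t⁻¹) * (eulerPoly (n + 1)).eval (1 - t⁻¹) := by
  induction n generalizing t with
  | zero =>
    rw [eval_eulerPoly]
    simp [rollePoly, eulerNum_one_one]
    field_simp
  | succ n ih =>
    have h1 : HasDerivAt (fun t : ℝ => 1 - t⁻¹) ((t ^ 2)⁻¹) t := by
      simpa using (hasDerivAt_inv ht).const_sub 1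
    have h2 := (((hasDerivAt_pow (n + 2) t).mul h1).mul
      (((eulerPoly (n + 1)).hasDerivAt (1 - t⁻¹)).comp t h1))
    have h3 : HasDerivAt (fun t => (rollePoly n).eval t) _ t := h2.congr_of_eventuallyEq (by
      filter_upwards [isOpen_ne.mem_nhds ht] with s hs
      simp only [ih hs, Pi.mul_apply, Function.comp_apply])
    have h4 := ((rollePoly n).hasDerivAt t).unique h3
    rw [rollePoly, eval_mul, h4, eulerPoly_succ]
    simp only [eval_sub, eval_pow, eval_X, eval_add, eval_mul, eval_one, eval_C, Pi.mul_apply,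
      Function.comp_apply]
    have h5 : (n + 2 - 1 : ℕ) = n + 1 := rfl
    rw [h5]
    push_cast
    field_simp
    ring

theorem rollePoly_isRoot (n : ℕ) : (rollePoly n).eval 0 = 0 ∧ (rollePoly n).eval 1 = 0 := by
  cases n <;> simp [rollePoly]

/-- Rolle: `n + 2` distinct roots give `n + 1` new roots of the derivative, and the factor t² - t
puts 0 and 1 back. -/
theorem card_roots_rollePoly (n : ℕ) :
    rollePoly n ≠ 0 ∧ n + 2 ≤ (rollePoly n).roots.toFinset.card := by
  have hq : (X ^ 2 - X : ℝ[X]) ≠ 0 := fun h => by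
    have := congrArg (eval 2) h
    norm_num at this
  induction n with
  | zero =>
    refine ⟨hq, ?_⟩
    have : ({0, 1} : Finset ℝ) ⊆ (rollePoly 0).roots.toFinset := by
      intro x hx
      rw [Multiset.mem_toFinset, rollePoly, mem_roots hq]
      simp only [Finset.mem_insert, Finset.mem_singleton] at hx
      rcases hx with rfl | rfl <;> simp
    exact (by simp : 0 + 2 = ({0, 1} : Finset ℝ).card).trans_le (Finset.card_le_card this)
  | succ n ih =>
    obtain ⟨h0, hc⟩ := ih
    have hR := card_roots_toFinset_le_card_roots_derivative_sdiff_roots_succ (rollePoly n)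
    have hd : derivative (rollePoly n) ≠ 0 := fun h => by
      rw [h] at hR
      simp at hR
      omega
    have hne : rollePoly (n + 1) ≠ 0 := mul_ne_zero hq hd
    refine ⟨hne, ?_⟩
    have hdis : Disjoint ({0, 1} : Finset ℝ)
        ((derivative (rollePoly n)).roots.toFinset \ (rollePoly n).roots.toFinset) := by
      rw [Finset.disjoint_left]
      intro x hx hx2
      rw [Finset.mem_sdiff, Multiset.mem_toFinset, Multiset.mem_toFinset, mem_roots h0] at hx2
      simp only [Finset.mem_insert, Finset.mem_singleton] at hx
      rcases hx with rfl | rfl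
      · exact hx2.2 (rollePoly_isRoot n).1
      · exact hx2.2 (rollePoly_isRoot n).2
    have hsub : ({0, 1} : Finset ℝ) ∪
        ((derivative (rollePoly n)).roots.toFinset \ (rollePoly n).roots.toFinset) ⊆
        (rollePoly (n + 1)).roots.toFinset := by
      intro x hx
      rw [Multiset.mem_toFinset, mem_roots hne]
      rw [Finset.mem_union, Finset.mem_sdiff, Multiset.mem_toFinset, mem_roots hd] at hx
      rcases hx with hx | hx
      · simp only [Finset.mem_insert, Finset.mem_singleton] at hx
        rcases hx with rfl | rfl
        · exact (rollePoly_isRoot (n + 1)).1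
        · exact (rollePoly_isRoot (n + 1)).2
      · rw [IsRoot.def, rollePoly, eval_mul, hx.1, mul_zero]
    have := Finset.card_le_card hsub
    rw [Finset.card_union_of_disjoint hdis, Finset.card_pair zero_ne_one] at this
    omega

/-- Removing 0 and 1 from the roots of `rollePoly` leaves at least `n`, sent injectively to roots of
the Eulerian polynomial; the degree is `n`, so all roots are real and simple. -/
theorem card_roots_eulerPoly (n : ℕ) : (eulerPoly (n + 1)).roots.toFinset.card = n := by
  apply le_antisymm
  · exact (Multiset.toFinset_card_le _).trans ((card_roots' _).trans (eulerPoly_natDegree n).le)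
  · obtain ⟨h0, hc⟩ := card_roots_rollePoly n
    have h1 : n ≤ ((rollePoly n).roots.toFinset \ {0, 1}).card := by
      have := Finset.le_card_sdiff ({0, 1} : Finset ℝ) (rollePoly n).roots.toFinset
      rw [Finset.card_pair zero_ne_one] at this
      omega
    refine h1.trans (Finset.card_le_card_of_injOn (fun t => 1 - t⁻¹) ?_ ?_)
    · intro t ht
      simp only [Finset.coe_sdiff, Set.mem_sdiff, Finset.mem_coe, Multiset.mem_toFinset,
        mem_roots h0, IsRoot.def, Finset.mem_insert, Finset.mem_singleton, not_or] at ht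
      obtain ⟨ht, h2, h3⟩ := ht
      simp only [Finset.mem_coe, Multiset.mem_toFinset, mem_roots (eulerPoly_ne_zero n), IsRoot.def]
      rw [eval_rollePoly n h2] at ht
      have h4 : 1 - t⁻¹ ≠ 0 := fun h => h3 (by
        rw [sub_eq_zero] at h
        exact (inv_eq_one.1 h.symm))
      simpa [h2, h4] using ht
    · intro a _ b _ h
      simpa using h

theorem eulerPoly_eq_prod (n : ℕ) :
    eulerPoly (n + 1) = ∏ r ∈ (eulerPoly (n + 1)).roots.toFinset, (X - C r) := by
  have h1 := card_roots_eulerPoly n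
  have h2 : Multiset.card (eulerPoly (n + 1)).roots ≤ n :=
    (card_roots' _).trans (eulerPoly_natDegree n).le
  have h3 : Multiset.card (eulerPoly (n + 1)).roots = n :=
    le_antisymm h2 (h1.symm.trans_le (Multiset.toFinset_card_le _))
  have hnd : (eulerPoly (n + 1)).roots.Nodup := by
    rw [← Multiset.toFinset_card_eq_card_iff_nodup, h1, h3]
  have := prod_multiset_X_sub_C_of_monic_of_roots_card_eq (eulerPoly_monic n)
    (h3.trans (eulerPoly_natDegree n).symm)
  rw [← Multiset.toFinset_val (eulerPoly (n + 1)).roots |>.trans hnd.dedup] at this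
  exact this.symm

/-- The roots of the Euler–Frobenius polynomial in `(-1, 0)`. -/
noncomputable def innerRoots (m : ℕ) : Finset ℝ :=
  (eulerFrobenius m).roots.toFinset.filter (fun x => -1 < x)

theorem innerRoots_bounds {m : ℕ} (hm : 1 ≤ m) {r : ℝ} (hr : r ∈ innerRoots m) :
    -1 < r ∧ r < 0 := by
  obtain ⟨m, rfl⟩ := Nat.exists_eq_add_of_le' hm
  rw [innerRoots, Finset.mem_filter, Multiset.mem_toFinset, eulerFrobenius_eq _ hm,
    show 2 * (m + 1) - 1 = 2 * m + 1 by omega, mem_roots (eulerPoly_ne_zero _)] at hr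
  exact ⟨hr.2, neg_of_isRoot_eulerPoly hr.1⟩

theorem roots_eulerFrobenius (m : ℕ) :
    (eulerFrobenius (m + 1)).roots.toFinset =
      innerRoots (m + 1) ∪ (innerRoots (m + 1)).image (·⁻¹) ∧
    Disjoint (innerRoots (m + 1)) ((innerRoots (m + 1)).image (·⁻¹)) ∧
    (innerRoots (m + 1)).card = m := by
  set R := (eulerFrobenius (m + 1)).roots.toFinset with hR
  have hef : eulerFrobenius (m + 1) = eulerPoly (2 * m + 1) := eulerFrobenius_eq _ (by omega)
  have hmem : ∀ x, x ∈ R ↔ (eulerPoly (2 * m + 1)).eval x = 0 := fun x => by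
    rw [hR, Multiset.mem_toFinset, hef, mem_roots (eulerPoly_ne_zero _), IsRoot.def]
  have hcard : R.card = 2 * m := by rw [hR, hef, card_roots_eulerPoly]
  have hneg : ∀ x ∈ R, x < 0 := fun x hx => neg_of_isRoot_eulerPoly ((hmem x).1 hx)
  have hinv : ∀ x ∈ R, x⁻¹ ∈ R := fun x hx => by
    have h0 := (hneg x hx).ne
    have h := eval_inv_eulerPoly (2 * m) h0
    rw [(hmem x).1 hx] at h
    rw [hmem]
    simpa [h0] using h.symm
  have hin : ∀ x, x ∈ innerRoots (m + 1) ↔ x ∈ R ∧ -1 < x := fun x => by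
    rw [innerRoots, Finset.mem_filter]
  have him : ∀ x, x ∈ (innerRoots (m + 1)).image (·⁻¹) ↔ x ∈ R ∧ x < -1 := fun x => by
    rw [Finset.mem_image]
    constructor
    · rintro ⟨y, hy, rfl⟩
      rw [hin] at hy
      refine ⟨hinv y hy.1, ?_⟩
      have := hneg y hy.1
      rw [inv_lt_of_neg this (by norm_num)]
      norm_num
      exact hy.2
    · rintro ⟨hx, h1⟩
      refine ⟨x⁻¹, ?_, inv_inv x⟩
      rw [hin]
      refine ⟨hinv x hx, ?_⟩
      have := hneg x hx
      rw [lt_inv_of_neg (by norm_num) this]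
      norm_num
      exact h1
  have hdis : Disjoint (innerRoots (m + 1)) ((innerRoots (m + 1)).image (·⁻¹)) := by
    rw [Finset.disjoint_left]
    intro x hx hx2
    have h1 := ((hin x).1 hx).2
    have h2 := ((him x).1 hx2).2
    linarith
  have hci : ((innerRoots (m + 1)).image (·⁻¹)).card = (innerRoots (m + 1)).card :=
    Finset.card_image_of_injective _ inv_injective
  -- Parity: the remaining roots pair off as r, 1/r, so a root -1 would make the even number of
  -- roots odd.
  have hR1 : (-1 : ℝ) ∉ R := by
    intro h
    have : R = insert (-1) (innerRoots (m + 1) ∪ (innerRoots (m + 1)).image (·⁻¹)) := by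
      ext x
      rw [Finset.mem_insert, Finset.mem_union, hin, him]
      constructor
      · intro hx
        rcases lt_trichotomy x (-1) with h1 | h1 | h1
        · exact Or.inr (Or.inr ⟨hx, h1⟩)
        · exact Or.inl h1
        · exact Or.inr (Or.inl ⟨hx, h1⟩)
      · rintro (rfl | h1 | h1)
        · exact h
        · exact h1.1
        · exact h1.1
    have h2 := congrArg Finset.card this
    rw [Finset.card_insert_of_notMem, Finset.card_union_of_disjoint hdis, hci, hcard] at h2
    · omega
    · rw [Finset.mem_union, hin, him]
      simp
  have hU : R = innerRoots (m + 1) ∪ (innerRoots (m + 1)).image (·⁻¹) := by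
    ext x
    rw [Finset.mem_union, hin, him]
    constructor
    · intro hx
      rcases lt_trichotomy x (-1) with h1 | h1 | h1
      · exact Or.inr ⟨hx, h1⟩
      · exact absurd (h1 ▸ hx) hR1
      · exact Or.inl ⟨hx, h1⟩
    · rintro (h1 | h1)
      · exact h1.1
      · exact h1.1
  refine ⟨hU, hdis, ?_⟩
  have h2 := congrArg Finset.card hU
  rw [Finset.card_union_of_disjoint hdis, hci, hcard] at h2
  omega

theorem efRoot_spec (m : ℕ) : efRoot (m + 2) (m + 1) ∈ innerRoots (m + 2) ∧
    ∀ r ∈ innerRoots (m + 2), efRoot (m + 2) (m + 1) ≤ r := by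
  obtain ⟨hU, hdis, hc⟩ := roots_eulerFrobenius (m + 1)
  set A := innerRoots (m + 2) with hA
  set B := (innerRoots (m + 2)).image (·⁻¹) with hB
  have hneg : ((eulerFrobenius (m + 2)).roots.toFinset.filter (fun x => x < 0)) = A ∪ B := by
    rw [← hU, Finset.filter_eq_self]
    intro x hx
    rw [Multiset.mem_toFinset, eulerFrobenius_eq _ (by omega),
      show 2 * (m + 2) - 1 = 2 * m + 2 + 1 by omega, mem_roots (eulerPoly_ne_zero _)] at hx
    exact neg_of_isRoot_eulerPoly hx
  have hBlt : ∀ b ∈ B, b < -1 := by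
    intro b hb
    rw [hB, Finset.mem_image] at hb
    obtain ⟨y, hy, rfl⟩ := hb
    have := innerRoots_bounds (by omega) hy
    rw [inv_lt_of_neg this.2 (by norm_num)]
    norm_num
    exact this.1
  -- In decreasing order all roots in (-1, 0) precede those below -1.
  have hsort : (A ∪ B).sort (fun x y => y ≤ x) =
      A.sort (fun x y => y ≤ x) ++ B.sort (fun x y => y ≤ x) := by
    refine List.Perm.eq_of_pairwise' (r := fun x y : ℝ => y ≤ x) (Finset.pairwise_sort _ _) ?_ ?_
    · rw [List.pairwise_append]
      refine ⟨Finset.pairwise_sort _ _, Finset.pairwise_sort _ _, fun a ha b hb => ?_⟩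
      rw [Finset.mem_sort] at ha hb
      exact ((hBlt b hb).trans (innerRoots_bounds (by omega) ha).1).le
    · refine (List.perm_ext_iff_of_nodup (Finset.sort_nodup _ _) ?_).2 fun x => ?_
      · rw [List.nodup_append]
        refine ⟨Finset.sort_nodup _ _, Finset.sort_nodup _ _, fun a ha b hb hab => ?_⟩
        rw [Finset.mem_sort] at ha hb
        exact Finset.disjoint_left.1 hdis ha (hab ▸ hb)
      · simp
  have hlen : (A.sort (fun x y => y ≤ x)).length = m + 1 := by rw [Finset.length_sort, hc]
  -- The 1-based index m + 1 is list position m, the last of the m + 1 inner roots, hence the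
  -- smallest of them.
  have hef : efRoot (m + 2) (m + 1) = (A.sort (fun x y => y ≤ x))[m] := by
    rw [efRoot, hneg, hsort, List.getD_append _ _ _ _ (by omega), List.getD_eq_getElem]
    rfl
  rw [hef]
  refine ⟨(Finset.mem_sort (fun x y : ℝ => y ≤ x)).1 (List.getElem_mem _), fun r hr => ?_⟩
  rw [← Finset.mem_sort (fun x y : ℝ => y ≤ x), List.mem_iff_getElem] at hr
  obtain ⟨i, hi, rfl⟩ := hr
  rcases (show i < m ∨ i = m by omega) with h | h
  · exact List.pairwise_iff_getElem.1 (Finset.pairwise_sort A fun x y => y ≤ x) i m hi (by omega) h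
  · simp [h]

/-- Pair r with 1/r and divide by a power of w: (w - r)(w - 1/r)/w = w + 1/w - (r + 1/r). Stated for
every nonzero `w` because it is also evaluated off the unit circle. -/
theorem symAt_autocorr_prod (m : ℕ) (hm : 1 ≤ m) {w : ℂ} (hw : w ≠ 0) :
    SymAt (autocorr m) w ((((2 * m - 1).factorial : ℝ)⁻¹ : ℂ) *
      ∏ r ∈ innerRoots m, (w + w⁻¹ - ((r + r⁻¹ : ℝ) : ℂ))) := by
  obtain ⟨m, rfl⟩ := Nat.exists_eq_add_of_le' hm
  rw [show 2 * (m + 1) - 1 = 2 * m + 1 by omega]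
  obtain ⟨hU, hdis, hc⟩ := roots_eulerFrobenius m
  have hef : eulerFrobenius (m + 1) = eulerPoly (2 * m + 1) := eulerFrobenius_eq _ (by omega)
  have hfac : ((2 * m + 1).factorial : ℂ) ≠ 0 := by exact_mod_cast (Nat.factorial_ne_zero _)
  have h1 : ∑ i ∈ Finset.range (2 * m + 1), (eulerNum (2 * m + 1) (i + 1) : ℂ) * w ^ i =
      ∏ r ∈ innerRoots (m + 1), ((w - r) * (w - (r : ℂ)⁻¹)) := by
    have h2 := congrArg (fun p : ℝ[X] => (p.map (algebraMap ℝ ℂ)).eval w) (eulerPoly_eq_prod (2 * m))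
    simp only [Polynomial.map_prod, eval_prod] at h2
    rw [← hef, hU, Finset.prod_union hdis, Finset.prod_image (fun a _ b _ h => inv_injective h),
      ← Finset.prod_mul_distrib, hef] at h2
    simpa [eulerPoly, Polynomial.map_sum, eval_finsetSum] using h2
  have h3 : ∏ r ∈ innerRoots (m + 1), (w + w⁻¹ - ((r + r⁻¹ : ℝ) : ℂ)) =
      (w ^ m)⁻¹ * ∏ r ∈ innerRoots (m + 1), ((w - r) * (w - (r : ℂ)⁻¹)) := by
    have h4 : (w ^ m)⁻¹ = ∏ r ∈ innerRoots (m + 1), w⁻¹ := by rw [Finset.prod_const, hc, inv_pow]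
    rw [h4, ← Finset.prod_mul_distrib]
    refine Finset.prod_congr rfl fun r hr => ?_
    have h5 : (r : ℂ) ≠ 0 := by exact_mod_cast (innerRoots_bounds (by omega) hr).2.ne
    push_cast
    field_simp
    ring
  rw [h3, ← h1]
  have h6 : (((2 * m + 1).factorial : ℝ)⁻¹ : ℂ) * ((w ^ m)⁻¹ *
      ∑ i ∈ Finset.range (2 * m + 1), (eulerNum (2 * m + 1) (i + 1) : ℂ) * w ^ i) =
      ∑ n ∈ (Finset.range (2 * m + 1)).image (fun i : ℕ => (i : ℤ) - m),
        (autocorr (m + 1) n : ℂ) * w ^ n := by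
    rw [Finset.sum_image (fun a _ b _ h => by simpa using h), Finset.mul_sum, Finset.mul_sum]
    refine Finset.sum_congr rfl fun i _ => ?_
    rw [zpow_sub₀ hw, zpow_natCast, zpow_natCast, autocorr, eulerNum,
      show 2 * m + 1 + 1 = 2 * (m + 1) by ring,
      show ((m + 1 : ℕ) : ℝ) + (((i : ℤ) - m : ℤ) : ℝ) = ((i + 1 : ℕ) : ℝ) by push_cast; ring]
    push_cast
    field_simp
  rw [h6]
  refine hasSum_sum_of_ne_finset_zero fun n hn => ?_
  rw [autocorr, bspline_shift_eq_zero (m + 1) n, Complex.ofReal_zero, zero_mul]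
  intro h
  apply hn
  rw [Finset.mem_Ioo] at h
  rw [Finset.mem_image]
  refine ⟨(n + m).toNat, ?_, ?_⟩
  · rw [Finset.mem_range]; push_cast at h; omega
  · push_cast at h
    rw [Int.toNat_of_nonneg (by omega)]
    ring

end BSplineWavelet

/-! ### The phase argument: the leading coefficient does not vanish. -/

namespace BSplineWavelet

open scoped Topology
open Polynomial

theorem exists_polar {a : ℝ} (ha : 0 < a) (t : ℝ) :
    ∃ R : ℝ, 0 < R ∧ (a + t * Complex.I : ℂ) = R * Complex.exp (Real.arctan (t / a) * Complex.I) := by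
  have h := Real.cos_arctan_pos (t / a)
  refine ⟨a / Real.cos (Real.arctan (t / a)), by positivity, ?_⟩
  rw [Complex.exp_mul_I, ← Complex.ofReal_cos, ← Complex.ofReal_sin]
  have h2 : t = a * (Real.sin (Real.arctan (t / a)) / Real.cos (Real.arctan (t / a))) := by
    rw [← Real.tan_eq_sin_div_cos, Real.tan_arctan]
    field_simp
  have h3 : (Real.cos (Real.arctan (t / a)) : ℂ) ≠ 0 := by exact_mod_cast h.ne'
  nth_rewrite 1 [h2]
  push_cast at h3 ⊢
  field_simp

theorem exists_polar_prod {ι : Type*} (R : Finset ι) (s : ι → ℝ) (hs : ∀ i ∈ R, 0 < s i) (t : ℝ) :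
    ∃ r : ℝ, 0 < r ∧ ∏ i ∈ R, (s i + t * Complex.I : ℂ) =
      r * Complex.exp ((∑ i ∈ R, Real.arctan (t / s i) : ℝ) * Complex.I) := by
  classical
  induction R using Finset.induction_on with
  | empty => exact ⟨1, one_pos, by simp⟩
  | insert i R hi ih =>
    obtain ⟨r, hr, h⟩ := ih fun j hj => hs j (Finset.mem_insert_of_mem hj)
    obtain ⟨r', hr', h'⟩ := exists_polar (hs i (Finset.mem_insert_self _ _)) t
    refine ⟨r' * r, by positivity, ?_⟩
    rw [Finset.prod_insert hi, Finset.sum_insert hi, h, h']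
    push_cast
    rw [add_mul, Complex.exp_add]
    ring

theorem exists_polar_pow {a : ℝ} (ha : 0 < a) (t : ℝ) (m : ℕ) :
    ∃ r : ℝ, 0 < r ∧ (a + t * Complex.I : ℂ) ^ m =
      r * Complex.exp ((m * Real.arctan (t / a) : ℝ) * Complex.I) := by
  obtain ⟨r, hr, h⟩ := exists_polar_prod (Finset.range m) (fun _ => a) (fun _ _ => ha) t
  exact ⟨r, hr, by simpa using h⟩

/-- At x = it the two terms on the right of `hQ` are conjugate, so the left side is a positive
multiple of cos g(t), where g is the phase of one term. Since g(0) = 0 and t = y is the first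
positive zero of the left side, g(y) = π/2. -/
theorem phase_at_first_zero {ι : Type*} {R : Finset ι} {s : ι → ℝ} {m : ℕ}
    (hs : ∀ i ∈ R, 2 < s i)
    (hQ : ∀ x : ℂ, ∏ i ∈ R, (x ^ 2 - 2 + s i) = ((2 + x) / 4) ^ m * ∏ i ∈ R, (x + s i) +
      ((2 - x) / 4) ^ m * ∏ i ∈ R, (-x + s i))
    {i₀ : ι} (hi₀ : i₀ ∈ R) (hmin : ∀ i ∈ R, s i₀ ≤ s i) {y : ℝ} (hy : 0 < y)
    (hys : 2 + y ^ 2 = s i₀) :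
    m * Real.arctan (y / 2) + ∑ i ∈ R, Real.arctan (y / s i) = Real.pi / 2 := by
  set g : ℝ → ℝ := fun t => m * Real.arctan (t / 2) + ∑ i ∈ R, Real.arctan (t / s i) with hg
  have hgc : Continuous g := by fun_prop
  have hs0 : ∀ i ∈ R, 0 < s i := fun i hi => by linarith [hs i hi]
  have key : ∀ t : ℝ, ∃ r : ℝ, 0 < r ∧ ∏ i ∈ R, (s i - 2 - t ^ 2) = r * Real.cos (g t) := by
    intro t
    obtain ⟨r, hr, h1⟩ := exists_polar_pow two_pos t m
    obtain ⟨r', hr', h2⟩ := exists_polar_prod R s hs0 t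
    refine ⟨2 * (1 / 4) ^ m * r * r', by positivity, ?_⟩
    set E := Complex.exp ((g t : ℝ) * Complex.I) with hE
    have hP : ((2 + t * Complex.I : ℂ)) ^ m * ∏ i ∈ R, (t * Complex.I + s i : ℂ) = r * r' * E := by
      have : (2 + t * Complex.I : ℂ) = ((2 : ℝ) + t * Complex.I : ℂ) := by push_cast; rfl
      simp_rw [add_comm (t * Complex.I : ℂ)]
      rw [this, h1, h2, hE, hg]
      push_cast
      rw [add_mul, Complex.exp_add]
      ring
    have hPc : ((2 - t * Complex.I : ℂ)) ^ m * ∏ i ∈ R, (-(t * Complex.I) + s i : ℂ) =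
        r * r' * starRingEnd ℂ E := by
      have := congrArg (starRingEnd ℂ) hP
      simp only [map_mul, map_pow, map_prod, map_add, Complex.conj_ofReal, Complex.conj_I,
        Complex.conj_ofNat] at this
      simpa [sub_eq_add_neg] using this
    have hx := hQ (t * Complex.I)
    rw [div_pow, div_pow, div_mul_eq_mul_div, div_mul_eq_mul_div, hP, hPc] at hx
    have hre : E + starRingEnd ℂ E = ((2 * Real.cos (g t) : ℝ) : ℂ) := by
      rw [Complex.add_conj, hE, Complex.exp_ofReal_mul_I_re]
    have hL : ∏ i ∈ R, ((t * Complex.I) ^ 2 - 2 + s i : ℂ) =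
        ((∏ i ∈ R, (s i - 2 - t ^ 2) : ℝ) : ℂ) := by
      push_cast
      refine Finset.prod_congr rfl fun i _ => ?_
      rw [mul_pow, Complex.I_sq]
      ring
    rw [hL] at hx
    have : ((∏ i ∈ R, (s i - 2 - t ^ 2) : ℝ) : ℂ) =
        ((2 * (1 / 4) ^ m * r * r' * Real.cos (g t) : ℝ) : ℂ) := by
      rw [hx, one_div, inv_pow]
      push_cast at hre ⊢
      linear_combination ((r : ℂ) * r' * (4 ^ m)⁻¹) * hre
    exact_mod_cast this
  have h0 : g 0 = 0 := by simp [hg]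
  have hpos : ∀ i ∈ R, 0 < Real.arctan (y / s i) := fun i hi =>
    Real.arctan_pos.2 (div_pos hy (hs0 i hi))
  have hgy : 0 < g y := by
    have h1 : 0 < ∑ i ∈ R, Real.arctan (y / s i) := Finset.sum_pos hpos ⟨i₀, hi₀⟩
    have h2 : 0 < Real.arctan (y / 2) := Real.arctan_pos.2 (by positivity)
    simp only [hg]
    positivity
  have hcos : Real.cos (g y) = 0 := by
    obtain ⟨r, hr, h⟩ := key y
    rw [Finset.prod_eq_zero hi₀ (by rw [← hys]; ring)] at h
    exact (mul_eq_zero.1 h.symm).resolve_left hr.ne'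
  -- Otherwise g takes the value π/2 at some t < y, making a factor vanish with s i = 2 + t² below
  -- the minimum s i₀.
  have hle : g y ≤ Real.pi / 2 := by
    by_contra hlt
    rw [not_le] at hlt
    obtain ⟨t, ht, hgt⟩ := intermediate_value_Icc hy.le hgc.continuousOn
      (show Real.pi / 2 ∈ Set.Icc (g 0) (g y) by rw [h0]; exact ⟨by positivity, hlt.le⟩)
    obtain ⟨r, hr, h⟩ := key t
    rw [hgt, Real.cos_pi_div_two, mul_zero, Finset.prod_eq_zero_iff] at h
    obtain ⟨i, hi, h⟩ := h
    have hty : t < y := lt_of_le_of_ne ht.2 fun h => by rw [h] at hgt; linarith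
    nlinarith [hmin i hi, ht.1]
  refine le_antisymm hle (not_lt.1 fun hlt => ?_)
  exact (Real.cos_pos_of_mem_Ioo ⟨by linarith [Real.pi_pos], hlt⟩).ne' hcos

/-- The coefficient of the leading singularity is neither real nor purely imaginary. -/
theorem singular_coeff_ne_zero {ι : Type*} {R : Finset ι} {s : ι → ℝ} {m : ℕ}
    (hs : ∀ i ∈ R, 2 < s i) (hm : 0 < m)
    (hQ : ∀ x : ℂ, ∏ i ∈ R, (x ^ 2 - 2 + s i) = ((2 + x) / 4) ^ m * ∏ i ∈ R, (x + s i) +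
      ((2 - x) / 4) ^ m * ∏ i ∈ R, (-x + s i))
    {i₀ : ι} (hi₀ : i₀ ∈ R) (hmin : ∀ i ∈ R, s i₀ ≤ s i) {ρ : ℝ} (h0 : 0 < ρ) (h1 : ρ < 1)
    (hρs : ρ ^ 2 + (ρ ^ 2)⁻¹ = s i₀) :
    ((1 + ρ * Complex.I) ^ m * ∏ i ∈ R, ((ρ - ρ⁻¹ : ℝ) * Complex.I + s i : ℂ)).re ≠ 0 ∧
    ((1 + ρ * Complex.I) ^ m * ∏ i ∈ R, ((ρ - ρ⁻¹ : ℝ) * Complex.I + s i : ℂ)).im ≠ 0 := by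
  set y := ρ⁻¹ - ρ with hy
  have hy0 : 0 < y := by
    have := (one_lt_inv₀ h0).2 h1
    linarith
  have hs0 : ∀ i ∈ R, 0 < s i := fun i hi => by linarith [hs i hi]
  have hph := phase_at_first_zero hs hQ hi₀ hmin hy0 (by rw [← hρs, hy]; field_simp; ring)
  set ω := Real.arctan ρ with hω
  set η := ∑ i ∈ R, Real.arctan (y / s i) with hη
  have hη0 : 0 < η :=
    Finset.sum_pos (fun i hi => Real.arctan_pos.2 (div_pos hy0 (hs0 i hi))) ⟨i₀, hi₀⟩
  -- y/2 = (1 - ρ²)/(2ρ) is the cotangent of 2 arctan ρ.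
  have hat : Real.arctan (y / 2) = Real.pi / 2 - 2 * ω := by
    have h2 := Real.two_mul_arctan (x := ρ) (by linarith) h1
    have h4 : 0 < 1 - ρ ^ 2 := by nlinarith
    have h3 : y / 2 = (2 * ρ / (1 - ρ ^ 2))⁻¹ := by
      rw [hy]
      field_simp
    rw [h3, Real.arctan_inv_of_pos (by positivity), ← h2]
  have hω1 : ω < Real.pi / 4 := by
    rw [← Real.arctan_one]
    exact Real.arctan_strictMono h1
  rw [hat] at hph
  obtain ⟨r, hr, e1⟩ := exists_polar_pow one_pos ρ m
  obtain ⟨r', hr', e2⟩ := exists_polar_prod R s hs0 (ρ - ρ⁻¹)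
  have hneg : ∑ i ∈ R, Real.arctan ((ρ - ρ⁻¹) / s i) = -η := by
    rw [hη, ← Finset.sum_neg_distrib]
    refine Finset.sum_congr rfl fun i _ => ?_
    rw [← Real.arctan_neg, hy]
    congr 1; ring
  set T := (m : ℝ) * ω - η with hT
  have hz : (1 + ρ * Complex.I : ℂ) ^ m * ∏ i ∈ R, ((ρ - ρ⁻¹ : ℝ) * Complex.I + s i : ℂ) =
      ((r * r' : ℝ) : ℂ) * Complex.exp ((T : ℝ) * Complex.I) := by
    have : (1 + ρ * Complex.I : ℂ) = ((1 : ℝ) + ρ * Complex.I : ℂ) := by push_cast; rfl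
    simp_rw [add_comm (((ρ - ρ⁻¹ : ℝ) : ℂ) * Complex.I)]
    rw [this, e1, e2, hneg, div_one, ← hω, hT]
    push_cast
    rw [sub_mul, sub_eq_add_neg, Complex.exp_add, neg_mul]
    ring
  -- The phase identity eliminates η. Then η > 0 bounds T above by (m-1)π/4 and ω < π/4 bounds it
  -- below by (m-2)π/4, so T is no multiple of π/4.
  have hTm : T = ((m : ℝ) - 1) * (Real.pi / 2) - m * ω := by linarith
  have hm' : (0 : ℝ) < m := by exact_mod_cast hm
  have hup : T < ((m : ℝ) - 1) * (Real.pi / 4) := by nlinarith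
  have hlo : ((m : ℝ) - 2) * (Real.pi / 4) < T := by nlinarith
  have hno : ∀ k : ℤ, T ≠ k * (Real.pi / 4) := by
    intro k hk
    rw [hk] at hup hlo
    have h5 := lt_of_mul_lt_mul_right hup (by positivity)
    have h6 := lt_of_mul_lt_mul_right hlo (by positivity)
    have h7 : k < (m : ℤ) - 1 := by exact_mod_cast h5
    have h8 : (m : ℤ) - 2 < k := by exact_mod_cast h6
    omega
  rw [hz, Complex.re_ofReal_mul, Complex.im_ofReal_mul, Complex.exp_ofReal_mul_I_re,
    Complex.exp_ofReal_mul_I_im]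
  refine ⟨mul_ne_zero (by positivity) fun h => ?_, mul_ne_zero (by positivity) fun h => ?_⟩
  · obtain ⟨k, hk⟩ := Real.cos_eq_zero_iff.1 h
    refine hno (2 * (2 * k + 1)) ?_
    rw [hk]; push_cast; ring
  · obtain ⟨k, hk⟩ := Real.sin_eq_zero_iff.1 h
    refine hno (4 * k) ?_
    rw [← hk]; push_cast; ring

theorem Pcos_eq_prod (m : ℕ) (hm : 1 ≤ m) (θ : ℝ) :
    Pcos m θ = ((2 * m - 1).factorial : ℝ)⁻¹ *
      ∏ r ∈ innerRoots m, (2 * Real.cos θ - (r + r⁻¹)) := by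
  have h := HasSum.unique (symAt_autocorr m hm θ)
    (symAt_autocorr_prod m hm (Complex.exp_ne_zero _))
  have h2 : Complex.exp (θ * Complex.I) + (Complex.exp (θ * Complex.I))⁻¹ =
      ((2 * Real.cos θ : ℝ) : ℂ) := by
    rw [← Complex.exp_neg, ← neg_mul, Complex.ofReal_mul, Complex.ofReal_cos, Complex.cos]
    push_cast
    ring
  rw [h2] at h
  exact_mod_cast h

theorem innerRoots_sum_lt {m : ℕ} (hm : 1 ≤ m) {r : ℝ} (hr : r ∈ innerRoots m) :
    2 < -(r + r⁻¹) := by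
  obtain ⟨h1, h2⟩ := innerRoots_bounds hm hr
  have h3 : -(r + r⁻¹) - 2 = (r + 1) ^ 2 / (-r) := by
    field_simp [h2.ne]
    ring
  have h4 : 0 < (r + 1) ^ 2 / (-r) := div_pos (pow_pos (by linarith) 2) (by linarith)
  linarith

theorem Pcos_pos (m : ℕ) (hm : 1 ≤ m) (θ : ℝ) : 0 < Pcos m θ := by
  rw [Pcos_eq_prod m hm]
  refine mul_pos (by positivity) (Finset.prod_pos fun r hr => ?_)
  linarith [innerRoots_sum_lt hm hr, Real.neg_one_le_cos θ]

/-- With x = 2cos θ this is `Pcos_two_mul` on [-2, 2]. Both sides are polynomials in x, so it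
persists for complex x, in particular on the imaginary axis. -/
theorem prod_two_scale (m : ℕ) (hm : 1 ≤ m) (x : ℂ) :
    ∏ r ∈ innerRoots m, (x ^ 2 - 2 + ((-(r + r⁻¹) : ℝ) : ℂ)) =
      ((2 + x) / 4) ^ m * ∏ r ∈ innerRoots m, (x + ((-(r + r⁻¹) : ℝ) : ℂ)) +
      ((2 - x) / 4) ^ m * ∏ r ∈ innerRoots m, (-x + ((-(r + r⁻¹) : ℝ) : ℂ)) := by
  let p : ℂ[X] := ∏ r ∈ innerRoots m, (X ^ 2 - C 2 + C ((-(r + r⁻¹) : ℝ) : ℂ))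
  let q : ℂ[X] := (C 4⁻¹ * (C 2 + X)) ^ m * ∏ r ∈ innerRoots m, (X + C ((-(r + r⁻¹) : ℝ) : ℂ)) +
      (C 4⁻¹ * (C 2 - X)) ^ m * ∏ r ∈ innerRoots m, (-X + C ((-(r + r⁻¹) : ℝ) : ℂ))
  have hp : ∀ z, p.eval z = ∏ r ∈ innerRoots m, (z ^ 2 - 2 + ((-(r + r⁻¹) : ℝ) : ℂ)) := fun z => by
    simp only [p, eval_prod, eval_add, eval_sub, eval_pow, eval_X, eval_C]
  have hq : ∀ z, q.eval z = ((2 + z) / 4) ^ m * ∏ r ∈ innerRoots m, (z + ((-(r + r⁻¹) : ℝ) : ℂ)) +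
      ((2 - z) / 4) ^ m * ∏ r ∈ innerRoots m, (-z + ((-(r + r⁻¹) : ℝ) : ℂ)) := fun z => by
    simp only [q, eval_prod, eval_add, eval_sub, eval_pow, eval_X, eval_C, eval_mul, eval_neg]
    ring
  rw [← hp, ← hq]
  congr 1
  refine eq_of_infinite_eval_eq p q (Set.Infinite.mono (s := (fun t : ℝ => (t : ℂ)) '' Set.Icc (-2) 2)
    ?_ ((Set.Icc_infinite (by norm_num)).image Complex.ofReal_injective.injOn))
  rintro _ ⟨t, ht, rfl⟩
  obtain ⟨θ, rfl⟩ : ∃ θ, t = 2 * Real.cos θ :=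
    ⟨Real.arccos (t / 2), by rw [Real.cos_arccos (by linarith [ht.1]) (by linarith [ht.2])]; ring⟩
  show p.eval _ = q.eval _
  rw [hp, hq]
  have h := Pcos_two_mul m hm θ
  rw [Pcos_eq_prod m hm, Pcos_eq_prod m hm, Pcos_eq_prod m hm, Real.cos_add_pi, Real.cos_two_mul] at h
  have hf : (((2 * m - 1).factorial : ℝ)⁻¹) ≠ 0 := by positivity
  have h2 : ∏ r ∈ innerRoots m, ((2 * Real.cos θ) ^ 2 - 2 + (-(r + r⁻¹))) =
      ((2 + 2 * Real.cos θ) / 4) ^ m * ∏ r ∈ innerRoots m, (2 * Real.cos θ + (-(r + r⁻¹))) +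
      ((2 - 2 * Real.cos θ) / 4) ^ m * ∏ r ∈ innerRoots m, (-(2 * Real.cos θ) + (-(r + r⁻¹))) := by
    apply mul_left_cancel₀ hf
    have e1 : ∏ r ∈ innerRoots m, (2 * (2 * Real.cos θ ^ 2 - 1) - (r + r⁻¹)) =
        ∏ r ∈ innerRoots m, ((2 * Real.cos θ) ^ 2 - 2 + (-(r + r⁻¹))) :=
      Finset.prod_congr rfl fun r _ => by ring
    have e2 : ∏ r ∈ innerRoots m, (2 * -Real.cos θ - (r + r⁻¹)) =
        ∏ r ∈ innerRoots m, (-(2 * Real.cos θ) + (-(r + r⁻¹))) :=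
      Finset.prod_congr rfl fun r _ => by ring
    rw [e1, e2] at h
    rw [h, show (2 + 2 * Real.cos θ) / 4 = (1 + Real.cos θ) / 2 by ring,
      show (2 - 2 * Real.cos θ) / 4 = (1 - Real.cos θ) / 2 by ring]
    simp only [← sub_eq_add_neg]
    ring
  beta_reduce
  exact_mod_cast h2

end BSplineWavelet

/-! ### Symbols of c, a and γ, and the factorisation of γ. -/

namespace BSplineWavelet

open scoped Topology

theorem norm_one_sub_mul_exp_sq (r θ : ℝ) :
    ‖1 - (r : ℂ) * Complex.exp (θ * Complex.I)‖ ^ 2 = 1 - 2 * r * Real.cos θ + r ^ 2 := by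
  rw [Complex.exp_mul_I, ← Complex.ofReal_cos, ← Complex.ofReal_sin, ← Complex.normSq_eq_norm_sq]
  have h1 : (1 - (r : ℂ) * (Real.cos θ + Real.sin θ * Complex.I) : ℂ) =
      ⟨1 - r * Real.cos θ, -(r * Real.sin θ)⟩ := by
    apply Complex.ext <;> simp [Complex.cos_ofReal_re, Complex.sin_ofReal_re]
  rw [h1, Complex.normSq_mk]
  linear_combination r ^ 2 * Real.sin_sq_add_cos_sq θ

theorem Pcos_congr (m : ℕ) (hm : 1 ≤ m) {θ θ' : ℝ} (h : Real.cos θ = Real.cos θ') :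
    Pcos m θ = Pcos m θ' := by
  rw [Pcos_eq_prod m hm, Pcos_eq_prod m hm, h]

theorem Pcos_eq_norm_prod (m : ℕ) (hm : 1 ≤ m) : ∃ K : ℝ, 0 < K ∧ ∀ θ : ℝ,
    Pcos m θ = K * ∏ r ∈ innerRoots m, ‖1 - (r : ℂ) * Complex.exp (θ * Complex.I)‖ ^ 2 := by
  refine ⟨((2 * m - 1).factorial : ℝ)⁻¹ * ∏ r ∈ innerRoots m, (-r)⁻¹, ?_, fun θ => ?_⟩
  · refine mul_pos (by positivity) (Finset.prod_pos fun r hr => inv_pos.2 ?_)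
    linarith [(innerRoots_bounds hm hr).2]
  · rw [Pcos_eq_prod m hm, mul_assoc, ← Finset.prod_mul_distrib]
    congr 1
    refine Finset.prod_congr rfl fun r hr => ?_
    have := (innerRoots_bounds hm hr).2.ne
    rw [norm_one_sub_mul_exp_sq]
    field_simp
    ring

/-- With s = r + 1/r, each pair of factors gives s² - 4cos²θ = r² + r⁻² - 2cos 2θ: the product
depends on 2θ only, and the roots are squared. -/
theorem Pcos_mul_eq_norm_prod (m : ℕ) (hm : 1 ≤ m) : ∃ K : ℝ, 0 < K ∧ ∀ θ : ℝ,
    Pcos m θ * Pcos m (θ + Real.pi) = K * ∏ r ∈ innerRoots m,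
      ‖1 - ((r ^ 2 : ℝ) : ℂ) * Complex.exp ((2 * θ : ℝ) * Complex.I)‖ ^ 2 := by
  refine ⟨((2 * m - 1).factorial : ℝ)⁻¹ ^ 2 * ∏ r ∈ innerRoots m, (r ^ 2)⁻¹, ?_, fun θ => ?_⟩
  · refine mul_pos (by positivity) (Finset.prod_pos fun r hr => inv_pos.2 ?_)
    have := (innerRoots_bounds hm hr).2.ne
    positivity
  · rw [Pcos_eq_prod m hm, Pcos_eq_prod m hm, mul_mul_mul_comm, ← sq, mul_assoc,
      ← Finset.prod_mul_distrib, ← Finset.prod_mul_distrib]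
    congr 1
    refine Finset.prod_congr rfl fun r hr => ?_
    have := (innerRoots_bounds hm hr).2.ne
    rw [norm_one_sub_mul_exp_sq, Real.cos_add_pi, Real.cos_two_mul]
    field_simp
    ring

theorem one_div_sqrt_eq {ι : Type*} {R : Finset ι} {a : ι → ℝ} (ha : ∀ i ∈ R, 0 ≤ a i) {K P : ℝ}
    (hK : 0 < K) (hP : P = K * ∏ i ∈ R, a i ^ 2) :
    1 / Real.sqrt P = 1 / Real.sqrt K * ∏ i ∈ R, (a i)⁻¹ := by
  rw [hP, Real.sqrt_mul hK.le, Finset.prod_pow, Real.sqrt_sq (Finset.prod_nonneg ha),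
    Finset.prod_inv_distrib, one_div, mul_inv, one_div]

theorem SymAt.const_mul {f : ℤ → ℝ} {w F : ℂ} (h : SymAt f w F) (K : ℝ) :
    SymAt (fun n => K * f n) w (K * F) := by
  have := HasSum.mul_left (K : ℂ) h
  unfold SymAt
  convert! this using 2 with n
  push_cast
  ring

theorem norm_exp_mul_I (θ : ℝ) : ‖Complex.exp (θ * Complex.I)‖ = 1 :=
  Complex.norm_exp_ofReal_mul_I θ

/-- The inner root of the Euler–Frobenius polynomial of largest absolute value. -/
theorem efRoot_bounds {m : ℕ} (hm : 2 ≤ m) : efRoot m (m - 1) ∈ innerRoots m ∧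
    -1 < efRoot m (m - 1) ∧ efRoot m (m - 1) < 0 ∧
    ∀ r ∈ innerRoots m, r ≠ efRoot m (m - 1) → |r| < |efRoot m (m - 1)| := by
  obtain ⟨m, rfl⟩ := Nat.exists_eq_add_of_le' hm
  obtain ⟨h1, h2⟩ := efRoot_spec m
  obtain ⟨h3, h4⟩ := innerRoots_bounds (by omega) h1
  refine ⟨h1, h3, h4, fun r hr hne => ?_⟩
  have h5 := lt_of_le_of_ne (h2 r hr) (Ne.symm hne)
  have h6 := innerRoots_bounds (by omega) hr
  rw [show m + 2 - 1 = m + 1 from rfl, abs_of_neg h4, abs_of_neg h6.2]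
  linarith

/-- A sequence with the required symbol comes from `exists_asym_prod`, its asymptotics being
discarded; `SymAt.cos_integral` then identifies it with the defining integral. -/
theorem symAt_coeffC (m : ℕ) (hm : 2 ≤ m) (θ : ℝ) :
    SymAt (coeffC m) (Complex.exp (θ * Complex.I)) ((1 / Real.sqrt (Pcos m θ) : ℝ) : ℂ) := by
  obtain ⟨K, hK, hP⟩ := Pcos_eq_norm_prod m (by omega)
  obtain ⟨h1, h2, h3, h4⟩ := efRoot_bounds hm
  obtain ⟨f, -, -, -, hf⟩ := exists_asym_prod ((innerRoots m).erase (efRoot m (m - 1)))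
    (fun r => r) h3.ne (abs_lt.2 ⟨h2, by linarith⟩) fun r hr =>
      h4 r (Finset.mem_of_mem_erase hr) (Finset.ne_of_mem_erase hr)
  have hs : ∀ θ : ℝ, SymAt (fun n => 1 / Real.sqrt K * f n) (Complex.exp (θ * Complex.I))
      ((1 / Real.sqrt (Pcos m θ) : ℝ) : ℂ) := fun θ => by
    rw [one_div_sqrt_eq (fun _ _ => norm_nonneg _) hK (hP θ), ← Finset.mul_prod_erase _ _ h1,
      Complex.ofReal_mul]
    exact (hf _ (norm_exp_mul_I θ)).const_mul _
  have hc : coeffC m = fun n => 1 / Real.sqrt K * f n := funext fun j => by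
    rw [← SymAt.cos_integral hs j, coeffC]
    congr 1
    refine intervalIntegral.integral_congr fun t _ => ?_
    simp only [mul_one_div]
  rw [hc]
  exact hs θ

theorem summable_coeffC (m : ℕ) (hm : 2 ≤ m) : Summable fun k => |coeffC m k| :=
  (symAt_coeffC m hm 0).summable

/-- This is the part of the symbol of γ that is a function of w² alone and contains all square
roots. Only P(2θ) contributes the root l itself. -/
theorem exists_asym_symbol (m : ℕ) (hm : 2 ≤ m) : ∃ (D : ℤ → ℝ) (X : ℝ), X ≠ 0 ∧
    Asym (efRoot m (m - 1)) D X ∧ ∀ θ : ℝ, SymAt D (Complex.exp ((2 * θ : ℝ) * Complex.I))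
      ((1 / Real.sqrt (Pcos m (2 * θ)) * (1 / Real.sqrt (Pcos m θ * Pcos m (θ + Real.pi))) : ℝ) :
        ℂ) := by
  obtain ⟨K, hK, hP⟩ := Pcos_eq_norm_prod m (by omega)
  obtain ⟨K', hK', hP'⟩ := Pcos_mul_eq_norm_prod m (by omega)
  obtain ⟨h1, h2, h3, h4⟩ := efRoot_bounds hm
  have habs : |efRoot m (m - 1)| < 1 := abs_lt.2 ⟨h2, by linarith⟩
  obtain ⟨f, X, hX, hA, hf⟩ := exists_asym_prod
    (((innerRoots m).erase (efRoot m (m - 1))).disjSum (innerRoots m))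
    (Sum.elim (fun r => r) fun r => r ^ 2) h3.ne habs fun i hi => by
      rcases i with r | r
      · rw [Finset.inl_mem_disjSum] at hi
        exact h4 r (Finset.mem_of_mem_erase hi) (Finset.ne_of_mem_erase hi)
      -- The factors with r² come from P(θ)P(θ+π); they are strictly subdominant as r² < |r| ≤ |l|.
      · rw [Finset.inr_mem_disjSum] at hi
        have hle : |r| ≤ |efRoot m (m - 1)| := by
          by_cases hr : r = efRoot m (m - 1)
          · rw [hr]
          · exact (h4 r hi hr).le
        have h0 := abs_pos.2 (innerRoots_bounds (by omega) hi).2.ne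
        rw [Sum.elim_inr, abs_pow]
        nlinarith
  refine ⟨fun n => 1 / Real.sqrt K * (1 / Real.sqrt K') * f n,
    1 / Real.sqrt K * (1 / Real.sqrt K') * X, by positivity, ⟨?_, ?_⟩, fun θ => ?_⟩
  · obtain ⟨M, hM⟩ := hA.1
    refine ⟨1 / Real.sqrt K * (1 / Real.sqrt K') * M, fun n => ?_⟩
    rw [abs_mul, abs_of_pos (by positivity : 0 < 1 / Real.sqrt K * (1 / Real.sqrt K')), mul_assoc,
      mul_assoc _ M]
    exact mul_le_mul_of_nonneg_left (hM n) (by positivity)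
  · refine (hA.2.const_mul (1 / Real.sqrt K * (1 / Real.sqrt K'))).congr fun n => ?_
    ring
  · have hs := (hf _ (norm_exp_mul_I (2 * θ))).const_mul (1 / Real.sqrt K * (1 / Real.sqrt K'))
    convert! hs using 1
    rw [one_div_sqrt_eq (fun _ _ => norm_nonneg _) hK (hP (2 * θ)),
      one_div_sqrt_eq (fun _ _ => norm_nonneg _) hK' (hP' θ), ← Finset.mul_prod_erase _ _ h1,
      Finset.prod_disjSum]
    simp only [Sum.elim_inl, Sum.elim_inr]
    push_cast
    ring

/-- The two-scale sequence of `N_m`. -/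
noncomputable def maskSeq (m : ℕ) (n : ℤ) : ℝ :=
  if 0 ≤ n then (1 / 2) ^ (m - 1) * (m.choose n.toNat : ℝ) else 0

theorem hasSum_maskSeq {E : Type*} [NormedAddCommGroup E] [NormedSpace ℝ E] (m : ℕ) (g : ℤ → E) :
    HasSum (fun n => maskSeq m n • g n)
      (∑ i ∈ Finset.range (m + 1), ((1 / 2) ^ (m - 1) * (m.choose i : ℝ)) • g i) := by
  have h : ∑ i ∈ Finset.range (m + 1), ((1 / 2) ^ (m - 1) * (m.choose i : ℝ)) • g i =
      ∑ n ∈ (Finset.range (m + 1)).image (fun i : ℕ => (i : ℤ)), maskSeq m n • g n := by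
    rw [Finset.sum_image fun a _ b _ h => by simpa using h]
    refine Finset.sum_congr rfl fun i _ => ?_
    simp [maskSeq]
  rw [h]
  refine hasSum_sum_of_ne_finset_zero fun n hn => ?_
  unfold maskSeq
  split_ifs with h0
  · obtain ⟨k, rfl⟩ := Int.eq_ofNat_of_zero_le h0
    have : m < k := by
      by_contra hk
      exact hn (Finset.mem_image.2 ⟨k, Finset.mem_range.2 (by omega), rfl⟩)
    rw [Int.toNat_natCast, Nat.choose_eq_zero_of_lt this]
    simp
  · simp

theorem symAt_maskSeq (m : ℕ) (w : ℂ) :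
    SymAt (maskSeq m) w (((1 / 2) ^ (m - 1) : ℝ) * (1 + w) ^ m) := by
  have h := hasSum_maskSeq m fun n : ℤ => w ^ n
  unfold SymAt
  convert! h using 1
  rw [add_comm, add_pow, Finset.mul_sum]
  refine Finset.sum_congr rfl fun i _ => ?_
  simp [Complex.real_smul]
  ring

theorem hasSum_mask_bspline (m : ℕ) (hm : 1 ≤ m) (x : ℝ) :
    HasSum (fun n : ℤ => maskSeq m n * bspline m (2 * x - n)) (bspline m x) := by
  have h := hasSum_maskSeq m fun n : ℤ => bspline m (2 * x - n)
  obtain ⟨m, rfl⟩ := Nat.exists_eq_add_of_le' hm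
  rw [bspline_two_scale]
  simpa using h

/-- Expand the coarse spline by the two-scale relation so that both factors live at scale 2x;
substituting u = 2x leaves autocorrelations and a factor 1/2, which cancels the 2 in `scalingConst`.
-/
theorem integral_bspline_mul_shift (m : ℕ) (hm : 1 ≤ m) (k n : ℤ) :
    ∫ x, bspline m (x - k) * bspline m (2 * x - n) =
      1 / 2 * dconv 1 (maskSeq m) (autocorr m) (n - 2 * k) := by
  have hI : ∀ i : ℕ, Integrable fun x : ℝ => bspline m (2 * (x - k) - i) * bspline m (2 * x - n) := by
    intro i
    have h1 : Integrable fun x : ℝ => bspline m (2 * x - (2 * k + i)) :=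
      ((integrable_bspline m).comp_sub_right (2 * k + i : ℝ)).comp_mul_left' two_ne_zero
    have h2 : Integrable fun x : ℝ => bspline m (2 * (x - k) - i) := by
      convert! h1 using 3
      ring
    refine h2.mul_bdd (c := 1) ?_ ?_
    · exact ((measurable_bspline m).comp (by fun_prop)).aestronglyMeasurable
    · exact Eventually.of_forall fun x => abs_bspline_le _ _
  have hH : dconv 1 (maskSeq m) (autocorr m) (n - 2 * k) =
      ∑ i ∈ Finset.range (m + 1), ((1 / 2) ^ (m - 1) * (m.choose i : ℝ)) *
        autocorr m (n - 2 * k - i) := by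
    have h := (hasSum_maskSeq m fun i : ℤ => autocorr m (n - 2 * k - i)).tsum_eq
    simpa [dconv] using h
  have hts : ∀ x : ℝ, bspline m (x - k) = ∑ i ∈ Finset.range (m + 1),
      ((1 / 2) ^ (m - 1) * (m.choose i : ℝ)) * bspline m (2 * (x - k) - i) := fun x => by
    have h := hasSum_maskSeq m fun i : ℤ => bspline m (2 * (x - k) - i)
    have h2 := (hasSum_mask_bspline m hm (x - k)).unique h
    simpa using h2
  simp_rw [fun x : ℝ => hts x, Finset.sum_mul, mul_assoc]
  rw [integral_finsetSum _ fun i _ => ((hI i).const_mul _).const_mul _, hH, Finset.mul_sum]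
  refine Finset.sum_congr rfl fun i _ => ?_
  rw [integral_const_mul, integral_const_mul]
  have h3 : ∫ x : ℝ, bspline m (2 * (x - k) - i) * bspline m (2 * x - n) =
      1 / 2 * autocorr m (n - 2 * k - i) := by
    have h4 := Measure.integral_comp_mul_left
      (fun u : ℝ => bspline m (u - (2 * k + i)) * bspline m (u - n)) 2
    have h5 : ∀ x : ℝ, 2 * (x - (k : ℝ)) - i = 2 * x - (2 * k + i) := fun x => by ring
    simp_rw [h5]
    rw [h4, ← integral_add_right_eq_self _ (2 * k + i : ℝ)]
    have h6 : ∀ x : ℝ, bspline m (x + (2 * k + i) - (2 * k + i)) * bspline m (x + (2 * k + i) - n) =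
        bspline m x * bspline m (x - ((n - 2 * k - i : ℤ) : ℝ)) := fun x => by
      congr 2
      · ring
      · push_cast; ring
    simp_rw [h6]
    rw [integral_bspline_shift m hm, autocorr, smul_eq_mul]
    norm_num
  rw [h3]
  ring

theorem summable_scalingFun (m : ℕ) (hm : 2 ≤ m) (x : ℝ) :
    Summable fun k : ℤ => ‖coeffC m k * bspline m (x - k)‖ := by
  refine Summable.of_nonneg_of_le (fun _ => norm_nonneg _) (fun k => ?_) (summable_coeffC m hm)
  rw [Real.norm_eq_abs, abs_mul]
  exact mul_le_of_le_one_right (abs_nonneg _) (abs_bspline_le _ _)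

theorem abs_scalingFun_le (m : ℕ) (hm : 2 ≤ m) (x : ℝ) :
    |scalingFun m x| ≤ ∑' k, |coeffC m k| := by
  rw [← Real.norm_eq_abs, scalingFun]
  refine tsum_of_norm_bounded (summable_coeffC m hm).hasSum fun k => ?_
  rw [Real.norm_eq_abs, abs_mul]
  exact mul_le_of_le_one_right (abs_nonneg _) (abs_bspline_le _ _)

/-- Insert both spline series and integrate termwise. Step 2 reflects the coarse translates, and
step -1 the index `j + l` of the second series. -/
theorem scalingConst_eq (m : ℕ) (hm : 2 ≤ m) : scalingConst m =
    dconv 2 (coeffC m) (dconv (-1) (coeffC m) (dconv 1 (maskSeq m) (autocorr m))) := by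
  funext j
  let F : ℤ × ℤ → ℝ → ℝ := fun p x =>
    coeffC m p.1 * bspline m (x - p.1) * (coeffC m p.2 * bspline m (2 * x - j - p.2))
  have hFi : ∀ p, Integrable (F p) := fun p => by
    refine Integrable.mul_bdd (c := |coeffC m p.2|)
      (((integrable_bspline m).comp_sub_right (p.1 : ℝ)).const_mul _) ?_ ?_
    · exact (((measurable_bspline m).comp (by fun_prop)).const_mul _).aestronglyMeasurable
    · refine Eventually.of_forall fun x => ?_
      rw [Real.norm_eq_abs, abs_mul]
      exact mul_le_of_le_one_right (abs_nonneg _) (abs_bspline_le _ _)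
  have hFs : Summable fun p => ∫ x, ‖F p x‖ := by
    have hb : Summable fun p : ℤ × ℤ => |coeffC m p.1| * |coeffC m p.2| * ∫ x, ‖bspline m x‖ :=
      (summable_mul_of_summable_norm (summable_coeffC m hm).norm
        (summable_coeffC m hm).norm).mul_right _
    refine Summable.of_nonneg_of_le (fun p => integral_nonneg fun _ => norm_nonneg _) (fun p => ?_) hb
    rw [← integral_sub_right_eq_self (fun x => ‖bspline m x‖) (p.1 : ℝ), ← integral_const_mul]
    refine integral_mono (hFi p).norm
      (((integrable_bspline m).comp_sub_right (p.1 : ℝ)).norm.const_mul _) fun x => ?_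
    simp only [F, norm_mul, Real.norm_eq_abs]
    calc |coeffC m p.1| * |bspline m (x - p.1)| * (|coeffC m p.2| * |bspline m (2 * x - j - p.2)|)
        ≤ |coeffC m p.1| * |bspline m (x - p.1)| * (|coeffC m p.2| * 1) := by
          gcongr
          exact abs_bspline_le _ _
      _ = _ := by ring
  have hI := hasSum_integral_of_summable_integral_norm hFi hFs
  have hT : ∀ x, ∑' p, F p x = scalingFun m x * scalingFun m (2 * x - j) := fun x =>
    (tsum_mul_tsum_of_summable_norm (summable_scalingFun m hm x)
      (summable_scalingFun m hm (2 * x - j))).symm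
  simp_rw [hT] at hI
  have hFp : ∀ p : ℤ × ℤ, ∫ x, F p x = coeffC m p.1 * (coeffC m p.2 *
      (1 / 2 * dconv 1 (maskSeq m) (autocorr m) (j + p.2 - 2 * p.1))) := fun p => by
    rw [← integral_bspline_mul_shift m (by omega), ← integral_const_mul, ← integral_const_mul]
    refine integral_congr_ae (Eventually.of_forall fun x => ?_)
    simp only [F]
    push_cast
    rw [sub_sub]
    ring
  simp_rw [hFp] at hI
  rw [scalingConst, ← hI.tsum_eq, hI.summable.tsum_prod' fun k => hI.summable.prod_factor k,
    dconv, ← tsum_mul_left]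
  refine tsum_congr fun k => ?_
  rw [dconv]
  dsimp only
  rw [tsum_mul_left, ← mul_assoc, mul_comm 2, mul_assoc, ← tsum_mul_left]
  congr 1
  refine tsum_congr fun l => ?_
  rw [show j - 2 * k - -1 * l = j + l - 2 * k by ring]
  ring

theorem exp_zpow (θ : ℝ) (d : ℤ) :
    Complex.exp (θ * Complex.I) ^ d = Complex.exp (((d : ℝ) * θ : ℝ) * Complex.I) := by
  rw [← Complex.exp_int_mul]
  congr 1
  push_cast
  ring

theorem neg_inv_exp (θ : ℝ) :
    -(Complex.exp (θ * Complex.I))⁻¹ = Complex.exp ((Real.pi - θ : ℝ) * Complex.I) := by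
  push_cast
  rw [sub_mul, Complex.exp_sub, Complex.exp_pi_mul_I]
  field_simp

theorem symAt_mask_autocorr (m : ℕ) (hm : 1 ≤ m) (θ : ℝ) :
    SymAt (dconv 1 (maskSeq m) (autocorr m)) (Complex.exp (θ * Complex.I))
      (((1 / 2) ^ (m - 1) : ℝ) * (1 + Complex.exp (θ * Complex.I)) ^ m * Pcos m θ) := by
  refine SymAt.dconv (Complex.exp_ne_zero _) ?_ (symAt_autocorr m hm θ)
  rw [zpow_one]
  exact symAt_maskSeq m _

theorem symAt_scalingConst (m : ℕ) (hm : 2 ≤ m) (θ : ℝ) :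
    SymAt (scalingConst m) (Complex.exp (θ * Complex.I))
      (((1 / Real.sqrt (Pcos m (2 * θ)) : ℝ) : ℂ) * (((1 / Real.sqrt (Pcos m θ) : ℝ) : ℂ) *
        (((1 / 2) ^ (m - 1) : ℝ) * (1 + Complex.exp (θ * Complex.I)) ^ m * Pcos m θ))) := by
  rw [scalingConst_eq m hm]
  refine SymAt.dconv (Complex.exp_ne_zero _) ?_ (SymAt.dconv (Complex.exp_ne_zero _) ?_
    (symAt_mask_autocorr m (by omega) θ))
  · rw [exp_zpow]
    exact_mod_cast symAt_coeffC m hm (2 * θ)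
  · rw [exp_zpow, Pcos_congr m (by omega) (θ' := ((-1 : ℤ) : ℝ) * θ) (by simp)]
    exact symAt_coeffC m hm _

theorem coeffGamma_eq (m : ℕ) : coeffGamma m =
    dconv 1 (coeffC m) (fun j => (-1 : ℝ) ^ j * scalingConst m (1 - j)) := by
  funext j
  rw [coeffGamma, dconv, ← tsum_mul_left]
  refine tsum_congr fun k => ?_
  rw [one_mul, show 1 - (j - k) = k - j + 1 by ring, zpow_sub₀ (by norm_num : (-1 : ℝ) ≠ 0)]
  rcases Int.even_or_odd k with hk | hk
  · rw [hk.neg_one_zpow]; ring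
  · rw [hk.neg_one_zpow]; ring

theorem symAt_modulated_scalingConst (m : ℕ) (hm : 2 ≤ m) (θ : ℝ) :
    SymAt (fun j => (-1 : ℝ) ^ j * scalingConst m (1 - j)) (Complex.exp (θ * Complex.I))
      (-Complex.exp (θ * Complex.I) *
        (((1 / Real.sqrt (Pcos m (2 * θ)) : ℝ) : ℂ) *
          (((1 / Real.sqrt (Pcos m (θ + Real.pi)) : ℝ) : ℂ) *
        (((1 / 2) ^ (m - 1) : ℝ) * (1 - (Complex.exp (θ * Complex.I))⁻¹) ^ m *
          Pcos m (θ + Real.pi))))) := by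
  apply SymAt.modulate (Complex.exp_ne_zero _)
  rw [neg_inv_exp]
  have h := symAt_scalingConst m hm (Real.pi - θ)
  rw [← neg_inv_exp, ← sub_eq_add_neg, neg_inv_exp] at h
  rw [Pcos_congr m (by omega) (θ := 2 * θ) (θ' := 2 * (Real.pi - θ)) (by
      rw [mul_sub, Real.cos_two_pi_sub]),
    Pcos_congr m (by omega) (θ := θ + Real.pi) (θ' := Real.pi - θ) (by
      rw [Real.cos_add_pi, Real.cos_pi_sub])]
  exact h

theorem symAt_coeffGamma (m : ℕ) (hm : 2 ≤ m) (θ : ℝ) :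
    SymAt (coeffGamma m) (Complex.exp (θ * Complex.I))
      (((1 / Real.sqrt (Pcos m (2 * θ)) * (1 / Real.sqrt (Pcos m θ * Pcos m (θ + Real.pi))) : ℝ) :
          ℂ) * (-Complex.exp (θ * Complex.I) * (((1 / 2) ^ (m - 1) : ℝ) *
        (1 - (Complex.exp (θ * Complex.I))⁻¹) ^ m * Pcos m (θ + Real.pi)))) := by
  rw [coeffGamma_eq]
  have h := SymAt.dconv (d := 1) (Complex.exp_ne_zero _) (by rw [zpow_one]; exact symAt_coeffC m hm θ)
    (symAt_modulated_scalingConst m hm θ)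
  convert! h using 1
  rw [Real.sqrt_mul (Pcos_nonneg m (by omega) θ)]
  push_cast
  rw [one_div_mul_one_div_rev]
  ring

/-- The Laurent polynomial factor of the symbol of `γ`. -/
noncomputable def gammaFactor (m : ℕ) (n : ℤ) : ℝ :=
  (-1 : ℝ) ^ n * dconv 1 (maskSeq m) (autocorr m) (1 - n)

theorem symAt_gammaFactor (m : ℕ) (hm : 2 ≤ m) (θ : ℝ) :
    SymAt (gammaFactor m) (Complex.exp (θ * Complex.I))
      (-Complex.exp (θ * Complex.I) * (((1 / 2) ^ (m - 1) : ℝ) *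
        (1 - (Complex.exp (θ * Complex.I))⁻¹) ^ m * Pcos m (θ + Real.pi))) := by
  apply SymAt.modulate (Complex.exp_ne_zero _)
  rw [neg_inv_exp]
  have h := symAt_mask_autocorr m (by omega) (Real.pi - θ)
  rw [← neg_inv_exp, ← sub_eq_add_neg, neg_inv_exp] at h
  rw [Pcos_congr m (by omega) (θ := θ + Real.pi) (θ' := Real.pi - θ) (by
      rw [Real.cos_add_pi, Real.cos_pi_sub])]
  exact h

/-- Writing √P(θ+π)/√P(θ) as P(θ+π)/√(P(θ)P(θ+π)) leaves a Laurent polynomial times a function of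
w². -/
theorem exists_coeffGamma_eq_dconv (m : ℕ) (hm : 2 ≤ m) : ∃ (D : ℤ → ℝ) (X : ℝ), X ≠ 0 ∧
    Asym (efRoot m (m - 1)) D X ∧ coeffGamma m = dconv 2 D (gammaFactor m) := by
  obtain ⟨D, X, hX, hA, hD⟩ := exists_asym_symbol m hm
  refine ⟨D, X, hX, hA, SymAt.unique (symAt_coeffGamma m hm) fun θ => ?_⟩
  refine SymAt.dconv (Complex.exp_ne_zero _) ?_ (symAt_gammaFactor m hm θ)
  rw [exp_zpow]
  exact_mod_cast hD θ

/-- Replacing w by 1/w multiplies the symbol of γ by (-1)^m w^(m-2). This reduces j → -∞ to j → +∞.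
-/
theorem coeffGamma_neg (m : ℕ) (hm : 2 ≤ m) (j : ℤ) :
    coeffGamma m (-j) = (-1) ^ m * coeffGamma m (j + 2 - m) := by
  have h1 : ∀ θ : ℝ, SymAt (fun n => coeffGamma m (-n)) (Complex.exp (θ * Complex.I)) _ := fun θ => by
    apply SymAt.reverse
    rw [← Complex.exp_neg, ← neg_mul, ← Complex.ofReal_neg]
    exact symAt_coeffGamma m hm (-θ)
  have h2 : ∀ θ : ℝ, SymAt (fun n => (-1) ^ m * coeffGamma m (n + 2 - m))
      (Complex.exp (θ * Complex.I)) _ := fun θ => by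
    have h := (Equiv.addRight (2 - m : ℤ)).hasSum_iff.2
      (HasSum.mul_left ((-1) ^ m * Complex.exp (θ * Complex.I) ^ ((m : ℤ) - 2))
        (symAt_coeffGamma m hm θ))
    unfold SymAt
    convert! h using 1
    funext n
    have hw := Complex.exp_ne_zero (θ * Complex.I)
    simp only [Function.comp_apply, Equiv.coe_addRight]
    rw [show n + (2 - (m : ℤ)) = n + 2 - m by ring]
    rw [show Complex.exp (θ * Complex.I) ^ n = Complex.exp (θ * Complex.I) ^ ((m : ℤ) - 2) *
      Complex.exp (θ * Complex.I) ^ (n + 2 - m) by rw [← zpow_add₀ hw]; congr 1; ring]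
    push_cast
    ring
  have h3 : (fun n => coeffGamma m (-n)) = fun n => (-1) ^ m * coeffGamma m (n + 2 - m) := by
    refine SymAt.unique h1 fun θ => ?_
    convert! h2 θ using 1
    have hw := Complex.exp_ne_zero (θ * Complex.I)
    have e1 : Complex.exp (((-θ : ℝ) : ℂ) * Complex.I) = (Complex.exp (θ * Complex.I))⁻¹ := by
      rw [← Complex.exp_neg]; push_cast; congr 1; ring
    have p1 : Pcos m (2 * -θ) = Pcos m (2 * θ) := Pcos_congr m (by omega) (by simp)
    have p2 : Pcos m (-θ) = Pcos m θ := Pcos_congr m (by omega) (by simp)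
    have p3 : Pcos m (-θ + Real.pi) = Pcos m (θ + Real.pi) :=
      Pcos_congr m (by omega) (by simp [Real.cos_add_pi])
    rw [e1, p1, p2, p3, inv_inv]
    have e2 : (1 - Complex.exp (θ * Complex.I)) ^ m = (-1) ^ m *
        Complex.exp (θ * Complex.I) ^ m * (1 - (Complex.exp (θ * Complex.I))⁻¹) ^ m := by
      rw [← mul_pow, ← mul_pow]
      congr 1
      field_simp
      ring
    rw [e2, zpow_sub₀ hw, zpow_natCast, zpow_ofNat]
    field_simp
  exact congrFun h3 j

end BSplineWavelet

/-! ### Asymptotics of γ along the residue classes. -/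

namespace BSplineWavelet

open scoped Topology

theorem finite_support_gammaFactor (m : ℕ) : (Function.support (gammaFactor m)).Finite := by
  refine (Set.finite_Icc (-2 * m : ℤ) (m + 1)).subset fun n hn => ?_
  by_contra hout
  apply hn
  rw [gammaFactor]
  have : dconv 1 (maskSeq m) (autocorr m) (1 - n) = 0 := by
    have h := (hasSum_maskSeq m fun i : ℤ => autocorr m (1 - n - 1 * i)).tsum_eq
    simp only [smul_eq_mul] at h
    rw [dconv, h]
    refine Finset.sum_eq_zero fun i hi => ?_
    rw [Finset.mem_range] at hi
    rw [autocorr, bspline_shift_eq_zero, mul_zero]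
    rw [Finset.mem_Ioo]
    rw [Set.mem_Icc] at hout
    omega
  rw [this, mul_zero]

/-- Along a fixed parity the two-step convolution is an ordinary one, to which `Asym.dconv` applies.
-/
theorem coeffGamma_dilated (m : ℕ) {D : ℤ → ℝ} (h : coeffGamma m = dconv 2 D (gammaFactor m))
    (s p : ℤ) : coeffGamma m (2 * p + s) = dconv 1 (fun i => gammaFactor m (2 * i + s)) D p := by
  rw [h, dconv, dconv, ← (Equiv.subLeft p).tsum_eq]
  refine tsum_congr fun k => ?_
  rw [Equiv.subLeft_apply, mul_comm, one_mul]
  congr 2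
  ring

theorem finite_support_gammaFactor_dilated (m : ℕ) (s : ℤ) (c : ℤ → ℝ) :
    (Function.support fun i => gammaFactor m (2 * i + s) * c i).Finite := by
  refine ((finite_support_gammaFactor m).preimage (f := fun i : ℤ => 2 * i + s)
    (fun a _ b _ hab => by simpa using hab)).subset fun i hi => ?_
  exact left_ne_zero_of_mul hi

/-- The sum governing the leading asymptotics of `γ_{2p+s}`. -/
noncomputable def singularSum (m : ℕ) (s : ℤ) : ℝ :=
  ∑' i : ℤ, gammaFactor m (2 * i + s) / efRoot m (m - 1) ^ i

theorem singularSum_add_two_mul (m : ℕ) (hm : 2 ≤ m) (s t : ℤ) :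
    singularSum m (2 * t + s) = efRoot m (m - 1) ^ t * singularSum m s := by
  have h0 := (efRoot_bounds hm).2.2.1.ne
  unfold singularSum
  rw [← tsum_mul_left, ← (Equiv.addRight t).tsum_eq (fun i : ℤ => efRoot m (m - 1) ^ t *
    (gammaFactor m (2 * i + s) / efRoot m (m - 1) ^ i))]
  refine tsum_congr fun i => ?_
  rw [Equiv.coe_addRight, zpow_add₀ h0, show 2 * (i + t) + s = 2 * i + (2 * t + s) by ring]
  field_simp

/-- At z₀ = i/ρ with ρ² = -l, the even and odd parts of the symbol G give G(z₀) = S_0 + z₀ S_1. As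
z₀ is imaginary, S_0 and S_1 are the real part and ρ times the imaginary part of G(z₀), a real
multiple of iZ for the Z of `singular_coeff_ne_zero`. -/
theorem singularSum_zero_one (m : ℕ) (hm : 2 ≤ m) :
    singularSum m 0 ≠ 0 ∧ singularSum m 1 ≠ 0 := by
  obtain ⟨h1, h2, h3, -⟩ := efRoot_bounds hm
  have hmin : ∀ r ∈ innerRoots m, efRoot m (m - 1) ≤ r := by
    obtain ⟨m, rfl⟩ := Nat.exists_eq_add_of_le' hm
    exact (efRoot_spec m).2
  set l := efRoot m (m - 1) with hl
  set ρ := Real.sqrt (-l) with hρ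
  have hρ2 : ρ ^ 2 = -l := Real.sq_sqrt (by linarith)
  have hρ0 : 0 < ρ := Real.sqrt_pos.2 (by linarith)
  have hρ1 : ρ < 1 := by nlinarith
  have hρC : (ρ : ℂ) ≠ 0 := by exact_mod_cast hρ0.ne'
  have hle : ∀ r ∈ innerRoots m, -(l + l⁻¹) ≤ -(r + r⁻¹) := by
    intro r hr
    have hr' := innerRoots_bounds (by omega) hr
    have h4 := hmin r hr
    have h5 : -(r + r⁻¹) - -(l + l⁻¹) = (r - l) * (1 - r * l) / (r * l) := by
      field_simp [hr'.2.ne, h3.ne]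
      ring
    have h6 : 0 < r * l := mul_pos_of_neg_of_neg hr'.2 h3
    have h7 : 0 ≤ (r - l) * (1 - r * l) / (r * l) := by
      apply div_nonneg (mul_nonneg _ _) h6.le
      · linarith
      · nlinarith
    linarith
  obtain ⟨hre, him⟩ := singular_coeff_ne_zero (fun r hr => innerRoots_sum_lt (by omega) hr)
    (by omega : 0 < m) (prod_two_scale m (by omega)) h1 hle hρ0 hρ1 (by
      rw [hρ2, inv_neg]; ring)
  set Z := (1 + ρ * Complex.I) ^ m * ∏ i ∈ innerRoots m,
    ((ρ - ρ⁻¹ : ℝ) * Complex.I + ((-(i + i⁻¹) : ℝ) : ℂ) : ℂ) with hZ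
  set κ : ℝ := (1 / 2) ^ (m - 1) * ((2 * m - 1).factorial : ℝ)⁻¹ with hκ
  have hκ0 : 0 < κ := by positivity
  set z₀ : ℂ := ((ρ⁻¹ : ℝ) : ℂ) * Complex.I with hz₀
  have hz₀0 : z₀ ≠ 0 := by simp [hz₀, hρ0.ne']
  have hz₀inv : -z₀⁻¹ = ρ * Complex.I := by
    rw [hz₀, mul_inv, Complex.inv_I]
    push_cast
    rw [inv_inv]
    ring
  have hw : (ρ * Complex.I : ℂ) ≠ 0 := mul_ne_zero hρC Complex.I_ne_zero
  have hsym : SymAt (gammaFactor m) z₀ (-z₀ * (κ * Z)) := by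
    apply SymAt.modulate hz₀0
    rw [hz₀inv]
    have h := SymAt.dconv (d := 1) hw (by rw [zpow_one]; exact symAt_maskSeq m _)
      (symAt_autocorr_prod m (by omega) hw)
    convert! h using 1
    rw [hZ, hκ]
    have : ∀ r : ℝ, (ρ * Complex.I + (ρ * Complex.I)⁻¹ - ((r + r⁻¹ : ℝ) : ℂ) : ℂ) =
        (ρ - ρ⁻¹ : ℝ) * Complex.I + ((-(r + r⁻¹) : ℝ) : ℂ) := fun r => by
      rw [mul_inv, Complex.inv_I]
      push_cast
      ring
    simp_rw [this]
    push_cast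
    ring
  have hz₀2 : z₀ ^ (2 : ℤ) = (l : ℂ)⁻¹ := by
    rw [hz₀, mul_zpow, zpow_ofNat, zpow_ofNat, Complex.I_sq, ← Complex.ofReal_pow, inv_pow, hρ2]
    push_cast
    rw [inv_neg]
    ring
  have hS : ∀ s : ℤ, HasSum (fun i : ℤ => (gammaFactor m (2 * i + s) : ℂ) * z₀ ^ (2 * i + s))
      (z₀ ^ s * singularSum m s) := by
    intro s
    have hs : Summable fun i : ℤ => gammaFactor m (2 * i + s) / l ^ i := by
      simp_rw [div_eq_mul_inv]
      exact summable_of_hasFiniteSupport (finite_support_gammaFactor_dilated m s _)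
    have := (Complex.hasSum_ofReal.2 hs.hasSum).mul_left (z₀ ^ s)
    convert! this using 2 with i
    rw [zpow_add₀ hz₀0, zpow_mul, hz₀2, inv_zpow]
    push_cast
    ring
  have h0 := hS 0
  simp only [add_zero, zpow_zero, one_mul] at h0
  have h1 := hS 1
  have hE := HasSum.unique hsym (hasSum_int_even_odd h0 h1)
  have hIm : z₀ * (κ * Z) = ((ρ⁻¹ * κ : ℝ) : ℂ) * (Complex.I * Z) := by
    rw [hz₀]; push_cast; ring
  have hpos : 0 < ρ⁻¹ * κ := by positivity
  rw [neg_mul, hIm, zpow_one, hz₀, mul_right_comm, ← Complex.ofReal_mul] at hE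
  constructor
  · intro h
    have := congrArg Complex.re hE
    rw [h, Complex.neg_re, Complex.re_ofReal_mul] at this
    simp at this
    rcases this with h5 | h5
    · exact hpos.ne' (by simpa using h5)
    · exact him h5
  · intro h
    have := congrArg Complex.im hE
    rw [h, Complex.neg_im, Complex.im_ofReal_mul] at this
    simp at this
    rcases this with h5 | h5
    · exact hpos.ne' (by simpa using h5)
    · exact hre h5

theorem singularSum_ne_zero (m : ℕ) (hm : 2 ≤ m) (s : ℤ) : singularSum m s ≠ 0 := by
  have h0 := (efRoot_bounds hm).2.2.1.ne
  rcases Int.even_or_odd' s with ⟨t, rfl | rfl⟩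
  · rw [← add_zero (2 * t), singularSum_add_two_mul m hm]
    exact mul_ne_zero (zpow_ne_zero _ h0) (singularSum_zero_one m hm).1
  · rw [singularSum_add_two_mul m hm]
    exact mul_ne_zero (zpow_ne_zero _ h0) (singularSum_zero_one m hm).2

theorem tendsto_coeffGamma (m : ℕ) (hm : 2 ≤ m) (s : ℤ) : ∃ X : ℝ, X ≠ 0 ∧
    Tendsto (fun r : ℕ => coeffGamma m (2 * r + s) * Real.sqrt (r + 1) / efRoot m (m - 1) ^ r)
      atTop (𝓝 X) := by
  obtain ⟨D, X, hX, hA, hD⟩ := exists_coeffGamma_eq_dconv m hm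
  have h0 := (efRoot_bounds hm).2.2.1.ne
  have hy : Summable fun k => |gammaFactor m (2 * k + s)| * wt k / |efRoot m (m - 1)| ^ k := by
    refine summable_of_hasFiniteSupport
      ((finite_support_gammaFactor_dilated m s fun _ => 1).subset fun i hi => ?_)
    intro h
    apply hi
    simp only [mul_one] at h
    simp [h]
  have h := (hA.dconv h0 hy).2
  refine ⟨_, mul_ne_zero hX (singularSum_ne_zero m hm s), ?_⟩
  have h2 := h.comp tendsto_natCast_atTop_atTop
  refine h2.congr fun r => ?_
  simp only [Function.comp_apply]
  rw [← coeffGamma_dilated m hD, wt_nat, zpow_natCast]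

/-- With a = √(-l), √μ and √(μ+1) are (1 ∓ a²)/(2a), so the quotient inside the logarithm is 1/a².
-/
theorem exp_neg_alpha0 (m : ℕ) (hm : 2 ≤ m) : Real.exp (-alpha0 m) = -efRoot m (m - 1) := by
  obtain ⟨-, h2, h3, -⟩ := efRoot_bounds hm
  set l := efRoot m (m - 1) with hl
  set a := Real.sqrt (-l) with ha
  have ha2 : a ^ 2 = -l := Real.sq_sqrt (by linarith)
  have ha0 : 0 < a := Real.sqrt_pos.2 (by linarith)
  have hmu : mu m (m - 1) = ((1 - a ^ 2) / (2 * a)) ^ 2 := by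
    rw [mu, ← hl, abs_of_neg h3, ← ha2, div_pow, mul_pow]
    congr 1
    · rw [ha2]; ring
    · norm_num
  have h4 : 0 < 1 - a ^ 2 := by linarith
  have hs1 : Real.sqrt (mu m (m - 1)) = (1 - a ^ 2) / (2 * a) := by
    rw [hmu, Real.sqrt_sq (by positivity)]
  have hs2 : Real.sqrt (mu m (m - 1) + 1) = (1 + a ^ 2) / (2 * a) := by
    rw [hmu, show ((1 - a ^ 2) / (2 * a)) ^ 2 + 1 = ((1 + a ^ 2) / (2 * a)) ^ 2 by
      field_simp; ring, Real.sqrt_sq (by positivity)]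
  have hq : (Real.sqrt (mu m (m - 1) + 1) + Real.sqrt (mu m (m - 1))) /
      (Real.sqrt (mu m (m - 1) + 1) - Real.sqrt (mu m (m - 1))) = (-l)⁻¹ := by
    rw [hs1, hs2, ← ha2, ← add_div, ← sub_div, div_div_div_cancel_right₀ (by positivity),
      show 1 + a ^ 2 + (1 - a ^ 2) = 2 by ring, show 1 + a ^ 2 - (1 - a ^ 2) = 2 * a ^ 2 by ring]
    field_simp
  rw [alpha0, hq, Real.log_inv, neg_neg, Real.exp_log (by linarith)]

theorem tendsto_int_cofinite {f : ℤ → ℝ} {L : Filter ℝ}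
    (h1 : Tendsto (fun r : ℕ => f (2 * r)) atTop L)
    (h2 : Tendsto (fun r : ℕ => f (2 * r - 1)) atTop L)
    (h3 : Tendsto (fun r : ℕ => f (-(2 * r))) atTop L)
    (h4 : Tendsto (fun r : ℕ => f (-(2 * r - 1))) atTop L) : Tendsto f cofinite L := by
  intro U hU
  obtain ⟨N, hN⟩ := eventually_atTop.1 (((h1.eventually hU).and (h2.eventually hU)).and
    ((h3.eventually hU).and (h4.eventually hU)))
  rw [mem_map, mem_cofinite]
  refine (Set.finite_Icc (-(2 * N) : ℤ) (2 * N)).subset fun j hj => ?_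
  by_contra hout
  apply hj
  obtain ⟨⟨k1, k2⟩, k3, k4⟩ := hN ((j.natAbs + 1) / 2) (by rw [Set.mem_Icc] at hout; omega)
  have hj : j = 2 * (((j.natAbs + 1) / 2 : ℕ) : ℤ) ∨ j = 2 * (((j.natAbs + 1) / 2 : ℕ) : ℤ) - 1 ∨
      j = -(2 * (((j.natAbs + 1) / 2 : ℕ) : ℤ)) ∨
      j = -(2 * (((j.natAbs + 1) / 2 : ℕ) : ℤ) - 1) := by omega
  rw [Set.mem_preimage]
  rcases hj with h | h | h | h <;> rw [h] <;> assumption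

theorem tendsto_sqrt_div : Tendsto (fun r : ℕ => Real.sqrt r / Real.sqrt (r + 1)) atTop (𝓝 1) := by
  have h := (tendsto_natCast_div_add_atTop (𝕜 := ℝ) 1).sqrt
  rw [Real.sqrt_one] at h
  refine h.congr fun r => ?_
  rw [Real.sqrt_div (Nat.cast_nonneg r)]

theorem ratio_tendsto_one (m : ℕ) (hm : 2 ≤ m) {g : ℕ → ℝ} {X : ℝ} (hX : X ≠ 0)
    (h : Tendsto (fun r : ℕ => g r * Real.sqrt (r + 1) / efRoot m (m - 1) ^ r) atTop (𝓝 X)) :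
    Tendsto (fun r : ℕ => g r / ((-1) ^ r * X * (Real.exp (-(alpha0 m * r)) / Real.sqrt r)))
      atTop (𝓝 1) := by
  have h0 := (efRoot_bounds hm).2.2.1.ne
  have h2 := (h.mul tendsto_sqrt_div).div_const X
  rw [mul_one, div_self hX] at h2
  -- The identity holds for every `r`; at `r = 0` both sides are 0 by the convention for division by
  -- zero.
  refine h2.congr fun r => ?_
  have he : Real.exp (-(alpha0 m * r)) = (-efRoot m (m - 1)) ^ r := by
    rw [← exp_neg_alpha0 m hm, ← Real.exp_nat_mul]
    congr 1; ring
  have hp : (-1 : ℝ) ^ r * (-efRoot m (m - 1)) ^ r = efRoot m (m - 1) ^ r := by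
    rw [← mul_pow]; congr 1; ring
  have hs : Real.sqrt ((r : ℝ) + 1) ≠ 0 := (Real.sqrt_pos.2 (by positivity)).ne'
  rw [he, show (-1 : ℝ) ^ r * X * ((-efRoot m (m - 1)) ^ r / Real.sqrt r) =
    ((-1 : ℝ) ^ r * (-efRoot m (m - 1)) ^ r) * X / Real.sqrt r by ring, hp, div_div_eq_mul_div]
  field_simp

theorem coeffGamma_isEquivalent (m : ℕ) (hm : 2 ≤ m) : ∃ E : ℤ → ℝ,
    (∀ i j : ℤ, i.sign = j.sign → (Even i ↔ Even j) → E i = E j) ∧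
    (∀ j : ℤ, E j ≠ 0) ∧
    (fun j : ℤ => coeffGamma m j) ~[cofinite]
      (fun j : ℤ => (-1 : ℝ) ^ ((j.natAbs + 1) / 2) * E j *
        (Real.exp (-(alpha0 m * (((j.natAbs + 1) / 2 : ℕ) : ℝ))) /
          Real.sqrt (((j.natAbs + 1) / 2 : ℕ) : ℝ))) := by
  -- The shifts 0 and -1 serve j = 2r and j = 2r - 1; the shifts 2 - m and 1 - m are what
  -- `coeffGamma_neg` makes of j = -2r and j = -(2r - 1). In all four cases r = [(|j|+1)/2].
  obtain ⟨X₁, hX₁, h₁⟩ := tendsto_coeffGamma m hm 0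
  obtain ⟨X₂, hX₂, h₂⟩ := tendsto_coeffGamma m hm (-1)
  simp only [← sub_eq_add_neg] at h₂
  obtain ⟨X₃, hX₃, h₃⟩ := tendsto_coeffGamma m hm (2 - m)
  obtain ⟨X₄, hX₄, h₄⟩ := tendsto_coeffGamma m hm (1 - m)
  have hσ : (-1 : ℝ) ^ m ≠ 0 := pow_ne_zero _ (by norm_num)
  replace h₃ : Tendsto (fun r : ℕ => coeffGamma m (-(2 * r)) * Real.sqrt (r + 1) /
      efRoot m (m - 1) ^ r) atTop (𝓝 ((-1) ^ m * X₃)) := by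
    refine (h₃.const_mul ((-1) ^ m)).congr fun r => ?_
    rw [coeffGamma_neg m hm, show 2 * (r : ℤ) + 2 - m = 2 * r + (2 - m) by ring]
    ring
  replace h₄ : Tendsto (fun r : ℕ => coeffGamma m (-(2 * r - 1)) * Real.sqrt (r + 1) /
      efRoot m (m - 1) ^ r) atTop (𝓝 ((-1) ^ m * X₄)) := by
    refine (h₄.const_mul ((-1) ^ m)).congr fun r => ?_
    rw [coeffGamma_neg m hm, show 2 * (r : ℤ) - 1 + 2 - m = 2 * r + (1 - m) by ring]
    ring
  -- j = 0 falls into the second branch, where only nonvanishing matters.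
  let E : ℤ → ℝ := fun j => if j.sign = 1 then (if Even j then X₁ else X₂) else
    (if Even j then (-1) ^ m * X₃ else (-1) ^ m * X₄)
  have hE : ∀ j, E j ≠ 0 := fun j => by
    simp only [E]
    split_ifs
    exacts [hX₁, hX₂, mul_ne_zero hσ hX₃, mul_ne_zero hσ hX₄]
  refine ⟨E, fun i j hs he => by simp only [E, hs, he], hE, ?_⟩
  rw [isEquivalent_iff_tendsto_one]
  · have hpos : ∀ᶠ r : ℕ in atTop, 0 < r := eventually_gt_atTop 0
    refine tendsto_int_cofinite ?_ ?_ ?_ ?_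
    · refine (ratio_tendsto_one m hm hX₁ (by simpa using h₁)).congr' ?_
      filter_upwards [hpos] with r hr
      have e1 : E (2 * r) = X₁ := by
        have h1 : (2 * (r : ℤ)).sign = 1 := Int.sign_eq_one_of_pos (by omega)
        have h2 : Even (2 * (r : ℤ)) := even_two_mul _
        simp only [E, h1, if_true, h2]
      have e2 : ((2 * (r : ℤ)).natAbs + 1) / 2 = r := by omega
      simp only [Pi.div_apply, e1, e2]
    · refine (ratio_tendsto_one m hm hX₂ h₂).congr' ?_
      filter_upwards [hpos] with r hr
      have e1 : E (2 * r - 1) = X₂ := by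
        have h1 : (2 * (r : ℤ) - 1).sign = 1 := Int.sign_eq_one_of_pos (by omega)
        have h2 : ¬ Even (2 * (r : ℤ) - 1) := by rw [Int.even_iff]; omega
        simp only [E, h1, if_true, h2, if_false]
      have e2 : ((2 * (r : ℤ) - 1).natAbs + 1) / 2 = r := by omega
      simp only [Pi.div_apply, e1, e2]
    · refine (ratio_tendsto_one m hm (mul_ne_zero hσ hX₃) h₃).congr' ?_
      filter_upwards [hpos] with r hr
      have e1 : E (-(2 * r)) = (-1) ^ m * X₃ := by
        have h1 : (-(2 * (r : ℤ))).sign ≠ 1 := by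
          rw [Int.sign_eq_neg_one_of_neg (by omega)]; norm_num
        have h2 : Even (-(2 * (r : ℤ))) := by rw [Int.even_iff]; omega
        simp only [E, h1, if_true, h2, if_false]
      have e2 : ((-(2 * (r : ℤ))).natAbs + 1) / 2 = r := by omega
      simp only [Pi.div_apply, e1, e2]
    · refine (ratio_tendsto_one m hm (mul_ne_zero hσ hX₄) h₄).congr' ?_
      filter_upwards [hpos] with r hr
      have e1 : E (-(2 * r - 1)) = (-1) ^ m * X₄ := by
        have h1 : (-(2 * (r : ℤ) - 1)).sign ≠ 1 := by
          rw [Int.sign_eq_neg_one_of_neg (by omega)]; norm_num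
        have h2 : ¬ Even (-(2 * (r : ℤ) - 1)) := by rw [Int.even_iff]; omega
        simp only [E, h1, h2, if_false]
      have e2 : ((-(2 * (r : ℤ) - 1)).natAbs + 1) / 2 = r := by omega
      simp only [Pi.div_apply, e1, e2]
  · have : ∀ᶠ j : ℤ in cofinite, j ≠ 0 := (Set.finite_singleton 0).eventually_cofinite_notMem
    filter_upwards [this] with j hj
    have hr : 0 < (j.natAbs + 1) / 2 := by omega
    have hs : 0 < Real.sqrt (((j.natAbs + 1) / 2 : ℕ) : ℝ) := Real.sqrt_pos.2 (by exact_mod_cast hr)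
    exact mul_ne_zero (mul_ne_zero (pow_ne_zero _ (by norm_num)) (hE j))
      (div_ne_zero (Real.exp_ne_zero _) hs.ne')

/-! ### The refinement equation and the spline expansion of ψ. -/

theorem summable_scalingConst (m : ℕ) (hm : 2 ≤ m) : Summable fun j => |scalingConst m j| :=
  (symAt_scalingConst m hm 0).summable

theorem scalingFun_eq_dilated (m : ℕ) (hm : 2 ≤ m) (x : ℝ) : scalingFun m x =
    ∑' n, dconv 2 (coeffC m) (maskSeq m) n * bspline m (2 * x - n) := by
  have hmask : Summable fun n => |maskSeq m n| := by
    have h := symAt_maskSeq m (Complex.exp ((0 : ℝ) * Complex.I))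
    exact SymAt.summable h
  have h := dconv_apply_bounded (summable_coeffC m hm) hmask 2 (B := fun n => bspline m (2 * x - n))
    (M := 1) fun n => abs_bspline_le _ _
  rw [← h.tsum_eq, scalingFun]
  refine tsum_congr fun k => ?_
  rw [← (hasSum_mask_bspline m (by omega) (x - k)).tsum_eq]
  congr 2
  funext i
  congr 2
  push_cast
  ring

/-- In symbols √P(θ) · √P(θ) cancels P(θ), leaving the two-scale mask over √P(2θ); this is the
refinement equation at the level of spline coefficients. -/
theorem dconv_scalingConst_coeffC (m : ℕ) (hm : 2 ≤ m) :
    dconv 1 (scalingConst m) (coeffC m) = dconv 2 (coeffC m) (maskSeq m) := by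
  refine SymAt.unique (F := fun θ => ((1 / Real.sqrt (Pcos m (2 * θ)) : ℝ) : ℂ) *
    (((1 / 2) ^ (m - 1) : ℝ) * (1 + Complex.exp (θ * Complex.I)) ^ m)) (fun θ => ?_) fun θ => ?_
  · have h := SymAt.dconv (d := 1) (Complex.exp_ne_zero _)
      (by rw [zpow_one]; exact symAt_scalingConst m hm θ) (symAt_coeffC m hm θ)
    convert! h using 1
    have hp := Pcos_pos m (by omega) θ
    have hs : ((Real.sqrt (Pcos m θ) : ℝ) : ℂ) ≠ 0 := by
      exact_mod_cast (Real.sqrt_pos.2 hp).ne'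
    have h2 : (Pcos m θ : ℂ) = ((Real.sqrt (Pcos m θ) : ℝ) : ℂ) ^ 2 := by
      exact_mod_cast (Real.sq_sqrt hp.le).symm
    rw [h2]
    push_cast at hs ⊢
    field_simp
  · refine SymAt.dconv (Complex.exp_ne_zero _) ?_ (symAt_maskSeq m _)
    rw [exp_zpow]
    exact_mod_cast symAt_coeffC m hm (2 * θ)

theorem scalingFun_refinement (m : ℕ) (hm : 2 ≤ m) (x : ℝ) :
    HasSum (fun j : ℤ => scalingConst m j * scalingFun m (2 * x - j)) (scalingFun m x) := by
  have h := dconv_apply_bounded (summable_scalingConst m hm) (summable_coeffC m hm) 1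
    (B := fun n => bspline m (2 * x - n)) (M := 1) fun n => abs_bspline_le _ _
  rw [dconv_scalingConst_coeffC m hm, ← scalingFun_eq_dilated m hm] at h
  convert! h using 2 with j
  rw [scalingFun]
  congr 2
  funext k
  congr 2
  push_cast
  ring

theorem summable_modulated_scalingConst (m : ℕ) (hm : 2 ≤ m) :
    Summable fun j : ℤ => |(-1 : ℝ) ^ j * scalingConst m (1 - j)| :=
  (symAt_modulated_scalingConst m hm 0).summable

theorem summable_wavelet (m : ℕ) (hm : 2 ≤ m) (x : ℝ) : Summable fun j : ℤ =>
    (-1 : ℝ) ^ j * scalingConst m (1 - j) * scalingFun m (2 * x - j) := by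
  refine Summable.of_norm_bounded
    ((summable_modulated_scalingConst m hm).mul_right (∑' k, |coeffC m k|)) fun j => ?_
  rw [Real.norm_eq_abs, abs_mul]
  exact mul_le_mul_of_nonneg_left (abs_scalingFun_le m hm _) (abs_nonneg _)

theorem summable_coeffGamma_series (m : ℕ) (hm : 2 ≤ m) (j : ℤ) : Summable fun k : ℤ =>
    (-1 : ℝ) ^ k * scalingConst m (k - j + 1) * coeffC m k := by
  refine Summable.of_norm_bounded ((summable_coeffC m hm).mul_left (∑' k, |scalingConst m k|))
    fun k => ?_
  rw [Real.norm_eq_abs, abs_mul, abs_mul, abs_zpow, abs_neg, abs_one, one_zpow, one_mul]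
  gcongr
  exact (summable_scalingConst m hm).le_tsum _ fun _ _ => abs_nonneg _

/-- γ is the convolution of the modulated `scalingConst` with `coeffC`; the two orders of
convolution agree because symbols commute, and the double series in shifted splines is summed in the
other order. -/
theorem wavelet_hasSum (m : ℕ) (hm : 2 ≤ m) (x : ℝ) :
    HasSum (fun j : ℤ => coeffGamma m j * bspline m (2 * x - j)) (wavelet m x) := by
  have hγ : Summable fun j => |coeffGamma m j| := (symAt_coeffGamma m hm 0).summable
  have hs : Summable fun j : ℤ => coeffGamma m j * bspline m (2 * x - j) :=
    Summable.of_norm_bounded hγ fun j => by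
      rw [Real.norm_eq_abs, abs_mul]
      exact mul_le_of_le_one_right (abs_nonneg _) (abs_bspline_le _ _)
  have h := dconv_apply_bounded (summable_modulated_scalingConst m hm) (summable_coeffC m hm) 1
    (B := fun n => bspline m (2 * x - n)) (M := 1) fun n => abs_bspline_le _ _
  have hcomm : dconv 1 (fun j => (-1 : ℝ) ^ j * scalingConst m (1 - j)) (coeffC m) =
      coeffGamma m := by
    rw [coeffGamma_eq]
    refine SymAt.unique (fun θ => SymAt.dconv (Complex.exp_ne_zero _)
      (by rw [zpow_one]; exact symAt_modulated_scalingConst m hm θ) (symAt_coeffC m hm θ))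
      fun θ => ?_
    have h := SymAt.dconv (d := 1) (Complex.exp_ne_zero _)
      (by rw [zpow_one]; exact symAt_coeffC m hm θ) (symAt_modulated_scalingConst m hm θ)
    convert! h using 1
    exact mul_comm _ _
  rw [hcomm] at h
  have hw : wavelet m x = ∑' j, coeffGamma m j * bspline m (2 * x - j) := by
    rw [← h.tsum_eq, wavelet]
    refine tsum_congr fun j => ?_
    rw [scalingFun]
    congr 2
    funext k
    congr 2
    push_cast
    ring
  rw [hw]
  exact hs.hasSum

end BSplineWavelet

theorem theorem6p2 (m : ℕ) (hm : 2 ≤ m) :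
    -- `a_j` are the scaling constants of `φ_m`
    (∀ x : ℝ, HasSum (fun j : ℤ => scalingConst m j * scalingFun m (2 * x - (j : ℝ)))
      (scalingFun m x)) ∧
    -- the series defining `ψ_m` and `γ_j` converge absolutely
    (∀ x : ℝ, Summable (fun j : ℤ =>
      (-1 : ℝ) ^ j * scalingConst m (1 - j) * scalingFun m (2 * x - (j : ℝ)))) ∧
    (∀ j : ℤ, Summable (fun k : ℤ =>
      (-1 : ℝ) ^ k * scalingConst m (k - j + 1) * coeffC m k)) ∧
    -- `γ_j` are the coefficients of `ψ_m` in the B-spline basis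
    (∀ x : ℝ, HasSum (fun j : ℤ => coeffGamma m j * bspline m (2 * x - (j : ℝ)))
      (wavelet m x)) ∧
    -- the asymptotic behaviour as `|j| → ∞`
    (∃ E : ℤ → ℝ,
      (∀ i j : ℤ, i.sign = j.sign → (Even i ↔ Even j) → E i = E j) ∧
      (∀ j : ℤ, E j ≠ 0) ∧
      (fun j : ℤ => coeffGamma m j) ~[cofinite]
        (fun j : ℤ => (-1 : ℝ) ^ ((j.natAbs + 1) / 2) * E j *
          (Real.exp (-(alpha0 m * (((j.natAbs + 1) / 2 : ℕ) : ℝ))) /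
            Real.sqrt (((j.natAbs + 1) / 2 : ℕ) : ℝ)))) := by
  exact ⟨scalingFun_refinement m hm, summable_wavelet m hm, summable_coeffGamma_series m hm,
    wavelet_hasSum m hm, coeffGamma_isEquivalent m hm⟩
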